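/- Let $\mathbb{K}$ be a field of characteristic zero. Graded $\mathbb{K}$-modules are $\mathbb{Z}$-graded, signs follow the Koszul rule, and $s$ denotes the suspension, $(s\mathcal{V})_n=\mathcal{V}_{n-1}$. **The curved cooperad $u\mathscr{C}om^{¡}$.** Let $\mathcal{W}=\mathbb{K}\cdot s\mu\oplus\mathbb{K}\cdot s\xi$ be the graded $\mathbb{S}$-module with $s\mu$ in arity two and degree $1$, with trivial action of $\mathbb{S}_2$, and $s\xi$ in arity zero and degree $1$. Let $\mathbb{T}^c(\mathcal{W})$ be the cofree conilpotent graded cooperad on $\mathcal{W}$ (trees with vertices labelled by $\mathcal{W}$, with the decomposition given by degrafting), and let $\mathbb{T}^2(\mathcal{W})$ be its part spanned by the trees with two vertices. The operad $u\mathscr{C}om$ of unital commutative algebras has generators $\mu,\xi$ and relations $\mu\otimes(\mu\otimes 1)-\mu\otimes(1\otimes\mu)$, $\mu\otimes(\xi\otimes 1)-1$; accordingly let $s^2q\mathcal{R}\subset\mathbb{T}^2(\mathcal{W})$ be the sub-$\mathbb{S}$-module generated by $s\mu\otimes(s\mu\otimes 1)-s\mu\otimes(1\otimes s\mu)$ and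 $s\mu\otimes(s\xi\otimes 1)$. The graded cooperad underlying the curved Koszul dual $u\mathscr{C}om^{¡}$ is the final graded sub-cooperad of $\mathbb{T}^c(\mathcal{W})$ such that the composite $u\mathscr{C}om^{¡}\to\mathbb{T}^c(\mathcal{W})\to\mathbb{T}^2(\mathcal{W})/s^2q\mathcal{R}$ is zero. Its coderivation is zero, and its curvature $\theta$ is the map of degree $-2$ on its arity one part with $\theta(s\mu\otimes(s\xi\otimes 1))=-1$ which vanishes on trees with a number of vertices different from two. A $u\mathscr{C}om^{¡}$-coalgebra is a graded $\mathbb{K}$-module $\mathcal{D}$ with a coassociative and counital map $\Delta:\mathcal{D}\to u\mathscr{C}om^{¡}\circ\mathcal{D}$ of degree $0$ and a map $d:\mathcal{D}\to\mathcal{D}$ of degree $-1$ such that $\Delta d=(\mathrm{Id}\circ' d)\Delta$, where $\mathrm{Id}\circ' d$ applies $d$ to one factor of $\mathcal{D}$ at a time, and $d^2=(\theta\circ\mathrm{Id})\Delta$. Morphisms are the degree $0$ maps which commute with $\Delta$ and $d$. **Curved conilpotent Lie coalgebras.** A curved Lie coalgebra is a graded $\mathbb{K}$-module $\mathcal{C}$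 with a degree $0$ map $\delta:\mathcal{C}\to\mathcal{C}\otimes\mathcal{C}$, a degree $-1$ map $d:\mathcal{C}\to\mathcal{C}$ and a degree $-2$ map $\theta:\mathcal{C}\to\mathbb{K}$ such that, with $\tau(x\otimes y)=(-1)^{|x||y|}y\otimes x$, $$\tau\delta=-\delta,\qquad (\delta\otimes \mathrm{Id})\delta=(\mathrm{Id}\otimes\delta)\delta+(\mathrm{Id}\otimes\tau)(\delta\otimes\mathrm{Id})\delta,$$ $$\delta d=(d\otimes\mathrm{Id}+\mathrm{Id}\otimes d)\delta,\qquad d^2=(\theta\otimes\mathrm{Id}-\mathrm{Id}\otimes\theta)\delta,\qquad \theta d=0 .$$ It is conilpotent if for every $x\in\mathcal{C}$ there is an $n$ such that every composite of maps $\mathrm{Id}\otimes\cdots\otimes\delta\otimes\cdots\otimes\mathrm{Id}$ in which $\delta$ appears $n$ times vanishes at $x$. Let $\mathsf{cLieCog}$ be the category of curved conilpotent Lie coalgebras, with the degree $0$ maps commuting with $\delta$, $d$ and $\theta$ as morphisms. **Proposition.** The suspension $\mathcal{V}\mapsto s\mathcal{V}$ induces an equivalence between the category of $u\mathscr{C}om^{¡}$-coalgebras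 and $\mathsf{cLieCog}$: there is an equivalence of categories $E:u\mathscr{C}om^{¡}\text{-}\mathsf{cog}\to\mathsf{cLieCog}$ such that the underlying graded module of $E(\mathcal{D})$ is naturally isomorphic to $s\mathcal{D}$. -/

import Mathlib

open CategoryTheory TensorProduct

universe u v w

namespace CurvedKoszul

/-- The sign `(-1) ^ n`, as an element of `K`. -/
def sgn (K : Type u) [Field K] (n : ℤ) : K := ((n.negOnePow : ℤˣ) : ℤ)

section Sign

variable {K : Type u} [Field K]

theorem sgn_add (m n : ℤ) : sgn K (m + n) = sgn K m * sgn K n := by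
  simp [sgn, Int.negOnePow_add]

theorem sgn_mul_self (m : ℤ) : sgn K m * sgn K m = 1 := by
  rw [← sgn_add, sgn, Int.negOnePow_even _ ⟨m, rfl⟩]
  simp

theorem sgn_zero : sgn K 0 = 1 := by simp [sgn]

theorem sgn_one : sgn K 1 = -1 := by simp [sgn]

theorem sgn_neg (m : ℤ) : sgn K (-m) = sgn K m := by simp [sgn]

end Sign

/-! ### Graded modules -/

/-- A `ℤ`-graded `K`-module (graded internally). -/
structure GMod (K : Type u) [Field K] where
  carrier : Type v
  [addCommGroup : AddCommGroup carrier]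
  [module : Module K carrier]
  gr : ℤ → Submodule K carrier
  isInternal : DirectSum.IsInternal gr

namespace GMod

instance {K : Type u} [Field K] : CoeSort (GMod.{u, v} K) (Type v) := ⟨GMod.carrier⟩

attribute [instance] GMod.addCommGroup GMod.module

variable {K : Type u} [Field K]

/-- A morphism of graded modules: a linear map of degree `0`. -/
@[ext]
structure Hom (V W : GMod.{u, v} K) where
  toLin : V →ₗ[K] W
  map_mem : ∀ {n : ℤ} {x : V}, x ∈ V.gr n → toLin x ∈ W.gr n

instance : Category.{v} (GMod.{u, v} K) where
  Hom := Hom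
  id V := ⟨LinearMap.id, fun h => h⟩
  comp f g := ⟨g.toLin ∘ₗ f.toLin, fun h => g.map_mem (f.map_mem h)⟩

/-- `V` as the direct sum of its homogeneous components. -/
noncomputable def decomp (V : GMod.{u, v} K) :
    (DirectSum ℤ fun n => V.gr n) ≃ₗ[K] V :=
  LinearEquiv.ofBijective (DirectSum.coeLinearMap V.gr) V.isInternal

theorem decomp_lof (V : GMod.{u, v} K) {n : ℤ} (x : V.gr n) :
    V.decomp (DirectSum.lof K ℤ (fun n => V.gr n) n x) = x :=
  DirectSum.coeLinearMap_lof _ _ _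

theorem decomp_symm_apply (V : GMod.{u, v} K) {n : ℤ} {x : V} (hx : x ∈ V.gr n) :
    V.decomp.symm x = DirectSum.lof K ℤ (fun n => V.gr n) n ⟨x, hx⟩ := by
  rw [LinearEquiv.symm_apply_eq, decomp_lof]

/-- The parity involution `x ↦ (-1) ^ |x| x`. -/
noncomputable def parity (V : GMod.{u, v} K) : V →ₗ[K] V :=
  DirectSum.toModule K ℤ V (fun n => sgn K n • (V.gr n).subtype) ∘ₗ V.decomp.symm.toLinearMap

theorem parity_apply (V : GMod.{u, v} K) {n : ℤ} {x : V} (hx : x ∈ V.gr n) :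
    V.parity x = sgn K n • x := by
  simp [parity, decomp_symm_apply V hx]

/-- The exchange map `x ⊗ y ↦ (-1) ^ (|x| |y|) y ⊗ x`. -/
noncomputable def swap (V : GMod.{u, v} K) : V ⊗[K] V →ₗ[K] V ⊗[K] V :=
  TensorProduct.map V.decomp.toLinearMap V.decomp.toLinearMap ∘ₗ
    (TensorProduct.gradedComm K (fun n => V.gr n) (fun n => V.gr n)).toLinearMap ∘ₗ
    TensorProduct.map V.decomp.symm.toLinearMap V.decomp.symm.toLinearMap

theorem swap_tmul (V : GMod.{u, v} K) {m n : ℤ} {x y : V} (hx : x ∈ V.gr m) (hy : y ∈ V.gr n) :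
    V.swap (x ⊗ₜ y) = sgn K (m * n) • (y ⊗ₜ x) := by
  simp only [swap, LinearMap.comp_apply, TensorProduct.map_tmul, LinearEquiv.coe_coe,
    decomp_symm_apply V hx, decomp_symm_apply V hy, TensorProduct.gradedComm_of_tmul_of]
  rw [Units.smul_def, map_zsmul, TensorProduct.map_tmul, ← Int.cast_smul_eq_zsmul K]
  simp only [LinearEquiv.coe_coe, decomp_lof, sgn, mul_comm m n, Int.negOnePow]

/-- The degree `n` part of `V ⊗ V`. -/
def tensorGr (V : GMod.{u, v} K) (n : ℤ) : Submodule K (V ⊗[K] V) :=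
  Submodule.span K {t | ∃ (p q : ℤ) (x y : V), p + q = n ∧ x ∈ V.gr p ∧ y ∈ V.gr q ∧ t = x ⊗ₜ y}

theorem shift_isInternal (V : GMod.{u, v} K) :
    DirectSum.IsInternal (fun n : ℤ => V.gr (n - 1)) := by
  have h := V.isInternal
  rw [DirectSum.isInternal_submodule_iff_iSupIndep_and_iSup_eq_top] at h ⊢
  refine ⟨h.1.comp (f := fun n : ℤ => n - 1) (fun a b hab => by simpa using hab), ?_⟩
  rw [← h.2]
  exact (Equiv.subRight (1 : ℤ)).iSup_comp (g := V.gr)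

/-- The suspension functor `V ↦ sV`, `(sV)ₙ = Vₙ₋₁`: the element `sx` of `sV` is represented by
`x`, placed one degree higher. -/
def suspension (K : Type u) [Field K] : GMod.{u, v} K ⥤ GMod.{u, v} K where
  obj V := { carrier := V, gr := fun n => V.gr (n - 1), isInternal := V.shift_isInternal }
  map f := ⟨f.toLin, fun h => f.map_mem h⟩

end GMod

/-! ### Curved conilpotent Lie coalgebras -/

section Iterate

variable {K : Type u} [Field K]

/-- The tensor power of `M` with one factor for each leaf of a planar binary tree, bracketed
according to the tree. -/
noncomputable def treeTensor (M : ModuleCat.{v} K) : BinaryTree Unit → ModuleCat.{v} K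
  | .nil => M
  | .node _ l r => ModuleCat.of K (treeTensor M l ⊗[K] treeTensor M r)

/-- The composite of the maps `Id ⊗ ⋯ ⊗ δ ⊗ ⋯ ⊗ Id` prescribed by a planar binary tree,
in which `δ` appears once for each inner vertex of the tree. Any composite of `n` such maps is of
this form for a tree with `n` inner vertices, since maps `δ` applied to different tensor factors
commute (`δ` has degree `0`). -/
noncomputable def iterCobracket (M : ModuleCat.{v} K) (δ : M →ₗ[K] M ⊗[K] M) :
    (S : BinaryTree Unit) → M →ₗ[K] treeTensor M S
  | .nil => LinearMap.id
  | .node _ l r => TensorProduct.map (iterCobracket M δ l) (iterCobracket M δ r) ∘ₗ δ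

end Iterate

/-- A curved conilpotent Lie coalgebra. -/
structure CLieCog (K : Type u) [Field K] where
  V : GMod.{u, v} K
  δ : V →ₗ[K] V ⊗[K] V
  d : V →ₗ[K] V
  θ : V →ₗ[K] K
  δ_mem : ∀ {n : ℤ} {x : V}, x ∈ V.gr n → δ x ∈ V.tensorGr n
  d_mem : ∀ {n : ℤ} {x : V}, x ∈ V.gr n → d x ∈ V.gr (n - 1)
  /-- `θ` has degree `-2` -/
  θ_apply : ∀ {n : ℤ} {x : V}, x ∈ V.gr n → n ≠ 2 → θ x = 0
  antisymm : V.swap ∘ₗ δ = -δ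
  /-- `(δ ⊗ Id) δ = (Id ⊗ δ) δ + (Id ⊗ τ) (δ ⊗ Id) δ` -/
  coJacobi :
    (TensorProduct.assoc K V V V).toLinearMap ∘ₗ δ.rTensor V ∘ₗ δ =
      δ.lTensor V ∘ₗ δ +
        V.swap.lTensor V ∘ₗ (TensorProduct.assoc K V V V).toLinearMap ∘ₗ δ.rTensor V ∘ₗ δ
  /-- `δ d = (d ⊗ Id + Id ⊗ d) δ`, where `(Id ⊗ d) (x ⊗ y) = (-1) ^ |x| x ⊗ d y` -/
  coderivation :
    δ ∘ₗ d = (TensorProduct.map d LinearMap.id + TensorProduct.map V.parity d) ∘ₗ δ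
  /-- `d² = (θ ⊗ Id - Id ⊗ θ) δ` -/
  curvature :
    d ∘ₗ d = ((TensorProduct.lid K V).toLinearMap ∘ₗ TensorProduct.map θ LinearMap.id -
      (TensorProduct.rid K V).toLinearMap ∘ₗ TensorProduct.map LinearMap.id θ) ∘ₗ δ
  θ_d : θ ∘ₗ d = 0
  /-- for every `x` there is an `n` such that every composite of maps `Id ⊗ ⋯ ⊗ δ ⊗ ⋯ ⊗ Id` in
  which `δ` appears `n` times vanishes at `x` -/
  conilpotent : ∀ x : V, ∃ n : ℕ, ∀ S : BinaryTree Unit, S.numNodes = n →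
    iterCobracket (ModuleCat.of K V) δ S x = 0

namespace CLieCog

variable {K : Type u} [Field K]

/-- A morphism of curved Lie coalgebras: a morphism of graded modules which commutes with the
structure maps. -/
@[ext]
structure Hom (C D : CLieCog.{u, v} K) where
  base : C.V ⟶ D.V
  comm_δ : D.δ ∘ₗ base.toLin = TensorProduct.map base.toLin base.toLin ∘ₗ C.δ
  comm_d : D.d ∘ₗ base.toLin = base.toLin ∘ₗ C.d
  comm_θ : D.θ ∘ₗ base.toLin = C.θ

instance : Category.{v} (CLieCog.{u, v} K) where
  Hom := Hom
  id C :=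
    { base := 𝟙 C.V
      comm_δ := by
        change C.δ ∘ₗ LinearMap.id = TensorProduct.map LinearMap.id LinearMap.id ∘ₗ C.δ
        rw [TensorProduct.map_id]; rfl
      comm_d := rfl
      comm_θ := rfl }
  comp {C D E} f g :=
    { base := f.base ≫ g.base
      comm_δ := by
        change E.δ ∘ₗ g.base.toLin ∘ₗ f.base.toLin = TensorProduct.map
          (g.base.toLin ∘ₗ f.base.toLin) (g.base.toLin ∘ₗ f.base.toLin) ∘ₗ C.δ
        rw [TensorProduct.map_comp, ← LinearMap.comp_assoc, g.comm_δ, LinearMap.comp_assoc,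
          f.comm_δ, LinearMap.comp_assoc]
      comm_d := by
        change E.d ∘ₗ g.base.toLin ∘ₗ f.base.toLin = (g.base.toLin ∘ₗ f.base.toLin) ∘ₗ C.d
        rw [← LinearMap.comp_assoc, g.comm_d, LinearMap.comp_assoc, f.comm_d,
          LinearMap.comp_assoc]
      comm_θ := by
        change E.θ ∘ₗ g.base.toLin ∘ₗ f.base.toLin = C.θ
        rw [← LinearMap.comp_assoc, g.comm_θ, f.comm_θ] }

/-- The underlying graded module. -/
def forget (K : Type u) [Field K] : CLieCog.{u, v} K ⥤ GMod.{u, v} K where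
  obj C := C.V
  map f := f.base

end CLieCog

/-! ### Trees

`W = K·sμ ⊕ K·sξ` is the graded `𝕊`-module with `sμ` in arity two and degree `1`, with trivial
action of `𝕊₂`, and `sξ` in arity zero and degree `1`. -/

/-- Planar trees whose vertices are labelled by `sμ` (`node`, two inputs) or `sξ` (`cork`, no
input), with leaves labelled by `L`. -/
inductive PTree (L : Type v) : Type v
  | leaf (x : L) : PTree L
  | cork : PTree L
  | node (a b : PTree L) : PTree L

namespace PTree

/-- Relabelling of the leaves. -/
def map {L : Type v} {M : Type w} (f : L → M) : PTree L → PTree M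
  | leaf x => leaf (f x)
  | cork => cork
  | node a b => node (map f a) (map f b)

/-- The labels of the leaves, in planar order. -/
def leaves {L : Type v} : PTree L → List L
  | leaf x => [x]
  | cork => []
  | node a b => leaves a ++ leaves b

/-- The number of vertices. -/
def numVert {L : Type v} : PTree L → ℤ
  | leaf _ => 0
  | cork => 1
  | node a b => numVert a + numVert b + 1

/-- A tree whose leaves are labelled by homogeneous elements is homogeneous; its degree is the
number of vertices plus the sum of the degrees of the labels. -/
inductive HasDeg {K : Type u} [Field K] {V : Type v} [AddCommGroup V] [Module K V]
    (gr : ℤ → Submodule K V) : PTree V → ℤ → Prop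
  | leaf {n : ℤ} {x : V} (h : x ∈ gr n) : HasDeg gr (leaf x) n
  | cork : HasDeg gr cork 1
  | node {m n : ℤ} {a b : PTree V} (ha : HasDeg gr a m) (hb : HasDeg gr b n) :
      HasDeg gr (node a b) (m + n + 1)

end PTree

section TreeModule

variable {K : Type u} [Field K] {V : Type v} [AddCommGroup V] [Module K V]

/-- The relations between planar trees with leaves labelled by elements of a graded module:
multilinearity in the labels, and `sμ(a, b) = (-1) ^ (|a| |b|) sμ(b, a)`, anywhere in a tree. -/
inductive TreeRel (gr : ℤ → Submodule K V) : (PTree V →₀ K) → Prop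
  | add (x y : V) : TreeRel gr (Finsupp.single (.leaf (x + y)) 1 -
      (Finsupp.single (.leaf x) 1 + Finsupp.single (.leaf y) 1))
  | smul (c : K) (x : V) : TreeRel gr (Finsupp.single (.leaf (c • x)) 1 -
      c • Finsupp.single (.leaf x) 1)
  | comm {m n : ℤ} {a b : PTree V} (ha : a.HasDeg gr m) (hb : b.HasDeg gr n) :
      TreeRel gr (Finsupp.single (.node a b) 1 -
        sgn K (m * n) • Finsupp.single (.node b a) 1)
  | left (b : PTree V) {r : PTree V →₀ K} (hr : TreeRel gr r) :
      TreeRel gr (Finsupp.lmapDomain K K (fun a => .node a b) r)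
  | right (a : PTree V) {r : PTree V →₀ K} (hr : TreeRel gr r) :
      TreeRel gr (Finsupp.lmapDomain K K (fun b => .node a b) r)

/-- `Trees gr` is the module `𝕋ᶜ(W) ∘ V` of trees with vertices labelled by `W = K·sμ ⊕ K·sξ` and
leaves labelled by the module `V`, graded by `gr`. A planar tree, read in prefix order, is a
tensor product of vertices and labels; this order fixes all Koszul signs. -/
def Trees (gr : ℤ → Submodule K V) : Type (max u v) :=
  (PTree V →₀ K) ⧸ Submodule.span K {r | TreeRel gr r}

noncomputable instance (gr : ℤ → Submodule K V) : AddCommGroup (Trees gr) :=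
  inferInstanceAs (AddCommGroup ((PTree V →₀ K) ⧸ Submodule.span K {r | TreeRel gr r}))

noncomputable instance (gr : ℤ → Submodule K V) : Module K (Trees gr) :=
  inferInstanceAs (Module K ((PTree V →₀ K) ⧸ Submodule.span K {r | TreeRel gr r}))

namespace Trees

variable (gr : ℤ → Submodule K V)

/-- The class of a linear combination of planar trees. -/
noncomputable def mkL : (PTree V →₀ K) →ₗ[K] Trees gr :=
  Submodule.mkQ (Submodule.span K {r | TreeRel gr r})

/-- The class of a planar tree. -/
noncomputable def mk (t : PTree V) : Trees gr := mkL gr (Finsupp.single t 1)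

variable {gr}

theorem mkL_rel {r : PTree V →₀ K} (hr : TreeRel gr r) : mkL gr r = 0 :=
  (Submodule.Quotient.mk_eq_zero _).2 (Submodule.subset_span hr)

theorem mkL_surjective : Function.Surjective (mkL gr) := Submodule.mkQ_surjective _

/-- Linear maps out of `Trees gr`. -/
noncomputable def desc {B : Type w} [AddCommGroup B] [Module K B] (f : (PTree V →₀ K) →ₗ[K] B)
    (hf : ∀ r, TreeRel gr r → f r = 0) : Trees gr →ₗ[K] B :=
  Submodule.liftQ _ f (Submodule.span_le.2 hf)

theorem desc_mkL {B : Type w} [AddCommGroup B] [Module K B] (f : (PTree V →₀ K) →ₗ[K] B)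
    (hf : ∀ r, TreeRel gr r → f r = 0) (r : PTree V →₀ K) : desc f hf (mkL gr r) = f r :=
  Submodule.liftQ_apply _ _ _

@[ext high]
theorem hom_ext {B : Type w} [AddCommGroup B] [Module K B] {f g : Trees gr →ₗ[K] B}
    (h : ∀ t, f (mk gr t) = g (mk gr t)) : f = g := by
  have : f ∘ₗ mkL gr = g ∘ₗ mkL gr := Finsupp.lhom_ext' fun t => LinearMap.ext_ring (h t)
  refine LinearMap.ext fun x => ?_
  obtain ⟨r, rfl⟩ := mkL_surjective x
  exact LinearMap.congr_fun this r

/-- The trivial tree labelled by `x`. -/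
noncomputable def ι : V →ₗ[K] Trees gr where
  toFun x := mk gr (.leaf x)
  map_add' x y := by
    have := mkL_rel (gr := gr) (.add x y)
    rwa [map_sub, map_add, sub_eq_zero] at this
  map_smul' c x := by
    have := mkL_rel (gr := gr) (.smul c x)
    rwa [map_sub, map_smul, sub_eq_zero] at this

/-- `a ↦ sμ(a, b)` for a planar tree `b`. -/
noncomputable def nodeAux (b : PTree V) : Trees gr →ₗ[K] Trees gr :=
  desc (mkL gr ∘ₗ Finsupp.lmapDomain K K (fun a => .node a b)) fun _ hr => mkL_rel (.left b hr)

theorem nodeAux_mk (a b : PTree V) : nodeAux b (mk gr a) = mk gr (.node a b) := by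
  rw [nodeAux, mk, desc_mkL]
  simp [mk]

/-- Grafting: `(a, b) ↦ sμ(a, b)`. -/
noncomputable def node : Trees gr →ₗ[K] Trees gr →ₗ[K] Trees gr :=
  (desc (Finsupp.linearCombination K (fun b => nodeAux (gr := gr) b)) fun r hr => by
    ext a
    have key : ∀ r : PTree V →₀ K,
        (Finsupp.linearCombination K (fun b => nodeAux (gr := gr) b) r) (mk gr a) =
          mkL gr (Finsupp.lmapDomain K K (fun b => .node a b) r) := by
      intro r
      induction r using Finsupp.induction_linear with
      | zero => simp
      | add f g hf hg => simp only [map_add, LinearMap.add_apply, hf, hg]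
      | single b c =>
        rw [Finsupp.linearCombination_single, LinearMap.smul_apply, nodeAux_mk,
          Finsupp.lmapDomain_apply, Finsupp.mapDomain_single, mk, ← map_smul,
          Finsupp.smul_single, smul_eq_mul, mul_one]
    rw [key, mkL_rel (.right a hr)]
    rfl).flip

theorem node_mk (a b : PTree V) : node (mk gr a) (mk gr b) = mk gr (.node a b) := by
  rw [node, LinearMap.flip_apply, ← nodeAux_mk]
  conv_lhs => rw [mk.eq_def gr b]
  rw [desc_mkL]
  simp

variable (gr)

/-- The degree `n` part of `Trees gr`. -/
noncomputable def deg (n : ℤ) : Submodule K (Trees gr) :=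
  Submodule.span K {x | ∃ t : PTree V, t.HasDeg gr n ∧ x = mk gr t}

end Trees

/-- An algebra over the graded free operad `𝕋(W)`: a module with a grading, an element of
degree `1` and a graded symmetric product of degree `1`. -/
structure TreeAlg (K : Type u) [Field K] {B : Type w} [AddCommGroup B] [Module K B]
    (gr : ℤ → Submodule K B) where
  cork : B
  node : B →ₗ[K] B →ₗ[K] B
  cork_mem : cork ∈ gr 1
  node_mem : ∀ {m n : ℤ} {a b : B}, a ∈ gr m → b ∈ gr n → node a b ∈ gr (m + n + 1)
  node_comm : ∀ {m n : ℤ} {a b : B}, a ∈ gr m → b ∈ gr n → node a b = sgn K (m * n) • node b a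

namespace Trees

/-- `Trees gr` is a `𝕋(W)`-algebra. -/
noncomputable def free (gr : ℤ → Submodule K V) : TreeAlg K (deg gr) where
  cork := mk gr .cork
  node := node
  cork_mem := Submodule.subset_span ⟨_, .cork, rfl⟩
  node_mem {m n a b} ha hb := by
    refine Submodule.span_induction₂ (p := fun a b _ _ => node a b ∈ deg gr (m + n + 1))
      ?_ ?_ ?_ ?_ ?_ ?_ ?_ ha hb
    · rintro _ _ ⟨s, hs, rfl⟩ ⟨t, ht, rfl⟩
      rw [node_mk]
      exact Submodule.subset_span ⟨_, .node hs ht, rfl⟩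
    · intros; simp
    · intros; simp
    · intro x y z _ _ _ h₁ h₂
      rw [map_add, LinearMap.add_apply]; exact add_mem h₁ h₂
    · intro x y z _ _ _ h₁ h₂
      rw [map_add]; exact add_mem h₁ h₂
    · intro c x y _ _ h
      rw [map_smul, LinearMap.smul_apply]; exact Submodule.smul_mem _ _ h
    · intro c x y _ _ h
      rw [map_smul]; exact Submodule.smul_mem _ _ h
  node_comm {m n a b} ha hb := by
    refine Submodule.span_induction₂ (p := fun a b _ _ => node a b = sgn K (m * n) • node b a)
      ?_ ?_ ?_ ?_ ?_ ?_ ?_ ha hb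
    · rintro _ _ ⟨s, hs, rfl⟩ ⟨t, ht, rfl⟩
      have := mkL_rel (gr := gr) (.comm hs ht)
      rw [map_sub, map_smul, sub_eq_zero] at this
      rw [node_mk, node_mk]
      exact this
    · intros; simp
    · intros; simp
    · intro x y z _ _ _ h₁ h₂
      rw [map_add, map_add, LinearMap.add_apply, h₁, h₂, smul_add]
    · intro x y z _ _ _ h₁ h₂
      rw [map_add, map_add, LinearMap.add_apply, h₁, h₂, smul_add]
    · intro c x y _ _ h
      rw [map_smul, map_smul, LinearMap.smul_apply, h, smul_comm]
    · intro c x y _ _ h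
      rw [map_smul, map_smul, LinearMap.smul_apply, h, smul_comm]

variable {gr : ℤ → Submodule K V} {B : Type w} [AddCommGroup B] [Module K B]
  {grB : ℤ → Submodule K B}

/-- Evaluation of a planar tree in a `𝕋(W)`-algebra. -/
noncomputable def eval (A : TreeAlg K grB) (f : V → B) : PTree V → B
  | .leaf x => f x
  | .cork => A.cork
  | .node a b => A.node (eval A f a) (eval A f b)

theorem eval_mem (A : TreeAlg K grB) (f : V →ₗ[K] B) (hf : ∀ n, ∀ x ∈ gr n, f x ∈ grB n)
    {t : PTree V} {n : ℤ} (h : t.HasDeg gr n) : eval A f t ∈ grB n := by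
  induction h with
  | leaf h => exact hf _ _ h
  | cork => exact A.cork_mem
  | node _ _ iha ihb => exact A.node_mem iha ihb

/-- `Trees gr` is the free `𝕋(W)`-algebra on the graded module `V`: the extension of a degree `0`
map to a morphism of `𝕋(W)`-algebras. -/
noncomputable def lift (A : TreeAlg K grB) (f : V →ₗ[K] B)
    (hf : ∀ n, ∀ x ∈ gr n, f x ∈ grB n) : Trees gr →ₗ[K] B :=
  desc (Finsupp.linearCombination K (eval A f)) fun r hr => by
    induction hr with
    | add x y => simp [eval]
    | smul c x => simp [eval]
    | comm ha hb =>
      simp only [map_sub, map_smul, Finsupp.linearCombination_single, one_smul, eval]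
      rw [A.node_comm (eval_mem A f hf ha) (eval_mem A f hf hb), sub_self]
    | left b _ ih =>
      rename_i r _
      have key : Finsupp.linearCombination K (eval A f) ∘ₗ
          Finsupp.lmapDomain K K (fun a => .node a b) =
          A.node.flip (eval A f b) ∘ₗ Finsupp.linearCombination K (eval A f) :=
        Finsupp.lhom_ext fun a c => by simp [eval]
      have := LinearMap.congr_fun key r
      simp only [LinearMap.comp_apply, ih, map_zero] at this
      exact this
    | right a _ ih =>
      rename_i r _
      have key : Finsupp.linearCombination K (eval A f) ∘ₗ
          Finsupp.lmapDomain K K (fun b => .node a b) =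
          A.node (eval A f a) ∘ₗ Finsupp.linearCombination K (eval A f) :=
        Finsupp.lhom_ext fun b c => by simp [eval]
      have := LinearMap.congr_fun key r
      simp only [LinearMap.comp_apply, ih, map_zero] at this
      exact this

section

variable (A : TreeAlg K grB) (f : V →ₗ[K] B) (hf : ∀ n, ∀ x ∈ gr n, f x ∈ grB n)

theorem lift_mk (t : PTree V) : lift A f hf (mk gr t) = eval A f t := by
  rw [lift, mk, desc_mkL]
  simp

theorem lift_ι (x : V) : lift A f hf (ι x) = f x := lift_mk A f hf (.leaf x)

theorem lift_cork : lift A f hf (free gr).cork = A.cork := lift_mk A f hf .cork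

theorem lift_node (a b : Trees gr) :
    lift A f hf ((free gr).node a b) = A.node (lift A f hf a) (lift A f hf b) := by
  have : (free gr).node.compr₂ (lift A f hf) =
      A.node.compl₁₂ (lift A f hf) (lift A f hf) := by
    ext s t
    simp only [free, LinearMap.compr₂_apply, LinearMap.compl₁₂_apply, node_mk, lift_mk, eval]
  exact LinearMap.congr_fun (LinearMap.congr_fun this a) b

theorem lift_mem {n : ℤ} {x : Trees gr} (hx : x ∈ deg gr n) : lift A f hf x ∈ grB n := by
  have : deg gr n ≤ (grB n).comap (lift A f hf) := by
    refine Submodule.span_le.2 ?_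
    rintro _ ⟨t, ht, rfl⟩
    rw [SetLike.mem_coe, Submodule.mem_comap, lift_mk]
    exact eval_mem A f hf ht
  exact this hx

end

theorem ι_mem {n : ℤ} {x : V} (hx : x ∈ gr n) : ι x ∈ deg gr n :=
  Submodule.subset_span ⟨_, .leaf hx, rfl⟩

/-- The map `Id ∘ f` induced by a degree `0` map `f`. -/
noncomputable def map (f : V →ₗ[K] B) (hf : ∀ n, ∀ x ∈ gr n, f x ∈ grB n) :
    Trees gr →ₗ[K] Trees grB :=
  lift (free grB) (ι ∘ₗ f) fun n x hx => ι_mem (hf n x hx)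

theorem map_mk (f : V →ₗ[K] B) (hf : ∀ n, ∀ x ∈ gr n, f x ∈ grB n) (t : PTree V) :
    map f hf (mk gr t) = mk grB (t.map f) := by
  rw [map, lift_mk]
  induction t with
  | leaf x => rfl
  | cork => rfl
  | node a b iha ihb =>
    rw [eval, iha, ihb]
    exact node_mk _ _

theorem map_id : map (gr := gr) (grB := gr) LinearMap.id (fun _ _ h => h) = LinearMap.id := by
  ext t
  rw [map_mk, LinearMap.id_apply]
  congr 1
  induction t with
  | leaf x => rfl
  | cork => rfl
  | node a b iha ihb => simp only [PTree.map, iha, ihb]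

theorem map_comp {B' : Type*} [AddCommGroup B'] [Module K B'] {grB' : ℤ → Submodule K B'}
    (f : V →ₗ[K] B) (hf : ∀ n, ∀ x ∈ gr n, f x ∈ grB n)
    (g : B →ₗ[K] B') (hg : ∀ n, ∀ x ∈ grB n, g x ∈ grB' n) :
    map g hg ∘ₗ map f hf = map (g ∘ₗ f) (fun n x h => hg n _ (hf n x h)) := by
  ext t
  rw [LinearMap.comp_apply, map_mk, map_mk, map_mk]
  congr 1
  induction t with
  | leaf x => rfl
  | cork => rfl
  | node a b iha ihb => simp only [PTree.map, iha, ihb]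

/-- The auxiliary `𝕋(W)`-algebra which defines the degrafting of trees. -/
noncomputable def decompAlg (gr : ℤ → Submodule K V) :
    TreeAlg K (fun n => (deg gr n).prod (deg (deg gr) n)) where
  cork := ((free gr).cork, ι (free gr).cork + (free (deg gr)).cork)
  node := LinearMap.mk₂ K (fun a b => ((free gr).node a.1 b.1,
      ι ((free gr).node a.1 b.1) + (free (deg gr)).node a.2 b.2))
    (fun a a' b => by ext <;> simp; abel) (fun c a b => by ext <;> simp)
    (fun a b b' => by ext <;> simp; abel) (fun c a b => by ext <;> simp)
  cork_mem := Submodule.mem_prod.2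
    ⟨(free gr).cork_mem, add_mem (ι_mem (free gr).cork_mem) (free (deg gr)).cork_mem⟩
  node_mem ha hb := by
    rw [Submodule.mem_prod] at ha hb ⊢
    exact ⟨(free gr).node_mem ha.1 hb.1, add_mem (ι_mem ((free gr).node_mem ha.1 hb.1))
      ((free (deg gr)).node_mem ha.2 hb.2)⟩
  node_comm {m n a b} ha hb := by
    rw [Submodule.mem_prod] at ha hb
    simp only [LinearMap.mk₂_apply, Prod.smul_mk, smul_add, ← map_smul,
      ← (free gr).node_comm ha.1 hb.1, ← (free (deg gr)).node_comm ha.2 hb.2]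

/-- Auxiliary map: the identity together with the degrafting. -/
noncomputable def decompPair (gr : ℤ → Submodule K V) :
    Trees gr →ₗ[K] Trees gr × Trees (deg gr) :=
  lift (decompAlg gr) (LinearMap.prod ι (ι ∘ₗ ι))
    (fun _ _ hx => Submodule.mem_prod.2 ⟨ι_mem hx, ι_mem (ι_mem hx)⟩)

theorem decompPair_fst (a : Trees gr) : (decompPair gr a).1 = a := by
  have : LinearMap.fst K _ _ ∘ₗ decompPair gr = LinearMap.id := by
    ext t
    induction t with
    | leaf x => rw [LinearMap.comp_apply, decompPair, lift_mk]; rfl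
    | cork => rw [LinearMap.comp_apply, decompPair, lift_mk]; rfl
    | node a b iha ihb =>
      have h : mk gr (.node a b) = (free gr).node (mk gr a) (mk gr b) := (node_mk a b).symm
      rw [h, LinearMap.comp_apply, decompPair, lift_node]
      change (free gr).node (decompPair gr (mk gr a)).1 (decompPair gr (mk gr b)).1 = _
      rw [LinearMap.comp_apply, LinearMap.fst_apply] at iha ihb
      rw [iha, ihb]
      rfl
  exact LinearMap.congr_fun this a

/-- The map `Δ ∘ Id : 𝕋ᶜ(W) ∘ V → 𝕋ᶜ(W) ∘ 𝕋ᶜ(W) ∘ V` given by the decomposition of the cofree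
conilpotent cooperad `𝕋ᶜ(W)`: the sum over all ways to cut a tree into a bottom tree whose leaves
are labelled by the top trees. -/
noncomputable def decomp (gr : ℤ → Submodule K V) : Trees gr →ₗ[K] Trees (deg gr) :=
  LinearMap.snd K _ _ ∘ₗ decompPair gr

theorem decomp_ι (x : V) : decomp gr (ι x) = ι (ι x) := by
  rw [decomp, LinearMap.comp_apply, decompPair, lift_ι]; rfl

theorem decomp_cork : decomp gr (free gr).cork = ι (free gr).cork + (free (deg gr)).cork := by
  rw [decomp, LinearMap.comp_apply, decompPair, lift_cork]; rfl

/-- Degrafting of `sμ(a, b)`: either the cut is below the bottom vertex, or it goes through `a`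
and `b`. -/
theorem decomp_node (a b : Trees gr) : decomp gr ((free gr).node a b) =
    ι ((free gr).node a b) + (free (deg gr)).node (decomp gr a) (decomp gr b) := by
  rw [decomp, LinearMap.comp_apply, decompPair, lift_node]
  change ι ((free gr).node (decompPair gr a).1 (decompPair gr b).1) + _ = _
  rw [decompPair_fst, decompPair_fst]
  rfl

/-- The map `ε ∘ Id : 𝕋ᶜ(W) ∘ V → V`: the projection on the trivial tree. -/
noncomputable def counit (gr : ℤ → Submodule K V) : Trees gr →ₗ[K] V :=
  lift (grB := gr)
    { cork := 0
      node := 0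
      cork_mem := zero_mem _
      node_mem := fun _ _ => zero_mem _
      node_comm := fun _ _ => by simp } LinearMap.id (fun _ _ hx => hx)

/-- The auxiliary `𝕋(W)`-algebra which defines the weight. -/
noncomputable def weightAlg (gr : ℤ → Submodule K V) :
    TreeAlg K (fun n => Submodule.pi (Set.univ : Set ℕ) (fun _ => deg gr n)) where
  cork := Pi.single 1 (free gr).cork
  node := LinearMap.mk₂ K
    (fun f g => fun k => Nat.casesOn k 0 fun k =>
      ∑ p ∈ Finset.HasAntidiagonal.antidiagonal k, (free gr).node (f p.1) (g p.2))
    (fun f f' g => by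
      ext k; cases k with
      | zero => simp
      | succ k => simp [Finset.sum_add_distrib])
    (fun c f g => by
      ext k; cases k with
      | zero => simp
      | succ k => simp [Finset.smul_sum])
    (fun f g g' => by
      ext k; cases k with
      | zero => simp
      | succ k => simp [Finset.sum_add_distrib])
    (fun c f g => by
      ext k; cases k with
      | zero => simp
      | succ k => simp [Finset.smul_sum])
  cork_mem := by
    intro k _
    by_cases h : k = 1
    · subst h; simpa using (free gr).cork_mem
    · simp [h]
  node_mem {m n f g} ha hb := by
    intro k _
    cases k with
    | zero => exact zero_mem _
    | succ k =>
      exact Submodule.sum_mem (deg gr (m + n + 1)) (t := Finset.HasAntidiagonal.antidiagonal k)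
        (f := fun p : ℕ × ℕ => (free gr).node (f p.1) (g p.2))
        (fun p _ => (free gr).node_mem (ha p.1 trivial) (hb p.2 trivial))
  node_comm {m n a b} ha hb := by
    ext k
    cases k with
    | zero => simp
    | succ k =>
      simp only [LinearMap.mk₂_apply, Pi.smul_apply, Finset.smul_sum]
      rw [← Finset.Nat.sum_antidiagonal_swap]
      exact Finset.sum_congr rfl fun p _ =>
        (free gr).node_comm (ha _ trivial) (hb _ trivial)

/-- The projection of `𝕋(W) ∘ V` onto `𝕋ᵏ(W) ∘ V`, the trees with `k` vertices. -/
noncomputable def weight (gr : ℤ → Submodule K V) (k : ℕ) : Trees gr →ₗ[K] Trees gr :=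
  LinearMap.proj k ∘ₗ lift (weightAlg gr) (LinearMap.single K (fun _ : ℕ => Trees gr) 0 ∘ₗ ι)
    (fun n x hx => Submodule.mem_pi.2 fun j _ => by
      by_cases h : j = 0
      · subst h; simpa using ι_mem hx
      · simp [h])

end Trees

end TreeModule

namespace Trees

variable {K : Type u} [Field K]

/-- The involution `t ↦ (-1) ^ |t| t` of `𝕋(W) ∘ D`. -/
noncomputable def parity (D : GMod.{u, v} K) : Trees D.gr →ₗ[K] Trees D.gr :=
  lift (grB := deg D.gr)
    { cork := -(free D.gr).cork
      node := -(free D.gr).node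
      cork_mem := neg_mem (free D.gr).cork_mem
      node_mem := fun ha hb => neg_mem ((free D.gr).node_mem ha hb)
      node_comm := fun ha hb => by
        simp only [LinearMap.neg_apply, smul_neg, ← (free D.gr).node_comm ha hb] }
    (ι ∘ₗ D.parity)
    (fun _ _ hx => ι_mem (by rw [D.parity_apply hx]; exact Submodule.smul_mem _ _ hx))

theorem parity_apply (D : GMod.{u, v} K) {n : ℤ} {x : Trees D.gr} (hx : x ∈ deg D.gr n) :
    parity D x = sgn K n • x := by
  have : deg D.gr n ≤ LinearMap.eqLocus (parity D) (sgn K n • LinearMap.id) := by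
    refine Submodule.span_le.2 ?_
    rintro _ ⟨t, ht, rfl⟩
    simp only [SetLike.mem_coe, LinearMap.mem_eqLocus, LinearMap.smul_apply, LinearMap.id_apply]
    rw [parity, lift_mk]
    clear hx
    induction ht with
    | leaf h =>
      simp only [eval, LinearMap.comp_apply, D.parity_apply h, map_smul]
      rfl
    | cork =>
      simp only [eval, sgn_one, neg_one_smul]
      rfl
    | node ha hb iha ihb =>
      simp only [eval, iha, ihb, map_smul, LinearMap.neg_apply, LinearMap.smul_apply, sgn_add,
        sgn_one, smul_neg, mul_neg, mul_one, neg_smul, smul_smul]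
      rw [← node_mk, mul_comm]
      rfl
  exact this hx

/-- The auxiliary `𝕋(W)`-algebra which defines `Id ∘' d`. -/
noncomputable def derAlg (D : GMod.{u, v} K) :
    TreeAlg K (fun n => (deg D.gr n).prod (deg D.gr (n - 1))) where
  cork := ((free D.gr).cork, 0)
  node := LinearMap.mk₂ K (fun a b => ((free D.gr).node a.1 b.1,
      -(free D.gr).node a.2 b.1 - (free D.gr).node (parity D a.1) b.2))
    (fun a a' b => by ext <;> simp; abel) (fun c a b => by ext <;> simp [smul_sub])
    (fun a b b' => by ext <;> simp; abel) (fun c a b => by ext <;> simp [smul_sub])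
  cork_mem := Submodule.mem_prod.2 ⟨(free D.gr).cork_mem, zero_mem _⟩
  node_mem {m n a b} ha hb := by
    rw [Submodule.mem_prod] at ha hb ⊢
    refine ⟨(free D.gr).node_mem ha.1 hb.1, sub_mem (neg_mem ?_) ?_⟩
    · have := (free D.gr).node_mem ha.2 hb.1
      rwa [show m - 1 + n + 1 = m + n + 1 - 1 by ring] at this
    · rw [parity_apply D ha.1, map_smul, LinearMap.smul_apply]
      have := (free D.gr).node_mem ha.1 hb.2
      rw [show m + (n - 1) + 1 = m + n + 1 - 1 by ring] at this
      exact Submodule.smul_mem _ _ this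
  node_comm {m n a b} ha hb := by
    rw [Submodule.mem_prod] at ha hb
    have h1 : sgn K ((m - 1) * n) = sgn K (m * n) * sgn K n := by
      rw [← sgn_neg n, ← sgn_add]; congr 1; ring
    have h2 : sgn K (m * (n - 1)) = sgn K (m * n) * sgn K m := by
      rw [← sgn_neg m, ← sgn_add]; congr 1; ring
    simp only [LinearMap.mk₂_apply, Prod.smul_mk, Prod.mk.injEq]
    refine ⟨(free D.gr).node_comm ha.1 hb.1, ?_⟩
    rw [parity_apply D ha.1, parity_apply D hb.1, (free D.gr).node_comm ha.2 hb.1, map_smul,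
      LinearMap.smul_apply, (free D.gr).node_comm ha.1 hb.2, h1, h2, map_smul,
      LinearMap.smul_apply, smul_sub, smul_neg, smul_smul, smul_smul, mul_comm (sgn K m),
      mul_assoc, sgn_mul_self, mul_one]
    abel

/-- The map `Id ∘' d` on `𝕋ᶜ(W) ∘ D`, for a map `d : D → D` of degree `-1`: the sum over all leaves
of the application of `d` to the label, with Koszul signs. -/
noncomputable def der (D : GMod.{u, v} K) (d : D →ₗ[K] D)
    (hd : ∀ n, ∀ x ∈ D.gr n, d x ∈ D.gr (n - 1)) : Trees D.gr →ₗ[K] Trees D.gr :=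
  LinearMap.snd K _ _ ∘ₗ lift (derAlg D) (LinearMap.prod ι (ι ∘ₗ d))
    (fun n x hx => Submodule.mem_prod.2 ⟨ι_mem hx, ι_mem (hd n x hx)⟩)

/-- The auxiliary `𝕋(W)`-algebra which defines the curvature. The three components of the image of
a tree are the coefficient of `sξ`, the image by `ε ∘ Id`, and the image by `θ ∘ Id`. -/
noncomputable def curvAlg (D : GMod.{u, v} K) :
    TreeAlg K (fun n => (if n = 1 then ⊤ else ⊥ : Submodule K K).prod
      ((D.gr n).prod (D.gr (n - 2)))) where
  cork := (1, 0, 0)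
  node := LinearMap.mk₂ K (fun a b => (0, 0, -(a.1 • b.2.1 + b.1 • D.parity a.2.1)))
    (fun a a' b => by ext <;> simp [add_smul]; abel)
    (fun c a b => by ext <;> simp [smul_smul, smul_add, mul_comm])
    (fun a b b' => by ext <;> simp [add_smul]; abel)
    (fun c a b => by ext <;> simp [smul_smul, smul_add, mul_comm])
  cork_mem := by simp [Submodule.mem_prod]
  node_mem {m n a b} ha hb := by
    simp only [Submodule.mem_prod] at ha hb ⊢
    refine ⟨zero_mem _, zero_mem _, neg_mem (add_mem ?_ ?_)⟩
    · by_cases h : m = 1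
      · subst h
        rw [show 1 + n + 1 - 2 = n by ring]
        exact Submodule.smul_mem _ _ hb.2.1
      · have : a.1 = 0 := by simpa [h] using ha.1
        simp [this]
    · by_cases h : n = 1
      · subst h
        rw [show m + 1 + 1 - 2 = m by ring, D.parity_apply ha.2.1]
        exact Submodule.smul_mem _ _ (Submodule.smul_mem _ _ ha.2.1)
      · have : b.1 = 0 := by simpa [h] using hb.1
        simp [this]
  node_comm {m n a b} ha hb := by
    simp only [Submodule.mem_prod] at ha hb
    simp only [LinearMap.mk₂_apply, Prod.smul_mk, smul_zero, Prod.mk.injEq, true_and]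
    rw [smul_neg, smul_add, add_comm]
    congr 2
    · by_cases h : n = 1
      · subst h
        rw [D.parity_apply ha.2.1, mul_one, smul_comm]
      · have : b.1 = 0 := by simpa [h] using hb.1
        simp [this]
    · by_cases h : m = 1
      · subst h
        rw [D.parity_apply hb.2.1, one_mul, smul_comm, smul_smul (sgn K n), sgn_mul_self,
          one_smul]
      · have : a.1 = 0 := by simpa [h] using ha.1
        simp [this]

/-- The map `θ ∘ Id : 𝕋ᶜ(W) ∘ D → D`, where `θ` is the map of degree `-2` which sends the tree
`sμ ⊗ (sξ ⊗ 1)` to `-1` and the trees in arity one with a number of vertices different from two to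
`0`. -/
noncomputable def curv (D : GMod.{u, v} K) : Trees D.gr →ₗ[K] D :=
  (LinearMap.snd K _ _ ∘ₗ LinearMap.snd K _ _) ∘ₗ
    lift (curvAlg D) (LinearMap.prod 0 (LinearMap.prod LinearMap.id 0))
      (fun _ _ hx => Submodule.mem_prod.2 ⟨zero_mem _, Submodule.mem_prod.2 ⟨hx, zero_mem _⟩⟩)

end Trees

/-! ### Operations on trees -/

section Operations

variable {K : Type u} [Field K]

/-- The module `K ⊕ ⋯ ⊕ K` with `n` summands, concentrated in degree `0`. -/
def stdGr (K : Type u) [Field K] (n : ℕ) : ℤ → Submodule K (Fin n → K) :=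
  fun m => if m = 0 then ⊤ else ⊥

/-- `𝕋(W) ∘ (K e₁ ⊕ ⋯ ⊕ K eₙ)`: trees with leaves labelled by the formal inputs `e₁, …, eₙ`. -/
abbrev StdTrees (K : Type u) [Field K] (n : ℕ) : Type u := Trees (stdGr K n)

/-- The `i`-th formal input. -/
def inp (K : Type u) [Field K] {n : ℕ} (i : Fin n) : Fin n → K := Pi.single i 1

/-- A planar tree whose leaves are labelled by `1, …, n`, each of them exactly once. -/
def PTree.IsLabelled {n : ℕ} (t : PTree (Fin n)) : Prop := t.leaves.Perm (List.finRange n)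

/-- The class of a linear combination of planar trees with inputs labelled by `1, …, n`. -/
noncomputable def opClass (K : Type u) [Field K] (n : ℕ) :
    (PTree (Fin n) →₀ K) →ₗ[K] StdTrees K n :=
  Finsupp.linearCombination K fun t => Trees.mk (stdGr K n) (t.map (inp K))

/-- The arity `n` part `𝕋(W)(n)` of the tree module: the part of `𝕋(W) ∘ (K e₁ ⊕ ⋯ ⊕ K eₙ)` that is
multilinear in `e₁, …, eₙ`. -/
noncomputable def ops (K : Type u) [Field K] (n : ℕ) : Submodule K (StdTrees K n) :=
  Submodule.span K {x | ∃ t : PTree (Fin n), t.IsLabelled ∧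
    x = Trees.mk (stdGr K n) (t.map (inp K))}

/-- The action of a permutation of the inputs. -/
noncomputable def relabel {n : ℕ} (σ : Equiv.Perm (Fin n)) : StdTrees K n →ₗ[K] StdTrees K n :=
  Trees.map (LinearMap.funLeft K K σ) fun m x hx => by
    unfold stdGr at hx ⊢
    split_ifs with h
    · exact Submodule.mem_top
    · rw [if_neg h, Submodule.mem_bot] at hx
      rw [hx, map_zero]
      exact zero_mem _

/-- The exponent of the Koszul sign of the permutation which puts elements `x₁, …, xₙ` of degrees
`d 1, …, d n` in the order prescribed by a list of indices. -/
def permSign {n : ℕ} (d : Fin n → ℤ) : List (Fin n) → ℤ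
  | [] => 0
  | i :: l => (l.map fun j => if j < i then d i * d j else 0).sum + permSign d l

/-- The exponent of the Koszul sign obtained when elements of degrees `d i`, standing on the right
of a planar tree in the order of its leaves, are moved to the leaves: at a vertex `sμ(a, b)`, the
vertices of `b` (each of degree `1`) are exchanged with the labels of the leaves of `a`. -/
def insertSign {n : ℕ} (d : Fin n → ℤ) : PTree (Fin n) → ℤ
  | .leaf _ => 0
  | .cork => 0
  | .node a b => insertSign d a + insertSign d b + b.numVert * (a.leaves.map d).sum

variable {V : Type v} [AddCommGroup V] [Module K V]

/-- The element `t ⊗ (x₁ ⊗ ⋯ ⊗ xₙ)` of `𝕋(W)(n) ⊗_{𝕊ₙ} V^{⊗ n} ⊆ 𝕋(W) ∘ V`, where `xᵢ` has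
degree `d i`. -/
noncomputable def plug (gr : ℤ → Submodule K V) {n : ℕ} (d : Fin n → ℤ) (x : Fin n → V) :
    (PTree (Fin n) →₀ K) →ₗ[K] Trees gr :=
  Finsupp.linearCombination K fun t =>
    sgn K (permSign d t.leaves + insertSign d t) • Trees.mk gr (t.map x)

/-- For `C ⊆ 𝕋(W)` and a graded submodule `S ⊆ V`, the submodule `C ∘ S` of `𝕋(W) ∘ V`: it is
spanned by the elements `c ⊗ (x₁ ⊗ ⋯ ⊗ xₙ)` with `c ∈ C(n)` and homogeneous `xᵢ ∈ S`. -/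
noncomputable def comp (C : (n : ℕ) → Submodule K (StdTrees K n)) (gr : ℤ → Submodule K V)
    (S : Submodule K V) : Submodule K (Trees gr) :=
  Submodule.span K {y | ∃ (n : ℕ) (c : PTree (Fin n) →₀ K) (d : Fin n → ℤ) (x : Fin n → V),
    (∀ t ∈ c.support, t.IsLabelled) ∧ opClass K n c ∈ C n ∧
    (∀ i, x i ∈ S ∧ x i ∈ gr (d i)) ∧ y = plug gr d x c}

end Operations

/-! ### The curved Koszul dual cooperad of `uCom` -/

section KoszulDual

variable {K : Type u} [Field K]

/-- The composite `sμ ⊗ (sμ ⊗ 1) - sμ ⊗ (1 ⊗ sμ)` with inputs labelled by `i, j, k`. -/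
noncomputable def assocRel (K : Type u) [Field K] {n : ℕ} (i j k : Fin n) : StdTrees K n :=
  Trees.mk (stdGr K n) (.node (.node (.leaf (inp K i)) (.leaf (inp K j))) (.leaf (inp K k))) -
    Trees.mk (stdGr K n) (.node (.leaf (inp K i)) (.node (.leaf (inp K j)) (.leaf (inp K k))))

/-- The composite `sμ ⊗ (sξ ⊗ 1)` with input labelled by `i`. -/
noncomputable def unitRel (K : Type u) [Field K] {n : ℕ} (i : Fin n) : StdTrees K n :=
  Trees.mk (stdGr K n) (.node .cork (.leaf (inp K i)))

/-- The sub-`𝕊`-module `s²qR` of `𝕋²(W)`, where `qR` is the quadratic part of the relations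
`μ ⊗ (μ ⊗ 1) - μ ⊗ (1 ⊗ μ)` and `μ ⊗ (ξ ⊗ 1) - 1` of `uCom`. -/
noncomputable def quadRel (K : Type u) [Field K] (n : ℕ) : Submodule K (StdTrees K n) :=
  Submodule.span K {x | (∃ σ : Fin 3 ≃ Fin n, x = assocRel K (σ 0) (σ 1) (σ 2)) ∨
    ∃ σ : Fin 1 ≃ Fin n, x = unitRel K (σ 0)}

/-- `C` is a graded sub-cooperad of `𝕋ᶜ(W)`. -/
structure IsSubcooperad (C : (n : ℕ) → Submodule K (StdTrees K n)) : Prop where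
  le_ops : ∀ n, C n ≤ ops K n
  relabel_mem : ∀ (n : ℕ) (σ : Equiv.Perm (Fin n)), ∀ c ∈ C n, relabel σ c ∈ C n
  graded : ∀ n, C n ≤ ⨆ k, C n ⊓ Trees.deg (stdGr K n) k
  /-- the decomposition maps `C` to `C ∘ C`; here `C(n)` is seen inside
  `C ∘ (K e₁ ⊕ ⋯ ⊕ K eₙ)` -/
  decomp_mem : ∀ n, ∀ c ∈ C n, Trees.decomp (stdGr K n) c ∈
    comp C (Trees.deg (stdGr K n)) (comp C (stdGr K n) ⊤)

/-- `C` is a graded sub-cooperad of `𝕋ᶜ(W)` such that the composite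
`C → 𝕋ᶜ(W) → 𝕋²(W) / s²qR` is zero. -/
structure IsQuadratic (C : (n : ℕ) → Submodule K (StdTrees K n)) : Prop
    extends IsSubcooperad C where
  weight_mem : ∀ n, ∀ c ∈ C n, Trees.weight (stdGr K n) 2 c ∈ quadRel K n

/-- The graded cooperad underlying the curved Koszul dual `uCom^¡`: the final (that is, the largest)
graded sub-cooperad of `𝕋ᶜ(W)` whose projection to `𝕋²(W) / s²qR` is zero. Its coderivation is
zero and its curvature is the restriction of `θ`. -/
noncomputable def uComDual (K : Type u) [Field K] (n : ℕ) : Submodule K (StdTrees K n) :=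
  ⨆ (C : (n : ℕ) → Submodule K (StdTrees K n)) (_ : IsQuadratic C), C n

theorem comp_mono {V : Type v} [AddCommGroup V] [Module K V] {gr : ℤ → Submodule K V}
    {C C' : (n : ℕ) → Submodule K (StdTrees K n)} (hC : ∀ n, C n ≤ C' n) {S S' : Submodule K V}
    (hS : S ≤ S') : comp C gr S ≤ comp C' gr S' := by
  refine Submodule.span_mono ?_
  rintro y ⟨n, c, d, x, h1, h2, h3, h4⟩
  exact ⟨n, c, d, x, h1, hC n h2, fun i => ⟨hS (h3 i).1, (h3 i).2⟩, h4⟩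

theorem le_uComDual {C : (n : ℕ) → Submodule K (StdTrees K n)} (hC : IsQuadratic C) (n : ℕ) :
    C n ≤ uComDual K n :=
  le_iSup₂_of_le C hC le_rfl

/-- `uComDual` is itself a graded sub-cooperad whose projection to `𝕋²(W) / s²qR` is zero. -/
theorem isQuadratic_uComDual (K : Type u) [Field K] : IsQuadratic (uComDual K) where
  le_ops n := iSup₂_le fun _ hC => hC.le_ops n
  relabel_mem n σ := by
    have : uComDual K n ≤ (uComDual K n).comap (relabel σ) :=
      iSup₂_le fun C hC c hc => le_uComDual hC n (hC.relabel_mem n σ c hc)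
    exact this
  graded n := iSup₂_le fun C hC => (hC.graded n).trans
    (iSup_mono fun _ => inf_le_inf_right _ (le_uComDual hC n))
  decomp_mem n := by
    have : uComDual K n ≤ (comp (uComDual K) (Trees.deg (stdGr K n))
        (comp (uComDual K) (stdGr K n) ⊤)).comap (Trees.decomp (stdGr K n)) :=
      iSup₂_le fun C hC c hc => comp_mono (le_uComDual hC) (comp_mono (le_uComDual hC) le_rfl)
        (hC.decomp_mem n c hc)
    exact this
  weight_mem n := by
    have : uComDual K n ≤ (quadRel K n).comap (Trees.weight (stdGr K n) 2) :=
      iSup₂_le fun C hC c hc => hC.weight_mem n c hc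
    exact this

end KoszulDual

/-! ### Coalgebras over the curved Koszul dual of `uCom` -/

/-- A coalgebra over the curved cooperad `uCom^¡`, for a field of characteristic zero: a graded
module `D` with a coassociative and counital map `Δ : D → uCom^¡ ∘ D` of degree `0`, and a
coderivation `d` of degree `-1` (relative to the zero coderivation of `uCom^¡`) such that
`d² = (θ ∘ Id) Δ`. In characteristic zero the inclusion `uCom^¡ ⊆ 𝕋ᶜ(W)` induces injections
`uCom^¡ ∘ D → 𝕋ᶜ(W) ∘ D` and `uCom^¡ ∘ uCom^¡ ∘ D → 𝕋ᶜ(W) ∘ 𝕋ᶜ(W) ∘ D`, along which the source is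
identified with its image. -/
structure UComDualCog (K : Type u) [Field K] where
  D : GMod.{u, v} K
  Δ : D →ₗ[K] Trees D.gr
  d : D →ₗ[K] D
  Δ_mem : ∀ n, ∀ x ∈ D.gr n, Δ x ∈ Trees.deg D.gr n
  d_mem : ∀ n, ∀ x ∈ D.gr n, d x ∈ D.gr (n - 1)
  Δ_mem_comp : ∀ x, Δ x ∈ comp (uComDual K) D.gr ⊤
  /-- `(ε ∘ Id) Δ = Id` -/
  counit : Trees.counit D.gr ∘ₗ Δ = LinearMap.id
  /-- `(Δ ∘ Id) Δ = (Id ∘ Δ) Δ` -/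
  coassoc : Trees.decomp D.gr ∘ₗ Δ = Trees.map Δ Δ_mem ∘ₗ Δ
  /-- `Δ d = (Id ∘' d) Δ` -/
  coderivation : Δ ∘ₗ d = Trees.der D d d_mem ∘ₗ Δ
  /-- `d² = (θ ∘ Id) Δ` -/
  curvature : d ∘ₗ d = Trees.curv D ∘ₗ Δ

namespace UComDualCog

variable {K : Type u} [Field K]

/-- A morphism of coalgebras: a morphism of graded modules which commutes with the structure
maps. -/
@[ext]
structure Hom (C D : UComDualCog.{u, v} K) where
  base : C.D ⟶ D.D
  comm_Δ : D.Δ ∘ₗ base.toLin = Trees.map base.toLin (fun _ _ h => base.map_mem h) ∘ₗ C.Δ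
  comm_d : D.d ∘ₗ base.toLin = base.toLin ∘ₗ C.d

instance : Category.{v} (UComDualCog.{u, v} K) where
  Hom := Hom
  id C :=
    { base := 𝟙 C.D
      comm_Δ := by
        change C.Δ ∘ₗ LinearMap.id = Trees.map LinearMap.id (fun _ _ h => h) ∘ₗ C.Δ
        rw [Trees.map_id]; rfl
      comm_d := rfl }
  comp {C D E} f g :=
    { base := f.base ≫ g.base
      comm_Δ := by
        change E.Δ ∘ₗ g.base.toLin ∘ₗ f.base.toLin = Trees.map (g.base.toLin ∘ₗ f.base.toLin)
          (fun _ _ h => g.base.map_mem (f.base.map_mem h)) ∘ₗ C.Δ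
        rw [← Trees.map_comp f.base.toLin (fun _ _ h => f.base.map_mem h) g.base.toLin
          (fun _ _ h => g.base.map_mem h), ← LinearMap.comp_assoc, g.comm_Δ, LinearMap.comp_assoc,
          f.comm_Δ, LinearMap.comp_assoc]
      comm_d := by
        change E.d ∘ₗ g.base.toLin ∘ₗ f.base.toLin = (g.base.toLin ∘ₗ f.base.toLin) ∘ₗ C.d
        rw [← LinearMap.comp_assoc, g.comm_d, LinearMap.comp_assoc, f.comm_d,
          LinearMap.comp_assoc] }

/-- The underlying graded module. -/
def forget (K : Type u) [Field K] : UComDualCog.{u, v} K ⥤ GMod.{u, v} K where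
  obj C := C.D
  map f := f.base

end UComDualCog

end CurvedKoszul

/-!
# Coalgebras over the curved Koszul dual of `uCom` and curved Lie coalgebras

The equivalence is the functor `UComDualCog.lieFunctor`. It sends a `uCom^¡`-coalgebra `(D, Δ, d)`
to `sD` with the same `d`, the cobracket `δ` given by the part of `Δ` with values in the trees
`sμ(x, y)` with labels `x`, `y` (`Trees.cobr`), and the form `θ` given by the coefficient of `sξ` in
`Δ` (`Trees.corkCoeff`). The suspension turns the commutative operation `sμ` of degree `1` into an
antisymmetric operation of degree `0` (`Trees.bra`).

*Recursion.* Everything rests on the observation that `Δ` is determined by `δ` and `θ`. Keep, in the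
coassociativity relation, the part in which the lower tree has exactly one vertex; grafting it back
together (`Trees.graftRoot_decomp`, `Trees.graftRoot_map`) yields, with signs,
`Δ x = x + θ(x) sξ + sμ (Δ ⊗ Δ) (δ x)`
(`Trees.eq_recursion`). It follows that the iterated cobrackets are the components of `Δ`,
so that `δ` is conilpotent (`Trees.isConilp_of_recursion`). Conversely, along a
conilpotent `δ` the recursion has exactly one solution, since the difference of two solutions factors through
arbitrarily many cobrackets (`IsConilp.unique`), and since the components with a given number of
cobrackets can be summed up (`IsConilp.sol_eq`). Uniqueness shows that a map which commutes with `δ`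
and `θ` commutes with `Δ` (`UComDualCog.comm_Δ_of_comm`), hence the functor is fully faithful.

*The Jacobi identity.* The defect of the co-Jacobi identity for `δ` is the value on `Δ x` of a map
which only sees the trees with two vertices and three leaves, and which takes the same value, up to
Koszul signs, on all trees of this shape with the same three labels. So it depends only on the sum
of the coefficients of these trees (`Trees.jac_plug`). This sum vanishes on the associativity
relations, hence on `uCom^¡` (`Trees.jac_eq_zero`). The formula for `d²` is the recursion, inserted
into the curvature (`Trees.curv_eq`).

*Essential surjectivity.* Given `δ`, `d` and `θ`, let `Δ` be the solution of the recursion. Both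
sides of the coassociativity relation solve one and the same recursion
(`Trees.coassoc_of_recursion`), and the defect of the compatibility with `d` solves a homogeneous
linear recursion, along which only zero is a solution (`Trees.coderivation_of_recursion`). What
remains is that `Δ` has values in `uCom^¡ ∘ D` and not only in `𝕋ᶜ(W) ∘ D`. Consider the sums of all
bracketings of words in the inputs and `sξ`. The degraftings of such a sum are the words in the
blocks of the given word (`Trees.decomp_word`), and the words with two vertices are the quadratic
relations (`word_mem_quadRel`); therefore they span a quadratic sub-cooperad
(`isQuadratic_lieWords`), which is contained in `uCom^¡` by finality. Finally, a dual form of the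
Dynkin-Specht-Wever formula (`Trees.iterSum_linWord`) writes `k + 1` times the component of `Δ` with
`k` cobrackets as a sum of words in elements `x + θ(x) sξ`, which are obtained by iterating `2 δ` on
the right-hand factor. This is where the co-Jacobi identity is used, and as `K` has characteristic
zero, it proves the claim (`Trees.recComp_mem_comp`).
-/

namespace CurvedKoszul

/-! ### Signs and graded modules -/

section Sign

variable {K : Type u} [Field K]

theorem sgn_eq {a b : ℤ} (k : ℤ) (h : a = b + 2 * k) : sgn K a = sgn K b := by
  rw [h, sgn_add, two_mul, sgn_add, sgn_mul_self, mul_one]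

theorem neg_sgn (a : ℤ) : -sgn K a = sgn K (a + 1) := by
  rw [sgn_add, sgn_one, mul_neg_one]

theorem sgn_smul_sgn_smul {M : Type w} [AddCommGroup M] [Module K M] (a : ℤ) (x : M) :
    sgn K a • sgn K a • x = x := by
  rw [smul_smul, sgn_mul_self, one_smul]

end Sign

section Ext

variable {K : Type u} [Field K] {M : Type v} [AddCommGroup M] [Module K M]
  {N : Type w} [AddCommGroup N] [Module K N]

theorem lin_ext_of_iSup {gr : ℤ → Submodule K M} (h : iSup gr = ⊤) {f g : M →ₗ[K] N}
    (hfg : ∀ n, ∀ x ∈ gr n, f x = g x) : f = g := by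
  have : (⊤ : Submodule K M) ≤ LinearMap.eqLocus f g := by
    rw [← h]
    exact iSup_le hfg
  exact LinearMap.ext fun x => this (Submodule.mem_top (x := x))

theorem tensor_ext_of_iSup {gr : ℤ → Submodule K M} (h : iSup gr = ⊤) {f g : M ⊗[K] M →ₗ[K] N}
    (hfg : ∀ m n, ∀ x ∈ gr m, ∀ y ∈ gr n, f (x ⊗ₜ y) = g (x ⊗ₜ y)) : f = g :=
  TensorProduct.ext <| lin_ext_of_iSup h fun m x hx => lin_ext_of_iSup h fun n y hy =>
    hfg m n x hx y hy

end Ext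

namespace GMod

variable {K : Type u} [Field K]

theorem iSup_gr (D : GMod.{u, v} K) : iSup D.gr = ⊤ :=
  D.isInternal.submodule_iSup_eq_top

/-- The suspension of a graded module, with a carrier which is visibly the given one. -/
@[reducible]
def susp (D : GMod.{u, v} K) : GMod.{u, v} K :=
  { carrier := D, gr := fun n => D.gr (n - 1), isInternal := D.shift_isInternal }

/-- Every graded module is, on the nose, the suspension of its desuspension. -/
theorem exists_eq_susp (V : GMod.{u, v} K) : ∃ D : GMod.{u, v} K, V = D.susp := by
  obtain ⟨C, gr, h⟩ := V
  have h' : DirectSum.IsInternal (fun n : ℤ => gr (n + 1)) := by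
    rw [DirectSum.isInternal_submodule_iff_iSupIndep_and_iSup_eq_top] at h ⊢
    refine ⟨h.1.comp (f := fun n : ℤ => n + 1) (fun a b hab => by simpa using hab), ?_⟩
    rw [← h.2]
    exact (Equiv.addRight (1 : ℤ)).iSup_comp (g := gr)
  refine ⟨⟨C, fun n => gr (n + 1), h'⟩, ?_⟩
  simp [susp]

variable (D : GMod.{u, v} K)

theorem mem_susp {m : ℤ} {x : D} (hx : x ∈ D.gr m) : x ∈ D.susp.gr (m + 1) := by
  change x ∈ D.gr (m + 1 - 1)
  rwa [add_sub_cancel_right]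

theorem susp_swap_tmul {m n : ℤ} {x y : D} (hx : x ∈ D.gr m) (hy : y ∈ D.gr n) :
    D.susp.swap (x ⊗ₜ y) = sgn K ((m + 1) * (n + 1)) • (y ⊗ₜ[K] x) :=
  D.susp.swap_tmul (D.mem_susp hx) (D.mem_susp hy)

theorem susp_parity : D.susp.parity = -D.parity :=
  lin_ext_of_iSup D.iSup_gr fun n x hx => by
    rw [D.susp.parity_apply (D.mem_susp hx), LinearMap.neg_apply, D.parity_apply hx, sgn_add,
      sgn_one, mul_neg_one, neg_smul]

theorem susp_swap_swap (t : D ⊗[K] D) : D.susp.swap (D.susp.swap t) = t := by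
  have : D.susp.swap ∘ₗ D.susp.swap = LinearMap.id :=
    tensor_ext_of_iSup D.iSup_gr fun m n x hx y hy => by
      rw [LinearMap.comp_apply, D.susp_swap_tmul hx hy, map_smul, D.susp_swap_tmul hy hx,
        mul_comm (n + 1), sgn_smul_sgn_smul, LinearMap.id_apply]
  exact LinearMap.congr_fun this t

/-- The operator `d ⊗ Id + Id ⊗ d` on the tensor square of the suspension, for `d` of
degree `-1`. -/
noncomputable def tensorDer (d : D →ₗ[K] D) : D ⊗[K] D →ₗ[K] D ⊗[K] D :=
  TensorProduct.map d LinearMap.id + TensorProduct.map D.susp.parity d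

theorem tensorDer_tmul (d : D →ₗ[K] D) {m : ℤ} {x : D} (hx : x ∈ D.gr m) (y : D) :
    D.tensorDer d (x ⊗ₜ y) = d x ⊗ₜ y - sgn K m • (x ⊗ₜ d y) := by
  rw [tensorDer, LinearMap.add_apply, TensorProduct.map_tmul, TensorProduct.map_tmul, susp_parity,
    LinearMap.neg_apply, D.parity_apply hx, TensorProduct.neg_tmul, TensorProduct.smul_tmul',
    sub_eq_add_neg, LinearMap.id_apply]

theorem susp_swap_der {d : D →ₗ[K] D} (hd : ∀ n, ∀ x ∈ D.gr n, d x ∈ D.gr (n - 1))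
    (t : D ⊗[K] D) : D.susp.swap (D.tensorDer d t) = D.tensorDer d (D.susp.swap t) := by
  have : D.susp.swap ∘ₗ D.tensorDer d = D.tensorDer d ∘ₗ D.susp.swap :=
    tensor_ext_of_iSup D.iSup_gr fun m n x hx y hy => by
      rw [LinearMap.comp_apply, LinearMap.comp_apply, D.tensorDer_tmul d hx,
        D.susp_swap_tmul hx hy, map_smul, D.tensorDer_tmul d hy, map_sub, map_smul,
        D.susp_swap_tmul (hd _ _ hx) hy, D.susp_swap_tmul hx (hd _ _ hy), smul_sub, smul_smul,
        smul_smul,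
        show sgn K ((m - 1 + 1) * (n + 1)) = -(sgn K ((m + 1) * (n + 1)) * sgn K n) by
          rw [← sgn_add, neg_sgn]; exact sgn_eq (-n - 1) (by ring),
        show sgn K m * sgn K ((m + 1) * (n - 1 + 1)) = -sgn K ((m + 1) * (n + 1)) by
          rw [← sgn_add, neg_sgn]; exact sgn_eq (-1) (by ring)]
      module
  exact LinearMap.congr_fun this t

end GMod

namespace Trees

/-! ### Maps out of tree modules -/

section General

variable {K : Type u} [Field K] {V : Type v} [AddCommGroup V] [Module K V]
  {gr : ℤ → Submodule K V}

/-- The tree `sξ`. -/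
noncomputable def cork (gr : ℤ → Submodule K V) : Trees gr := mk gr .cork

theorem cork_mem : cork gr ∈ deg gr 1 := (free gr).cork_mem

theorem node_mem {m n : ℤ} {a b : Trees gr} (ha : a ∈ deg gr m) (hb : b ∈ deg gr n) :
    node a b ∈ deg gr (m + n + 1) := (free gr).node_mem ha hb

theorem node_comm {m n : ℤ} {a b : Trees gr} (ha : a ∈ deg gr m) (hb : b ∈ deg gr n) :
    node a b = sgn K (m * n) • node b a := (free gr).node_comm ha hb

/-- Two linear maps on trees coincide if they do on the trivial trees and on `sξ`, and if their
coincidence is inherited by graftings. -/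
theorem hom_ext_alg {B : Type w} [AddCommGroup B] [Module K B] {f g : Trees gr →ₗ[K] B}
    (hι : ∀ x, f (ι x) = g (ι x)) (hc : f (cork gr) = g (cork gr))
    (hn : ∀ a b, f a = g a → f b = g b → f (node a b) = g (node a b)) : f = g := by
  ext t
  induction t with
  | leaf x => exact hι x
  | cork => exact hc
  | node a b iha ihb =>
    rw [← node_mk]
    exact hn _ _ iha ihb

variable (gr) in
/-- The coefficient of `sξ`. -/
noncomputable def corkCoeff : Trees gr →ₗ[K] K :=
  lift (grB := fun n => if n = 1 then ⊤ else ⊥)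
    { cork := 1
      node := 0
      cork_mem := by simp
      node_mem := fun _ _ => zero_mem _
      node_comm := fun _ _ => by simp } (0 : V →ₗ[K] K)
    (by intro n x _; exact zero_mem _)

@[simp] theorem corkCoeff_ι (x : V) : corkCoeff gr (ι x) = 0 := lift_ι _ _ _ _
@[simp] theorem corkCoeff_cork : corkCoeff gr (cork gr) = 1 := lift_cork _ _ _
@[simp] theorem corkCoeff_node (a b : Trees gr) : corkCoeff gr (node a b) = 0 :=
  lift_node _ _ _ _ _

theorem corkCoeff_of_mem {n : ℤ} {a : Trees gr} (ha : a ∈ deg gr n) (hn : n ≠ 1) :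
    corkCoeff gr a = 0 := by
  have h : corkCoeff gr a ∈ (if n = 1 then ⊤ else ⊥ : Submodule K K) :=
    lift_mem (grB := fun n => if n = 1 then ⊤ else ⊥) _ _ _ ha
  rw [if_neg hn] at h
  exact h

@[simp] theorem counit_ι (x : V) : counit gr (ι x) = x := lift_ι _ _ _ _
@[simp] theorem counit_cork : counit gr (cork gr) = 0 := lift_cork _ _ _
@[simp] theorem counit_node (a b : Trees gr) : counit gr (node a b) = 0 :=
  lift_node _ _ _ _ _

theorem counit_mem {n : ℤ} {a : Trees gr} (ha : a ∈ deg gr n) : counit gr a ∈ gr n :=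
  lift_mem (grB := gr) _ _ (fun _ _ h => h) ha

theorem decomp_cork' : decomp gr (cork gr) = ι (cork gr) + cork (deg gr) := decomp_cork

theorem decomp_node' (a b : Trees gr) :
    decomp gr (node a b) = ι (node a b) + node (decomp gr a) (decomp gr b) := decomp_node a b

theorem counit_decomp (a : Trees gr) : counit (deg gr) (decomp gr a) = a := by
  have : counit (deg gr) ∘ₗ decomp gr = LinearMap.id :=
    hom_ext_alg (fun x => by simp [decomp_ι]) (by simp [decomp_cork'])
      (fun a b _ _ => by simp [decomp_node'])
  exact LinearMap.congr_fun this a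

section Map

variable {B : Type w} [AddCommGroup B] [Module K B] {grB : ℤ → Submodule K B}
  (f : V →ₗ[K] B) (hf : ∀ n, ∀ x ∈ gr n, f x ∈ grB n)

@[simp] theorem map_ι (x : V) : map f hf (ι x) = ι (f x) := lift_ι _ _ _ _
@[simp] theorem map_cork : map f hf (cork gr) = cork grB := lift_cork _ _ _
@[simp] theorem map_node (a b : Trees gr) :
    map f hf (node a b) = node (map f hf a) (map f hf b) := lift_node _ _ _ _ _

theorem map_mem {n : ℤ} {a : Trees gr} (ha : a ∈ deg gr n) : map f hf a ∈ deg grB n :=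
  lift_mem _ _ _ ha

theorem counit_map (a : Trees gr) : counit grB (map f hf a) = f (counit gr a) := by
  have : counit grB ∘ₗ map f hf = f ∘ₗ counit gr :=
    hom_ext_alg (fun x => by simp) (by simp) (fun a b _ _ => by simp)
  exact LinearMap.congr_fun this a

theorem corkCoeff_map (a : Trees gr) : corkCoeff grB (map f hf a) = corkCoeff gr a := by
  have : corkCoeff grB ∘ₗ map f hf = corkCoeff gr :=
    hom_ext_alg (fun x => by simp) (by simp) (fun a b _ _ => by simp)
  exact LinearMap.congr_fun this a

end Map

/-- The auxiliary `𝕋(W)`-algebra which defines the grafting along the root vertex. -/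
noncomputable def graftAlg (gr : ℤ → Submodule K V) :
    TreeAlg K (fun n => (deg gr n).prod (deg gr n)) where
  cork := (0, cork gr)
  node := LinearMap.mk₂ K (fun a b => (0, node a.1 b.1))
    (fun a a' b => by ext <;> simp) (fun c a b => by ext <;> simp)
    (fun a b b' => by ext <;> simp) (fun c a b => by ext <;> simp)
  cork_mem := Submodule.mem_prod.2 ⟨zero_mem _, cork_mem⟩
  node_mem ha hb := by
    rw [Submodule.mem_prod] at ha hb ⊢
    exact ⟨zero_mem _, node_mem ha.1 hb.1⟩
  node_comm {m n a b} ha hb := by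
    rw [Submodule.mem_prod] at ha hb
    simp only [LinearMap.mk₂_apply, Prod.smul_mk, smul_zero, ← node_comm ha.1 hb.1]

/-- Projection of a tree of trees onto the part whose bottom tree has exactly one vertex, followed
by grafting. -/
noncomputable def graftRoot (gr : ℤ → Submodule K V) : Trees (deg gr) →ₗ[K] Trees gr :=
  LinearMap.snd K _ _ ∘ₗ lift (graftAlg gr) (LinearMap.inl K _ _)
    (fun _ _ hx => Submodule.mem_prod.2 ⟨hx, zero_mem _⟩)

/-- The first component of the auxiliary map is the projection onto the trivial trees, so that the
second one grafts the trees which sit directly on the root vertex. -/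
theorem graft_fst (t : Trees (deg gr)) :
    (lift (graftAlg gr) (LinearMap.inl K _ _)
      (fun _ _ hx => Submodule.mem_prod.2 ⟨hx, zero_mem _⟩) t).1 = counit (deg gr) t := by
  have : LinearMap.fst K _ _ ∘ₗ lift (graftAlg gr) (LinearMap.inl K _ _)
      (fun _ _ hx => Submodule.mem_prod.2 ⟨hx, zero_mem _⟩) = counit (deg gr) := by
    refine hom_ext_alg (fun x => ?_) ?_ (fun a b _ _ => ?_)
    · rw [LinearMap.comp_apply, lift_ι]; simp
    · rw [LinearMap.comp_apply, counit_cork]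
      exact congrArg Prod.fst (lift_cork _ _ _)
    · rw [LinearMap.comp_apply, counit_node]
      exact congrArg Prod.fst (lift_node _ _ _ _ _)
  exact LinearMap.congr_fun this t

@[simp] theorem graftRoot_ι (x : Trees gr) : graftRoot gr (ι x) = 0 := by
  rw [graftRoot, LinearMap.comp_apply, lift_ι]; simp

@[simp] theorem graftRoot_cork : graftRoot gr (cork (deg gr)) = cork gr :=
  congrArg Prod.snd (lift_cork (graftAlg gr) _ _)

@[simp] theorem graftRoot_node (a b : Trees (deg gr)) :
    graftRoot gr (node a b) = node (counit (deg gr) a) (counit (deg gr) b) := by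
  rw [← graft_fst, ← graft_fst]
  exact congrArg Prod.snd (lift_node (graftAlg gr) _ _ _ _)

/-- A tree which is not trivial is recovered from its degraftings by keeping those which cut
exactly above the root vertex. -/
theorem graftRoot_decomp (a : Trees gr) :
    graftRoot gr (decomp gr a) = a - ι (counit gr a) := by
  have : graftRoot gr ∘ₗ decomp gr = LinearMap.id - ι ∘ₗ counit gr :=
    hom_ext_alg (fun x => by simp [decomp_ι]) (by simp [decomp_cork'])
      (fun a b _ _ => by simp [decomp_node', counit_decomp])
  exact LinearMap.congr_fun this a

end General

/-! ### The suspended grafting and its splitting -/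

section GMod

variable {K : Type u} [Field K] (D : GMod.{u, v} K)

theorem iSup_deg : iSup (deg D.gr) = ⊤ := by
  have hι : ∀ x : D, (ι x : Trees D.gr) ∈ iSup (deg D.gr) := by
    intro x
    have : iSup D.gr ≤ (iSup (deg D.gr)).comap ι :=
      iSup_le fun n y hy => Submodule.mem_iSup_of_mem n (ι_mem hy)
    exact this (by rw [D.iSup_gr]; trivial)
  have hn : ∀ a ∈ iSup (deg D.gr), ∀ b ∈ iSup (deg D.gr), node a b ∈ iSup (deg D.gr) := by
    intro a ha b hb
    have h : iSup (deg D.gr) ≤ (iSup (deg D.gr)).comap ((node (gr := D.gr)).flip b) := by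
      refine iSup_le fun m a ha => ?_
      have h' : iSup (deg D.gr) ≤ (iSup (deg D.gr)).comap (node (gr := D.gr) a) :=
        iSup_le fun n b hb => Submodule.mem_iSup_of_mem (m + n + 1) (node_mem ha hb)
      exact h' hb
    exact h ha
  rw [eq_top_iff]
  have hmk : ∀ t, mk D.gr t ∈ iSup (deg D.gr) := by
    intro t
    induction t with
    | leaf x => exact hι x
    | cork => exact Submodule.mem_iSup_of_mem 1 cork_mem
    | node a b iha ihb =>
      rw [← node_mk]
      exact hn _ iha _ ihb
  have : (iSup (deg D.gr)).mkQ = 0 := hom_ext fun t => by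
    rw [LinearMap.zero_apply]
    exact (Submodule.Quotient.mk_eq_zero _).2 (hmk t)
  intro x _
  exact (Submodule.Quotient.mk_eq_zero _).1 (LinearMap.congr_fun this x)

/-- Variant of `hom_ext_alg` for homogeneous trees, whose Koszul signs are known. -/
theorem hom_ext_homog {B : Type w} [AddCommGroup B] [Module K B] {f g : Trees D.gr →ₗ[K] B}
    (hι : ∀ n, ∀ x ∈ D.gr n, f (ι x) = g (ι x)) (hc : f (cork D.gr) = g (cork D.gr))
    (hn : ∀ m n, ∀ a ∈ deg D.gr m, ∀ b ∈ deg D.gr n, f a = g a → f b = g b →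
      f (node a b) = g (node a b)) : f = g := by
  refine lin_ext_of_iSup (iSup_deg D) fun n => ?_
  have : ∀ {t : PTree D} {n : ℤ}, t.HasDeg D.gr n → f (mk D.gr t) = g (mk D.gr t) := by
    intro t n h
    induction h with
    | leaf h => exact hι _ _ h
    | cork => exact hc
    | node ha hb iha ihb =>
      rw [← node_mk]
      exact hn _ _ _ (Submodule.subset_span ⟨_, ha, rfl⟩) _ (Submodule.subset_span ⟨_, hb, rfl⟩)
        iha ihb
  intro x hx
  have hle : deg D.gr n ≤ LinearMap.eqLocus f g := by
    refine Submodule.span_le.2 ?_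
    rintro _ ⟨t, ht, rfl⟩
    exact this ht
  exact hle hx

theorem parity_mem {m : ℤ} {a : Trees D.gr} (ha : a ∈ deg D.gr m) :
    parity D a ∈ deg D.gr m := by
  rw [parity_apply D ha]
  exact Submodule.smul_mem _ _ ha

/-- The operation `sμ` on suspended trees, `sa ⊗ sb ↦ (-1) ^ |a| s sμ(a, b)`. It has degree `0` and
is antisymmetric for the degrees of the suspension. -/
noncomputable def bra : Trees D.gr →ₗ[K] Trees D.gr →ₗ[K] Trees D.gr := node ∘ₗ parity D

theorem bra_apply {m : ℤ} {a : Trees D.gr} (ha : a ∈ deg D.gr m) (b : Trees D.gr) :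
    bra D a b = sgn K m • node a b := by
  rw [bra, LinearMap.comp_apply, parity_apply D ha, map_smul, LinearMap.smul_apply]

theorem node_eq_bra {m : ℤ} {a : Trees D.gr} (ha : a ∈ deg D.gr m) (b : Trees D.gr) :
    node a b = sgn K m • bra D a b := by
  rw [bra_apply D ha, sgn_smul_sgn_smul]

theorem bra_mem {m n : ℤ} {a b : Trees D.gr} (ha : a ∈ deg D.gr m) (hb : b ∈ deg D.gr n) :
    bra D a b ∈ deg D.gr (m + n + 1) :=
  node_mem (parity_mem D ha) hb

theorem bra_comm {m n : ℤ} {a b : Trees D.gr} (ha : a ∈ deg D.gr m) (hb : b ∈ deg D.gr n) :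
    bra D b a = -(sgn K ((m + 1) * (n + 1)) • bra D a b) := by
  rw [bra_apply D hb, bra_apply D ha, node_comm hb ha, smul_smul, smul_smul, ← neg_smul,
    ← sgn_add, ← sgn_add, neg_sgn]
  congr 1
  exact sgn_eq (-m - 1) (by ring)

/-- Grafting of suspended trees, as a map on the tensor product. -/
noncomputable def braT : Trees D.gr ⊗[K] Trees D.gr →ₗ[K] Trees D.gr :=
  TensorProduct.lift (bra D)

@[simp] theorem braT_tmul (a b : Trees D.gr) : braT D (a ⊗ₜ b) = bra D a b := rfl

/-- For degree `0` maps `f` and `g` to trees, exchanging the arguments of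
`x ⊗ y ↦ sμ(f x, g y)` exchanges `f` and `g`, up to sign. -/
theorem braT_map_swap {f g : D →ₗ[K] Trees D.gr} (hf : ∀ n, ∀ x ∈ D.gr n, f x ∈ deg D.gr n)
    (hg : ∀ n, ∀ x ∈ D.gr n, g x ∈ deg D.gr n) (t : D ⊗[K] D) :
    braT D (TensorProduct.map f g (D.susp.swap t)) = -braT D (TensorProduct.map g f t) := by
  have : braT D ∘ₗ TensorProduct.map f g ∘ₗ D.susp.swap = -(braT D ∘ₗ TensorProduct.map g f) :=
    tensor_ext_of_iSup D.iSup_gr fun m n x hx y hy => by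
      simp only [LinearMap.comp_apply, LinearMap.neg_apply, D.susp_swap_tmul hx hy, map_smul,
        TensorProduct.map_tmul, braT_tmul]
      rw [bra_comm D (hg _ _ hx) (hf _ _ hy), smul_neg, sgn_smul_sgn_smul]
  exact LinearMap.congr_fun this t

/-- The exchange map `sa ⊗ sb ↦ (-1) ^ ((|a| + 1) (|b| + 1)) sb ⊗ sa` on suspended trees. The sign
is written as `½ (1 - (-1) ^ |a| - (-1) ^ |b| - (-1) ^ (|a| + |b|))`, which only uses the parity
involution. -/
noncomputable def treeSwap : Trees D.gr ⊗[K] Trees D.gr →ₗ[K] Trees D.gr ⊗[K] Trees D.gr :=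
  (2⁻¹ : K) • (LinearMap.id - TensorProduct.map LinearMap.id (parity D) -
    TensorProduct.map (parity D) LinearMap.id - TensorProduct.map (parity D) (parity D)) ∘ₗ
      (TensorProduct.comm K _ _).toLinearMap

theorem treeSwap_tmul [CharZero K] {m n : ℤ} {a b : Trees D.gr} (ha : a ∈ deg D.gr m)
    (hb : b ∈ deg D.gr n) :
    treeSwap D (a ⊗ₜ b) = sgn K ((m + 1) * (n + 1)) • (b ⊗ₜ[K] a) := by
  have h : (2⁻¹ : K) * (1 - sgn K m - sgn K n - sgn K n * sgn K m) =
      sgn K ((m + 1) * (n + 1)) := by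
    rcases Int.even_or_odd' m with ⟨k, rfl | rfl⟩ <;> rcases Int.even_or_odd' n with ⟨l, rfl | rfl⟩
    · rw [sgn_eq (a := 2 * k) (b := 0) k (by ring), sgn_eq (a := 2 * l) (b := 0) l (by ring),
        sgn_eq (a := (2 * k + 1) * (2 * l + 1)) (b := 1) (2 * k * l + k + l) (by ring), sgn_zero,
        sgn_one]
      norm_num
    · rw [sgn_eq (a := 2 * k) (b := 0) k (by ring), sgn_eq (a := 2 * l + 1) (b := 1) l (by ring),
        sgn_eq (a := (2 * k + 1) * (2 * l + 1 + 1)) (b := 0) ((2 * k + 1) * (l + 1)) (by ring),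
        sgn_zero, sgn_one]
      norm_num
    · rw [sgn_eq (a := 2 * k + 1) (b := 1) k (by ring), sgn_eq (a := 2 * l) (b := 0) l (by ring),
        sgn_eq (a := (2 * k + 1 + 1) * (2 * l + 1)) (b := 0) ((2 * l + 1) * (k + 1)) (by ring),
        sgn_zero, sgn_one]
      norm_num
    · rw [sgn_eq (a := 2 * k + 1) (b := 1) k (by ring),
        sgn_eq (a := 2 * l + 1) (b := 1) l (by ring),
        sgn_eq (a := (2 * k + 1 + 1) * (2 * l + 1 + 1)) (b := 0) (2 * (l + 1) * (k + 1))
          (by ring), sgn_zero, sgn_one]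
      norm_num
  simp only [treeSwap, LinearMap.smul_apply, LinearMap.comp_apply, LinearEquiv.coe_coe,
    TensorProduct.comm_tmul, LinearMap.sub_apply, TensorProduct.map_tmul, LinearMap.id_apply,
    parity_apply D ha, parity_apply D hb, TensorProduct.tmul_smul, ← TensorProduct.smul_tmul',
    smul_smul, ← h]
  module

/-- The antisymmetrization of a tensor of suspended trees. -/
noncomputable def treeAlt : Trees D.gr ⊗[K] Trees D.gr →ₗ[K] Trees D.gr ⊗[K] Trees D.gr :=
  (2⁻¹ : K) • (LinearMap.id - treeSwap D)

/-- The antisymmetrization of a tensor, for the degrees of the suspension. -/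
noncomputable def alt : D ⊗[K] D →ₗ[K] D ⊗[K] D :=
  (2⁻¹ : K) • (LinearMap.id - D.susp.swap)

theorem alt_eq_self [CharZero K] {t : D ⊗[K] D} (ht : D.susp.swap t = -t) : alt D t = t := by
  rw [alt, LinearMap.smul_apply, LinearMap.sub_apply, ht, LinearMap.id_apply, sub_neg_eq_add,
    ← two_smul K t, smul_smul, inv_mul_cancel₀ two_ne_zero, one_smul]

/-- The auxiliary `𝕋(W)`-algebra which defines the splitting at the root. -/
noncomputable def rootAlg [CharZero K] : TreeAlg K (fun n => (deg D.gr n).prod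
    (⊤ : Submodule K (Trees D.gr ⊗[K] Trees D.gr))) where
  cork := (cork D.gr, 0)
  node := LinearMap.mk₂ K (fun a b => (node a.1 b.1, treeAlt D (parity D a.1 ⊗ₜ b.1)))
    (fun a a' b => by ext <;> simp [TensorProduct.add_tmul])
    (fun c a b => by ext <;> simp [← TensorProduct.smul_tmul'])
    (fun a b b' => by ext <;> simp [TensorProduct.tmul_add])
    (fun c a b => by ext <;> simp)
  cork_mem := Submodule.mem_prod.2 ⟨cork_mem, Submodule.mem_top⟩
  node_mem ha hb := by
    rw [Submodule.mem_prod] at ha hb ⊢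
    exact ⟨node_mem ha.1 hb.1, Submodule.mem_top⟩
  node_comm {m n a b} ha hb := by
    rw [Submodule.mem_prod] at ha hb
    simp only [LinearMap.mk₂_apply, Prod.smul_mk, ← node_comm ha.1 hb.1, Prod.mk.injEq, true_and]
    simp only [treeAlt, parity_apply D ha.1, parity_apply D hb.1, ← TensorProduct.smul_tmul',
      map_smul, LinearMap.smul_apply, LinearMap.sub_apply, LinearMap.id_apply,
      treeSwap_tmul D ha.1 hb.1, treeSwap_tmul D hb.1 ha.1, smul_sub, smul_smul]
    rw [← neg_sub, ← sub_eq_zero, ← neg_eq_zero]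
    have h1 : sgn K (m * n) * (sgn K n * (2⁻¹ * sgn K ((n + 1) * (m + 1)))) =
        -(sgn K m * 2⁻¹) := by
      rw [show sgn K (m * n) * (sgn K n * (2⁻¹ * sgn K ((n + 1) * (m + 1)))) =
        (sgn K (m * n) * sgn K n * sgn K ((n + 1) * (m + 1))) * 2⁻¹ by ring, ← sgn_add, ← sgn_add,
        ← neg_mul, neg_sgn, sgn_eq (b := m + 1) (m * n + n) (by ring)]
    have h2 : sgn K (m * n) * (sgn K n * 2⁻¹) =
        -(sgn K m * (2⁻¹ * sgn K ((m + 1) * (n + 1)))) := by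
      rw [show -(sgn K m * (2⁻¹ * sgn K ((m + 1) * (n + 1)))) =
        -(sgn K m * sgn K ((m + 1) * (n + 1))) * 2⁻¹ by ring, ← mul_assoc, ← sgn_add, ← sgn_add,
        neg_sgn, sgn_eq (a := m + (m + 1) * (n + 1) + 1) (b := m * n + n) (m + 1) (by ring)]
    rw [h1, h2]
    module

/-- The root splitting `sμ(a, b) ↦ ½ (a ⊗ b - τ (a ⊗ b))` of suspended trees, up to the sign
`(-1) ^ |a|`. The antisymmetrization makes it compatible with the commutativity of `sμ`. -/
noncomputable def rootSplit [CharZero K] : Trees D.gr →ₗ[K] Trees D.gr ⊗[K] Trees D.gr :=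
  LinearMap.snd K _ _ ∘ₗ lift (rootAlg D) (LinearMap.prod ι 0)
    (fun _ _ hx => Submodule.mem_prod.2 ⟨ι_mem hx, Submodule.mem_top⟩)

variable [CharZero K]

/-- The first component of the auxiliary map is the identity, so that the second one sees the two
trees above the root vertex. -/
theorem root_fst (t : Trees D.gr) :
    (lift (rootAlg D) (LinearMap.prod ι 0)
      (fun _ _ hx => Submodule.mem_prod.2 ⟨ι_mem hx, Submodule.mem_top⟩) t).1 = t := by
  have : LinearMap.fst K _ _ ∘ₗ lift (rootAlg D) (LinearMap.prod ι 0)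
      (fun _ _ hx => Submodule.mem_prod.2 ⟨ι_mem hx, Submodule.mem_top⟩) = LinearMap.id := by
    refine hom_ext_alg (fun x => ?_) ?_ (fun a b ha hb => ?_)
    · rw [LinearMap.comp_apply, lift_ι]; simp
    · exact congrArg Prod.fst (lift_cork _ _ _)
    · refine (congrArg Prod.fst (lift_node _ _ _ _ _)).trans ?_
      exact congrArg₂ (fun a b => node a b) ha hb
  exact LinearMap.congr_fun this t

@[simp] theorem rootSplit_ι (x : D) : rootSplit D (ι x) = 0 := by
  rw [rootSplit, LinearMap.comp_apply, lift_ι]; simp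

@[simp] theorem rootSplit_cork : rootSplit D (cork D.gr) = 0 :=
  congrArg Prod.snd (lift_cork (rootAlg D) _ _)

theorem rootSplit_node (a b : Trees D.gr) :
    rootSplit D (node a b) = treeAlt D (parity D a ⊗ₜ b) := by
  conv_rhs => rw [← root_fst D a, ← root_fst D b]
  exact congrArg Prod.snd (lift_node (rootAlg D) _ _ _ _)

/-- The root splitting inverts the suspended grafting up to antisymmetrization. -/
theorem rootSplit_bra (a b : Trees D.gr) : rootSplit D (bra D a b) = treeAlt D (a ⊗ₜ b) := by
  have : (TensorProduct.mk K _ _).compr₂ (rootSplit D ∘ₗ braT D) =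
      (TensorProduct.mk K _ _).compr₂ (treeAlt D) :=
    lin_ext_of_iSup (iSup_deg D) fun m a ha => LinearMap.ext fun b => by
      change rootSplit D (bra D a b) = treeAlt D (a ⊗ₜ b)
      rw [bra, LinearMap.comp_apply, rootSplit_node, parity_apply D ha, map_smul,
        parity_apply D ha, sgn_smul_sgn_smul]
  exact LinearMap.congr_fun (LinearMap.congr_fun this a) b

/-- The projection of trees to their part `sμ(x, y)` with labels `x`, `y`, as an antisymmetric
tensor. Its composite with the decomposition map of a coalgebra is the cobracket. -/
noncomputable def cobr : Trees D.gr →ₗ[K] D ⊗[K] D :=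
  TensorProduct.map (counit D.gr) (counit D.gr) ∘ₗ rootSplit D

@[simp] theorem cobr_ι (x : D) : cobr D (ι x) = 0 := by simp [cobr]

@[simp] theorem cobr_cork : cobr D (cork D.gr) = 0 := by simp [cobr]

theorem map_treeAlt {f : Trees D.gr →ₗ[K] D} (hf : ∀ n, ∀ x ∈ deg D.gr n, f x ∈ D.gr n)
    (t : Trees D.gr ⊗[K] Trees D.gr) :
    TensorProduct.map f f (treeAlt D t) = alt D (TensorProduct.map f f t) := by
  have : TensorProduct.map f f ∘ₗ treeAlt D = alt D ∘ₗ TensorProduct.map f f :=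
    tensor_ext_of_iSup (iSup_deg D) fun m n a ha b hb => by
      simp only [treeAlt, alt, LinearMap.comp_apply, LinearMap.smul_apply, LinearMap.sub_apply,
        LinearMap.id_apply, map_smul, map_sub, TensorProduct.map_tmul, treeSwap_tmul D ha hb,
        D.susp_swap_tmul (hf _ _ ha) (hf _ _ hb)]
  exact LinearMap.congr_fun this t

theorem treeAlt_map {f : D →ₗ[K] Trees D.gr} (hf : ∀ n, ∀ x ∈ D.gr n, f x ∈ deg D.gr n)
    (t : D ⊗[K] D) :
    treeAlt D (TensorProduct.map f f t) = TensorProduct.map f f (alt D t) := by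
  have : treeAlt D ∘ₗ TensorProduct.map f f = TensorProduct.map f f ∘ₗ alt D :=
    tensor_ext_of_iSup D.iSup_gr fun m n a ha b hb => by
      simp only [treeAlt, alt, LinearMap.comp_apply, LinearMap.smul_apply, LinearMap.sub_apply,
        LinearMap.id_apply, map_smul, map_sub, TensorProduct.map_tmul, D.susp_swap_tmul ha hb,
        treeSwap_tmul D (hf _ _ ha) (hf _ _ hb)]
  exact LinearMap.congr_fun this t

theorem cobr_bra (a b : Trees D.gr) :
    cobr D (bra D a b) = alt D (counit D.gr a ⊗ₜ counit D.gr b) := by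
  rw [cobr, LinearMap.comp_apply, rootSplit_bra,
    map_treeAlt D (f := counit D.gr) (fun _ _ h => counit_mem h), TensorProduct.map_tmul]

omit [CharZero K] in
/-- Variant of `hom_ext_homog` for the suspended grafting. -/
theorem bra_ext {B : Type w} [AddCommGroup B] [Module K B] {f g : Trees D.gr →ₗ[K] B}
    (hι : ∀ n, ∀ x ∈ D.gr n, f (ι x) = g (ι x)) (hc : f (cork D.gr) = g (cork D.gr))
    (hn : ∀ m n, ∀ a ∈ deg D.gr m, ∀ b ∈ deg D.gr n, f a = g a → f b = g b →
      f (bra D a b) = g (bra D a b)) : f = g :=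
  hom_ext_homog D hι hc fun m n a ha b hb h1 h2 => by
    rw [node_eq_bra D ha, map_smul, map_smul, hn m n a ha b hb h1 h2]

/-- If `Δ` has degree `0`, the part of `(Id ∘ Δ) t` whose bottom tree has one vertex only depends
on the part of `t` with one vertex. -/
theorem graftRoot_map {Δ : D →ₗ[K] Trees D.gr} (hΔ : ∀ n, ∀ x ∈ D.gr n, Δ x ∈ deg D.gr n)
    (t : Trees D.gr) :
    graftRoot D.gr (map Δ hΔ t) =
      corkCoeff D.gr t • cork D.gr + braT D (TensorProduct.map Δ Δ (cobr D t)) := by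
  have : graftRoot D.gr ∘ₗ map Δ hΔ =
      LinearMap.toSpanSingleton K _ (cork D.gr) ∘ₗ corkCoeff D.gr +
        braT D ∘ₗ TensorProduct.map Δ Δ ∘ₗ cobr D := by
    refine hom_ext_homog D (fun n x _ => by simp) (by simp) fun m n a ha b hb _ _ => ?_
    have ha' := hΔ _ _ (counit_mem ha)
    have hb' := hΔ _ _ (counit_mem hb)
    simp only [LinearMap.comp_apply, LinearMap.add_apply, map_node, graftRoot_node,
      corkCoeff_node, counit_map, map_zero, zero_add]
    rw [node_eq_bra D ha, map_smul, cobr_bra, map_smul, map_smul, alt, LinearMap.smul_apply,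
      LinearMap.sub_apply, map_smul, map_smul, map_sub, map_sub, braT_map_swap D hΔ hΔ,
      LinearMap.id_apply, sub_neg_eq_add, TensorProduct.map_tmul, braT_tmul, ← two_smul K,
      smul_smul 2⁻¹, inv_mul_cancel₀ two_ne_zero, one_smul, node_eq_bra D ha']
  have h := LinearMap.congr_fun this t
  simpa using h

theorem cobr_map {D' : GMod.{u, v} K} {f : D →ₗ[K] D'} (hf : ∀ n, ∀ x ∈ D.gr n, f x ∈ D'.gr n)
    (t : Trees D.gr) :
    cobr D' (map f hf t) = TensorProduct.map f f (cobr D t) := by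
  have : cobr D' ∘ₗ map f hf = TensorProduct.map f f ∘ₗ cobr D := by
    refine hom_ext_homog D (fun n x _ => by simp) (by simp) fun m n a ha b hb _ _ => ?_
    have ha' := counit_mem ha
    have hb' := counit_mem hb
    simp only [LinearMap.comp_apply, map_node]
    rw [node_eq_bra D ha, node_eq_bra D' (map_mem f hf ha), map_smul, map_smul, map_smul,
      cobr_bra, cobr_bra, counit_map, counit_map]
    simp only [alt, LinearMap.smul_apply, LinearMap.sub_apply, LinearMap.id_apply, map_smul,
      map_sub, TensorProduct.map_tmul, D.susp_swap_tmul ha' hb',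
      D'.susp_swap_tmul (hf _ _ ha') (hf _ _ hb')]
  exact LinearMap.congr_fun this t

theorem cobr_mem {n : ℤ} {t : Trees D.gr} (ht : t ∈ deg D.gr n) :
    cobr D t ∈ D.susp.tensorGr (n + 1) := by
  have hle : deg D.gr n ≤ (D.susp.tensorGr (n + 1)).comap (cobr D) := by
    refine Submodule.span_le.2 ?_
    rintro _ ⟨t, ht, rfl⟩
    change cobr D (mk D.gr t) ∈ D.susp.tensorGr (n + 1)
    cases ht with
    | leaf h => exact (cobr_ι D _).symm ▸ zero_mem _
    | cork => exact (cobr_cork D).symm ▸ zero_mem _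
    | @node p q a b ha hb =>
      have ha' : mk D.gr a ∈ deg D.gr p := Submodule.subset_span ⟨_, ha, rfl⟩
      have hb' : mk D.gr b ∈ deg D.gr q := Submodule.subset_span ⟨_, hb, rfl⟩
      have ha'' := counit_mem ha'
      have hb'' := counit_mem hb'
      rw [← node_mk, node_eq_bra D ha', map_smul, cobr_bra, alt, LinearMap.smul_apply,
        LinearMap.sub_apply, LinearMap.id_apply, D.susp_swap_tmul ha'' hb'']
      refine Submodule.smul_mem _ _ (Submodule.smul_mem _ _
        (sub_mem ?_ (Submodule.smul_mem _ _ ?_)))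
      · exact Submodule.subset_span ⟨p + 1, q + 1, _, _, by ring, D.mem_susp ha'',
          D.mem_susp hb'', rfl⟩
      · exact Submodule.subset_span ⟨q + 1, p + 1, _, _, by ring, D.mem_susp hb'',
          D.mem_susp ha'', rfl⟩
  exact hle ht

theorem swap_cobr (t : Trees D.gr) : D.susp.swap (cobr D t) = -cobr D t := by
  have : D.susp.swap ∘ₗ cobr D = -cobr D := by
    refine bra_ext D (fun n x _ => by simp) (by simp) fun m n a ha b hb _ _ => ?_
    rw [LinearMap.comp_apply, LinearMap.neg_apply, cobr_bra, alt, LinearMap.smul_apply,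
      LinearMap.sub_apply, LinearMap.id_apply, map_smul, map_sub, D.susp_swap_swap, ← smul_neg,
      neg_sub]
  exact LinearMap.congr_fun this t

/-! ### The coderivation and the curvature on trees -/

section Der

variable {d : D →ₗ[K] D} (hd : ∀ n, ∀ x ∈ D.gr n, d x ∈ D.gr (n - 1))

omit [CharZero K] in
theorem der_fst (t : Trees D.gr) :
    (lift (derAlg D) (LinearMap.prod ι (ι ∘ₗ d))
      (fun n x hx => Submodule.mem_prod.2 ⟨ι_mem hx, ι_mem (hd n x hx)⟩) t).1 = t := by
  have : LinearMap.fst K _ _ ∘ₗ lift (derAlg D) (LinearMap.prod ι (ι ∘ₗ d))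
      (fun n x hx => Submodule.mem_prod.2 ⟨ι_mem hx, ι_mem (hd n x hx)⟩) = LinearMap.id := by
    refine hom_ext_alg (fun x => ?_) ?_ (fun a b ha hb => ?_)
    · rw [LinearMap.comp_apply, lift_ι]; simp
    · exact congrArg Prod.fst (lift_cork _ _ _)
    · refine (congrArg Prod.fst (lift_node _ _ _ _ _)).trans ?_
      exact congrArg₂ (fun a b => node a b) ha hb
  exact LinearMap.congr_fun this t

omit [CharZero K] in
@[simp] theorem der_ι (x : D) : der D d hd (ι x) = ι (d x) := by
  rw [der, LinearMap.comp_apply, lift_ι]; simp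

omit [CharZero K] in
@[simp] theorem der_cork : der D d hd (cork D.gr) = 0 :=
  congrArg Prod.snd (lift_cork (derAlg D) _ _)

omit [CharZero K] in
theorem der_node (a b : Trees D.gr) : der D d hd (node a b) =
    -node (der D d hd a) b - node (parity D a) (der D d hd b) := by
  conv_rhs => rw [← der_fst D hd b, ← der_fst D hd a]
  rw [der_fst D hd a]
  refine (congrArg Prod.snd (lift_node (derAlg D) _ _ _ _)).trans ?_
  change -node _ _ - node (parity D _) _ = _
  rw [der_fst D hd a, der_fst D hd b]
  rfl

omit [CharZero K] in
theorem der_mem {n : ℤ} {t : Trees D.gr} (ht : t ∈ deg D.gr n) :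
    der D d hd t ∈ deg D.gr (n - 1) :=
  (Submodule.mem_prod.1 (lift_mem (derAlg D) _ _ ht)).2

omit [CharZero K] in
theorem der_bra {m : ℤ} {a : Trees D.gr} (ha : a ∈ deg D.gr m) (b : Trees D.gr) :
    der D d hd (bra D a b) = bra D (der D d hd a) b - bra D (parity D a) (der D d hd b) := by
  rw [bra_apply D ha, map_smul, der_node, bra_apply D (der_mem D hd ha),
    bra_apply D (parity_mem D ha), smul_sub, smul_neg, ← neg_smul]
  congr 2
  rw [neg_sgn]
  exact sgn_eq 1 (by ring)

omit [CharZero K] in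
theorem counit_der (t : Trees D.gr) : counit D.gr (der D d hd t) = d (counit D.gr t) := by
  have : counit D.gr ∘ₗ der D d hd = d ∘ₗ counit D.gr :=
    hom_ext_alg (fun x => by simp) (by simp) (fun a b _ _ => by simp [der_node])
  exact LinearMap.congr_fun this t

omit [CharZero K] in
theorem corkCoeff_der (t : Trees D.gr) : corkCoeff D.gr (der D d hd t) = 0 := by
  have : corkCoeff D.gr ∘ₗ der D d hd = 0 :=
    hom_ext_alg (fun x => by simp) (by simp) (fun a b _ _ => by simp [der_node])
  exact LinearMap.congr_fun this t

theorem cobr_der (t : Trees D.gr) : cobr D (der D d hd t) = D.tensorDer d (cobr D t) := by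
  have : cobr D ∘ₗ der D d hd = D.tensorDer d ∘ₗ cobr D := by
    refine bra_ext D (fun n x _ => by simp) (by simp) fun m n a ha b hb _ _ => ?_
    have ha' := counit_mem ha
    have key : alt D (D.tensorDer d (counit D.gr a ⊗ₜ counit D.gr b)) =
        D.tensorDer d (alt D (counit D.gr a ⊗ₜ counit D.gr b)) := by
      simp only [alt, LinearMap.smul_apply, LinearMap.sub_apply, LinearMap.id_apply, map_smul,
        map_sub, D.susp_swap_der hd]
    rw [LinearMap.comp_apply, LinearMap.comp_apply, der_bra D hd ha, map_sub, cobr_bra, cobr_bra,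
      cobr_bra, ← key, D.tensorDer_tmul d ha', map_sub, parity_apply D ha, counit_der, counit_der,
      map_smul, ← TensorProduct.smul_tmul']
  exact LinearMap.congr_fun this t

end Der

/-- The map to the auxiliary algebra for the curvature, whose components are the coefficient of
`sξ`, the counit and the curvature. -/
noncomputable def curvLift : Trees D.gr →ₗ[K] K × D × D :=
  lift (curvAlg D) (LinearMap.prod 0 (LinearMap.prod LinearMap.id 0))
    (fun _ _ hx => Submodule.mem_prod.2 ⟨zero_mem _, Submodule.mem_prod.2 ⟨hx, zero_mem _⟩⟩)

omit [CharZero K] in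
theorem curvLift_node (a b : Trees D.gr) : curvLift D (node a b) =
    (curvAlg D).node (curvLift D a) (curvLift D b) := lift_node _ _ _ _ _

omit [CharZero K] in
theorem curvLift_cork : curvLift D (cork D.gr) = (1, 0, 0) := lift_cork _ _ _

omit [CharZero K] in
theorem curvLift_ι (x : D) : curvLift D (ι x) = (0, x, 0) := lift_ι _ _ _ _

omit [CharZero K] in
theorem curvLift_fst (t : Trees D.gr) : (curvLift D t).1 = corkCoeff D.gr t := by
  have : LinearMap.fst K _ _ ∘ₗ curvLift D = corkCoeff D.gr :=
    hom_ext_alg (fun x => by simp [curvLift_ι]) (by simp [curvLift_cork])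
      (fun a b _ _ => by simp [curvLift_node, curvAlg])
  exact LinearMap.congr_fun this t

omit [CharZero K] in
theorem curvLift_snd_fst (t : Trees D.gr) : (curvLift D t).2.1 = counit D.gr t := by
  have : LinearMap.fst K _ _ ∘ₗ LinearMap.snd K _ _ ∘ₗ curvLift D = counit D.gr :=
    hom_ext_alg (fun x => by simp [curvLift_ι]) (by simp [curvLift_cork])
      (fun a b _ _ => by simp [curvLift_node, curvAlg])
  exact LinearMap.congr_fun this t

omit [CharZero K] in
@[simp] theorem curv_ι (x : D) : curv D (ι x) = 0 := by
  exact congrArg (fun z => z.2.2) (curvLift_ι D x)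

omit [CharZero K] in
@[simp] theorem curv_cork : curv D (cork D.gr) = 0 :=
  congrArg (fun z => z.2.2) (curvLift_cork D)

omit [CharZero K] in
theorem curv_node (a b : Trees D.gr) : curv D (node a b) =
    -(corkCoeff D.gr a • counit D.gr b + corkCoeff D.gr b • D.parity (counit D.gr a)) := by
  rw [← curvLift_fst, ← curvLift_fst, ← curvLift_snd_fst, ← curvLift_snd_fst]
  exact congrArg (fun z => z.2.2) (curvLift_node D a b)

omit [CharZero K] in
theorem curv_bra (a b : Trees D.gr) : curv D (bra D a b) =
    corkCoeff D.gr a • counit D.gr b - corkCoeff D.gr b • counit D.gr a := by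
  have : curv D ∘ₗ braT D = (TensorProduct.lid K D).toLinearMap ∘ₗ
      TensorProduct.map (corkCoeff D.gr) (counit D.gr) - (TensorProduct.rid K D).toLinearMap ∘ₗ
      TensorProduct.map (counit D.gr) (corkCoeff D.gr) :=
    tensor_ext_of_iSup (iSup_deg D) fun m n a ha b hb => by
      simp only [LinearMap.comp_apply, braT_tmul, LinearMap.sub_apply, TensorProduct.map_tmul,
        LinearEquiv.coe_coe, TensorProduct.lid_tmul, TensorProduct.rid_tmul]
      rw [bra_apply D ha, map_smul, curv_node, D.parity_apply (counit_mem ha), smul_neg, smul_add,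
        smul_comm (sgn K m) (corkCoeff D.gr b), sgn_smul_sgn_smul, neg_add, ← sub_eq_add_neg]
      congr 1
      by_cases hm : m = 1
      · subst hm
        rw [sgn_one, neg_one_smul, neg_neg]
      · rw [corkCoeff_of_mem ha hm, zero_smul, smul_zero, neg_zero]
  have h := LinearMap.congr_fun this (a ⊗ₜ b)
  simpa using h

end GMod

end Trees

/-! ### Maps which factor through iterated cobrackets -/

section Factor

variable {K : Type u} [Field K] {L : Type v} [AddCommGroup L] [Module K L]
  (δ : L →ₗ[K] L ⊗[K] L)

/-- The space of linear maps which are sums of maps factoring through a composite of `n` maps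
`Id ⊗ ⋯ ⊗ δ ⊗ ⋯ ⊗ Id`. -/
def factor (M : Type w) [AddCommGroup M] [Module K M] (n : ℕ) : Submodule K (L →ₗ[K] M) :=
  Submodule.span K {u | ∃ (S : BinaryTree Unit) (g : treeTensor (ModuleCat.of K L) S →ₗ[K] M),
    S.numNodes = n ∧ u = g ∘ₗ iterCobracket (ModuleCat.of K L) δ S}

variable {M : Type w} [AddCommGroup M] [Module K M]
  {M₁ : Type*} [AddCommGroup M₁] [Module K M₁] {M₂ : Type*} [AddCommGroup M₂] [Module K M₂]

theorem mem_factor_zero (u : L →ₗ[K] M) : u ∈ factor δ M 0 :=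
  Submodule.subset_span ⟨.nil, u, rfl, rfl⟩

variable {δ} in
/-- Maps which factor through `i` and `j` cobrackets, applied to the two factors of a cobracket,
factor through `i + j + 1` cobrackets. -/
theorem factor_node (m : M₁ ⊗[K] M₂ →ₗ[K] M) {i j : ℕ} {u : L →ₗ[K] M₁} {v : L →ₗ[K] M₂}
    (hu : u ∈ factor δ M₁ i) (hv : v ∈ factor δ M₂ j) :
    m ∘ₗ TensorProduct.map u v ∘ₗ δ ∈ factor δ M (i + j + 1) := by
  refine Submodule.span_induction₂
    (p := fun u v _ _ => m ∘ₗ TensorProduct.map u v ∘ₗ δ ∈ factor δ M (i + j + 1))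
    ?_ ?_ ?_ ?_ ?_ ?_ ?_ hu hv
  · rintro _ _ ⟨S, g, rfl, rfl⟩ ⟨T, h, rfl, rfl⟩
    refine Submodule.subset_span ⟨.node () S T, m ∘ₗ TensorProduct.map g h, rfl, ?_⟩
    rw [TensorProduct.map_comp]
    rfl
  · intro v _
    rw [TensorProduct.map_zero_left, LinearMap.zero_comp, LinearMap.comp_zero]
    exact zero_mem _
  · intro u _
    rw [TensorProduct.map_zero_right, LinearMap.zero_comp, LinearMap.comp_zero]
    exact zero_mem _
  · intro x y z _ _ _ h₁ h₂
    rw [TensorProduct.map_add_left, LinearMap.add_comp, LinearMap.comp_add]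
    exact add_mem h₁ h₂
  · intro x y z _ _ _ h₁ h₂
    rw [TensorProduct.map_add_right, LinearMap.add_comp, LinearMap.comp_add]
    exact add_mem h₁ h₂
  · intro c x y _ _ h
    rw [TensorProduct.map_smul_left, LinearMap.smul_comp, LinearMap.comp_smul]
    exact Submodule.smul_mem _ _ h
  · intro c x y _ _ h
    rw [TensorProduct.map_smul_right, LinearMap.smul_comp, LinearMap.comp_smul]
    exact Submodule.smul_mem _ _ h

theorem map_comp_left_comp {N₁ N₂ N₃ : Type*} [AddCommGroup N₁] [Module K N₁] [AddCommGroup N₂]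
    [Module K N₂] [AddCommGroup N₃] [Module K N₃] (g : N₁ →ₗ[K] N₂) (u : L →ₗ[K] N₁)
    (v : L →ₗ[K] N₃) : TensorProduct.map (g ∘ₗ u) v ∘ₗ δ =
      TensorProduct.map g LinearMap.id ∘ₗ TensorProduct.map u v ∘ₗ δ := by
  rw [← LinearMap.comp_assoc, ← TensorProduct.map_comp, LinearMap.id_comp]

theorem map_comp_right_comp {N₁ N₂ N₃ : Type*} [AddCommGroup N₁] [Module K N₁] [AddCommGroup N₂]
    [Module K N₂] [AddCommGroup N₃] [Module K N₃] (g : N₁ →ₗ[K] N₂) (u : L →ₗ[K] N₁)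
    (v : L →ₗ[K] N₃) : TensorProduct.map v (g ∘ₗ u) ∘ₗ δ =
      TensorProduct.map LinearMap.id g ∘ₗ TensorProduct.map v u ∘ₗ δ := by
  rw [← LinearMap.comp_assoc, ← TensorProduct.map_comp, LinearMap.id_comp]

/-- A tree with `n + 1` inner vertices is obtained from a tree with `n` inner vertices by splitting
a leaf. -/
theorem exists_iterCobracket_eq (S : BinaryTree Unit) : ∀ n, S.numNodes = n + 1 →
    ∃ (T : BinaryTree Unit) (g : treeTensor (ModuleCat.of K L) T →ₗ[K]
      treeTensor (ModuleCat.of K L) S), T.numNodes = n ∧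
      iterCobracket (ModuleCat.of K L) δ S = g ∘ₗ iterCobracket (ModuleCat.of K L) δ T := by
  induction S with
  | nil => intro n h; simp at h
  | node a l r ihl ihr =>
    intro n h
    have h' : l.numNodes + r.numNodes = n := by simpa using h
    rcases hl : l.numNodes with _ | k
    · rcases hr : r.numNodes with _ | k
      · obtain rfl : n = 0 := by omega
        exact ⟨.nil, iterCobracket (ModuleCat.of K L) δ (.node a l r), rfl, rfl⟩
      · obtain ⟨T, g, hT, hg⟩ := ihr k hr
        refine ⟨.node a l T, TensorProduct.map LinearMap.id g, ?_, ?_⟩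
        · simp only [BinaryTree.numNodes]; omega
        · exact (congrArg (fun u => TensorProduct.map _ u ∘ₗ δ) hg).trans
            (map_comp_right_comp δ g _ _)
    · obtain ⟨T, g, hT, hg⟩ := ihl k hl
      refine ⟨.node a T r, TensorProduct.map g LinearMap.id, ?_, ?_⟩
      · simp only [BinaryTree.numNodes]; omega
      · exact (congrArg (fun u => TensorProduct.map u _ ∘ₗ δ) hg).trans
          (map_comp_left_comp δ g _ _)

/-- A map which factors through `n + 1` cobrackets factors through `n` of them. -/
theorem factor_antitone : Antitone (factor δ M) := antitone_nat_of_succ_le fun n => by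
  refine Submodule.span_le.2 ?_
  rintro _ ⟨S, g, hS, rfl⟩
  obtain ⟨T, h, hT, hh⟩ := exists_iterCobracket_eq δ S n hS
  rw [hh, ← LinearMap.comp_assoc]
  exact Submodule.subset_span ⟨T, _, hT, rfl⟩

variable {δ} in
theorem factor_apply_eq_zero {n : ℕ} {x : L}
    (hx : ∀ S : BinaryTree Unit, S.numNodes = n → iterCobracket (ModuleCat.of K L) δ S x = 0)
    {k : ℕ} (hk : n ≤ k) {u : L →ₗ[K] M} (hu : u ∈ factor δ M k) : u x = 0 := by
  have hle : factor δ M n ≤ LinearMap.ker (LinearMap.applyₗ (R := K) (M₂ := M) x) := by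
    refine Submodule.span_le.2 ?_
    rintro _ ⟨S, g, hS, rfl⟩
    change g (iterCobracket (ModuleCat.of K L) δ S x) = 0
    rw [hx S hS, map_zero]
  exact hle (factor_antitone δ hk hu)

/-- The cobracket `δ` is conilpotent. -/
def IsConilp : Prop := ∀ x : L, ∃ n : ℕ, ∀ S : BinaryTree Unit, S.numNodes = n →
  iterCobracket (ModuleCat.of K L) δ S x = 0

variable {δ}

/-- A linear recursion along a conilpotent cobracket has only the zero solution. -/
theorem IsConilp.eq_zero (hδ : IsConilp δ) {Z : L →ₗ[K] M} {U : L →ₗ[K] M₁} {U' : L →ₗ[K] M₂}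
    {m : M ⊗[K] M₁ →ₗ[K] M} {m' : M₂ ⊗[K] M →ₗ[K] M}
    (h : Z = m ∘ₗ TensorProduct.map Z U ∘ₗ δ + m' ∘ₗ TensorProduct.map U' Z ∘ₗ δ) : Z = 0 := by
  have hn : ∀ n, Z ∈ factor δ M n := by
    intro n
    -- Inserting the recursion into itself produces one more cobracket.
    induction n with
    | zero => exact mem_factor_zero δ Z
    | succ n ih =>
      have h₁ := factor_node m ih (mem_factor_zero δ U)
      have h₂ := factor_node m' (mem_factor_zero δ U') ih
      rw [zero_add] at h₂
      have h₃ := Submodule.add_mem _ h₁ h₂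
      rwa [← h] at h₃
  refine LinearMap.ext fun x => ?_
  obtain ⟨n, hx⟩ := hδ x
  exact factor_apply_eq_zero hx le_rfl (hn n)

/-- The recursion `X = κ + m (X ⊗ X) δ` along a conilpotent cobracket has at most one
solution. -/
theorem IsConilp.unique (hδ : IsConilp δ) {κ X Y : L →ₗ[K] M} {m : M ⊗[K] M →ₗ[K] M}
    (hX : X = κ + m ∘ₗ TensorProduct.map X X ∘ₗ δ)
    (hY : Y = κ + m ∘ₗ TensorProduct.map Y Y ∘ₗ δ) : X = Y := by
  have h : X - Y = m ∘ₗ TensorProduct.map (X - Y) X ∘ₗ δ +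
      m ∘ₗ TensorProduct.map Y (X - Y) ∘ₗ δ := by
    conv_lhs => rw [hX, hY]
    rw [sub_eq_add_neg X Y, TensorProduct.map_add_left, TensorProduct.map_add_right,
      ← neg_one_smul K Y, TensorProduct.map_smul_left, TensorProduct.map_smul_right]
    simp only [LinearMap.add_comp, LinearMap.comp_add, LinearMap.smul_comp, LinearMap.comp_smul]
    module
  exact sub_eq_zero.1 (hδ.eq_zero h)

/-- The homogeneous components of the solution of the recursion `X = κ + m (X ⊗ X) δ`: the
component `n` is the part in which `δ` is applied `n` times. -/
noncomputable def recComp (δ : L →ₗ[K] L ⊗[K] L) (κ : L →ₗ[K] M) (m : M ⊗[K] M →ₗ[K] M) :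
    ℕ → L →ₗ[K] M
  | 0 => κ
  | n + 1 => ∑ p : Finset.HasAntidiagonal.antidiagonal n,
      m ∘ₗ TensorProduct.map (recComp δ κ m p.1.1) (recComp δ κ m p.1.2) ∘ₗ δ
decreasing_by
  · have := Finset.HasAntidiagonal.mem_antidiagonal.1 p.2; omega
  · have := Finset.HasAntidiagonal.mem_antidiagonal.1 p.2; omega

variable {κ : L →ₗ[K] M} {m : M ⊗[K] M →ₗ[K] M}

theorem recComp_zero : recComp δ κ m 0 = κ := by rw [recComp]

theorem recComp_succ (n : ℕ) : recComp δ κ m (n + 1) =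
    ∑ p ∈ Finset.HasAntidiagonal.antidiagonal n,
      m ∘ₗ TensorProduct.map (recComp δ κ m p.1) (recComp δ κ m p.2) ∘ₗ δ := by
  rw [recComp]
  exact Finset.sum_coe_sort (Finset.HasAntidiagonal.antidiagonal n) fun p =>
    m ∘ₗ TensorProduct.map (recComp δ κ m p.1) (recComp δ κ m p.2) ∘ₗ δ

theorem recComp_mem_factor (n : ℕ) : recComp δ κ m n ∈ factor δ M n := by
  induction n using Nat.strong_induction_on with
  | _ n ih =>
    cases n with
    | zero => exact mem_factor_zero δ _
    | succ n =>
      rw [recComp_succ]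
      refine Submodule.sum_mem _ fun p hp => ?_
      have hp := Finset.HasAntidiagonal.mem_antidiagonal.1 hp
      rw [← hp]
      exact factor_node m (ih _ (by omega)) (ih _ (by omega))

theorem IsConilp.finite_support (hδ : IsConilp δ) (x : L) :
    ∃ N, ∀ n, N ≤ n → recComp δ κ m n x = 0 := by
  obtain ⟨N, hN⟩ := hδ x
  exact ⟨N, fun n hn => factor_apply_eq_zero hN hn (recComp_mem_factor n)⟩

/-- The solution of the recursion `X = κ + m (X ⊗ X) δ` along a conilpotent cobracket. -/
noncomputable def IsConilp.sol (hδ : IsConilp δ) (κ : L →ₗ[K] M) (m : M ⊗[K] M →ₗ[K] M) :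
    L →ₗ[K] M :=
  have hfin : ∀ x, (Function.support fun n => recComp δ κ m n x).Finite := fun x => by
    obtain ⟨N, hN⟩ := hδ.finite_support (κ := κ) (m := m) x
    refine (Set.finite_lt_nat N).subset fun n hn => ?_
    by_contra h
    exact hn (hN n (not_lt.1 h))
  { toFun := fun x => ∑ᶠ n, recComp δ κ m n x
    map_add' := fun x y => by
      simp only [map_add]
      exact finsum_add_distrib (hfin x) (hfin y)
    map_smul' := fun c x => by
      simp only [map_smul, RingHom.id_apply]
      exact (smul_finsum c _).symm }

theorem IsConilp.sol_eq_sum (hδ : IsConilp δ) {x : L} {N : ℕ}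
    (hN : ∀ n, N ≤ n → recComp δ κ m n x = 0) :
    hδ.sol κ m x = ∑ n ∈ Finset.range N, recComp δ κ m n x := by
  refine finsum_eq_sum_of_support_subset _ fun n hn => ?_
  rw [Finset.coe_range, Set.mem_Iio]
  by_contra h
  exact hn (hN n (not_lt.1 h))

/-- On a given tensor, the tensor square of the solution only involves finitely many
components. -/
theorem IsConilp.map_sol_eq_sum (hδ : IsConilp δ) (t : L ⊗[K] L) : ∃ N₀, ∀ N, N₀ ≤ N →
    TensorProduct.map (hδ.sol κ m) (hδ.sol κ m) t =
      TensorProduct.map (∑ n ∈ Finset.range N, recComp δ κ m n)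
        (∑ n ∈ Finset.range N, recComp δ κ m n) t := by
  induction t with
  | zero => exact ⟨0, fun N _ => by simp⟩
  | tmul x y =>
    obtain ⟨N₁, h₁⟩ := hδ.finite_support (κ := κ) (m := m) x
    obtain ⟨N₂, h₂⟩ := hδ.finite_support (κ := κ) (m := m) y
    refine ⟨max N₁ N₂, fun N hN => ?_⟩
    rw [TensorProduct.map_tmul, TensorProduct.map_tmul, LinearMap.sum_apply, LinearMap.sum_apply,
      hδ.sol_eq_sum fun n hn => h₁ n (((le_max_left _ _).trans hN).trans hn),
      hδ.sol_eq_sum fun n hn => h₂ n (((le_max_right _ _).trans hN).trans hn)]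
  | add s t hs ht =>
    obtain ⟨N₁, h₁⟩ := hs
    obtain ⟨N₂, h₂⟩ := ht
    refine ⟨max N₁ N₂, fun N hN => ?_⟩
    rw [map_add, map_add, h₁ N ((le_max_left _ _).trans hN), h₂ N ((le_max_right _ _).trans hN)]

/-- `X = κ + m (X ⊗ X) δ` for the solution `X`. -/
theorem IsConilp.sol_eq (hδ : IsConilp δ) :
    hδ.sol κ m = κ + m ∘ₗ TensorProduct.map (hδ.sol κ m) (hδ.sol κ m) ∘ₗ δ := by
  -- The partial sums satisfy the recursion up to terms with more than `N` cobrackets, which vanish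
  -- on a given element for large `N`.
  have key : ∀ N, ∑ n ∈ Finset.range (N + 1), recComp δ κ m n - (κ +
      m ∘ₗ TensorProduct.map (∑ n ∈ Finset.range N, recComp δ κ m n)
        (∑ n ∈ Finset.range N, recComp δ κ m n) ∘ₗ δ) ∈ factor δ M (N + 1) := by
    intro N
    set f : ℕ × ℕ → L →ₗ[K] M := fun p =>
      m ∘ₗ TensorProduct.map (recComp δ κ m p.1) (recComp δ κ m p.2) ∘ₗ δ with hf
    have h₁ : m ∘ₗ TensorProduct.map (∑ n ∈ Finset.range N, recComp δ κ m n)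
        (∑ n ∈ Finset.range N, recComp δ κ m n) ∘ₗ δ =
        ∑ p ∈ Finset.range N ×ˢ Finset.range N, f p := by
      rw [Finset.sum_product]
      have hl : ∀ (s : Finset ℕ) (u : ℕ → L →ₗ[K] M) (v : L →ₗ[K] M),
          TensorProduct.map (∑ n ∈ s, u n) v = ∑ n ∈ s, TensorProduct.map (u n) v :=
        fun s u v => map_sum ((TensorProduct.mapBilinear (RingHom.id K) L L M M).flip v) u s
      have hr : ∀ (s : Finset ℕ) (u : ℕ → L →ₗ[K] M) (v : L →ₗ[K] M),
          TensorProduct.map v (∑ n ∈ s, u n) = ∑ n ∈ s, TensorProduct.map v (u n) :=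
        fun s u v => map_sum (TensorProduct.mapBilinear (RingHom.id K) L L M M v) u s
      rw [hl]
      refine LinearMap.ext fun x => ?_
      simp only [hr, hf, LinearMap.sum_apply, LinearMap.comp_apply, map_sum]
    have h₂ : ∑ n ∈ Finset.range (N + 1), recComp δ κ m n = κ +
        ∑ p ∈ Finset.range N ×ˢ Finset.range N with p.1 + p.2 < N, f p := by
      rw [Finset.sum_range_succ', recComp_zero, add_comm]
      congr 1
      rw [← Finset.sum_fiberwise_of_maps_to (t := Finset.range N) (g := fun p : ℕ × ℕ => p.1 + p.2)
        (fun p hp => Finset.mem_range.2 (Finset.mem_filter.1 hp).2)]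
      refine Finset.sum_congr rfl fun n hn => ?_
      rw [recComp_succ]
      refine Finset.sum_congr (Finset.ext fun p => ?_) fun _ _ => rfl
      have hn := Finset.mem_range.1 hn
      simp only [Finset.HasAntidiagonal.mem_antidiagonal, Finset.mem_filter, Finset.mem_product,
        Finset.mem_range]
      omega
    rw [h₁, h₂, ← Finset.sum_filter_add_sum_filter_not (Finset.range N ×ˢ Finset.range N)
      (fun p : ℕ × ℕ => p.1 + p.2 < N) f, ← add_assoc, sub_add_cancel_left]
    refine neg_mem (Submodule.sum_mem _ fun p hp => ?_)
    have hp := (Finset.mem_filter.1 hp).2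
    exact factor_antitone δ (by omega)
      (factor_node m (recComp_mem_factor p.1) (recComp_mem_factor p.2))
  refine LinearMap.ext fun x => ?_
  obtain ⟨N₁, h₁⟩ := hδ x
  obtain ⟨N₂, h₂⟩ := hδ.map_sol_eq_sum (κ := κ) (m := m) (δ x)
  have h := factor_apply_eq_zero h₁ ((le_max_left N₁ N₂).trans (Nat.le_succ _))
    (key (max N₁ N₂))
  rw [LinearMap.sub_apply, sub_eq_zero] at h
  rw [hδ.sol_eq_sum (N := max N₁ N₂ + 1) (x := x) fun n hn => factor_apply_eq_zero h₁
    (((le_max_left N₁ N₂).trans (Nat.le_succ _)).trans hn) (recComp_mem_factor n),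
    ← LinearMap.sum_apply, h, LinearMap.add_apply, LinearMap.add_apply, LinearMap.comp_apply,
    LinearMap.comp_apply, LinearMap.comp_apply, LinearMap.comp_apply, h₂ _ (le_max_right _ _)]

end Factor

namespace PTree

variable {L : Type v}

/-- The number of vertices, as a natural number. -/
def vertices : PTree L → ℕ
  | leaf _ => 0
  | cork => 1
  | node a b => vertices a + vertices b + 1

theorem numVert_eq (t : PTree L) : t.numVert = t.vertices := by
  induction t with
  | leaf => rfl
  | cork => rfl
  | node a b iha ihb => simp only [numVert, vertices, iha, ihb]; push_cast; rfl

theorem vertices_map {M : Type w} (f : L → M) (t : PTree L) :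
    (t.map f).vertices = t.vertices := by
  induction t with
  | leaf => rfl
  | cork => rfl
  | node a b iha ihb => simp only [map, vertices, iha, ihb]

end PTree

namespace Trees

/-! ### The weight grading -/

section Weight

variable {K : Type u} [Field K] {V : Type v} [AddCommGroup V] [Module K V]
  {gr : ℤ → Submodule K V}

theorem weight_mk (k : ℕ) (t : PTree V) :
    weight gr k (mk gr t) = if t.vertices = k then mk gr t else 0 := by
  have key : eval (weightAlg gr) (LinearMap.single K (fun _ : ℕ => Trees gr) 0 ∘ₗ ι) t =
      Pi.single t.vertices (mk gr t) := by
    induction t with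
    | leaf x => rfl
    | cork => rfl
    | node a b iha ihb =>
      rw [eval, iha, ihb]
      ext k
      cases k with
      | zero =>
        exact (Pi.single_eq_of_ne (M := fun _ : ℕ => Trees gr) (Nat.succ_ne_zero _).symm _).symm
      | succ k =>
        change ∑ p ∈ Finset.HasAntidiagonal.antidiagonal k,
          node (Pi.single (M := fun _ : ℕ => Trees gr) a.vertices (mk gr a) p.1)
            (Pi.single (M := fun _ : ℕ => Trees gr) b.vertices (mk gr b) p.2) = _
        by_cases h : a.vertices + b.vertices = k
        · subst h
          rw [Finset.sum_eq_single (a.vertices, b.vertices), Pi.single_eq_same, Pi.single_eq_same,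
            node_mk]
          · exact (Pi.single_eq_same (M := fun _ : ℕ => Trees gr) _ _).symm
          · rintro ⟨i, j⟩ hp hne
            have hp := Finset.HasAntidiagonal.mem_antidiagonal.1 hp
            by_cases hi : i = a.vertices
            · subst hi
              have hj : j ≠ b.vertices := fun hj => hne (by rw [hj])
              rw [Pi.single_eq_of_ne hj, map_zero]
            · rw [Pi.single_eq_of_ne hi, map_zero, LinearMap.zero_apply]
          · intro h
            exact (h (Finset.HasAntidiagonal.mem_antidiagonal.2 rfl)).elim
        · rw [Pi.single_eq_of_ne (by simp only [PTree.vertices]; omega)]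
          refine Finset.sum_eq_zero ?_
          rintro ⟨i, j⟩ hp
          have hp := Finset.HasAntidiagonal.mem_antidiagonal.1 hp
          by_cases hi : i = a.vertices
          · subst hi
            have hj : j ≠ b.vertices := fun hj => h (by rw [← hj]; exact hp)
            rw [Pi.single_eq_of_ne hj, map_zero]
          · rw [Pi.single_eq_of_ne hi, map_zero, LinearMap.zero_apply]
  rw [weight, LinearMap.comp_apply, lift_mk, key, LinearMap.proj_apply, Pi.single_apply]
  simp only [eq_comm]

end Weight

/-! ### The cobracket of a coalgebra over the tree cooperad -/

section Coalgebra

variable {K : Type u} [Field K] [CharZero K] (D : GMod.{u, v} K)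

/-- The projection of trees onto the tensors of the shape prescribed by a binary tree, which
iterates the root splitting. -/
noncomputable def treeProj :
    (S : BinaryTree Unit) → Trees D.gr →ₗ[K] treeTensor (ModuleCat.of K D) S
  | .nil => counit D.gr
  | .node _ l r => TensorProduct.map (treeProj l) (treeProj r) ∘ₗ rootSplit D

theorem treeProj_node_apply (l r : BinaryTree Unit) {m n : ℤ} {a b : Trees D.gr}
    (ha : a ∈ deg D.gr m) (hb : b ∈ deg D.gr n) (h₁ : treeProj D l a = 0 ∨ treeProj D r b = 0)
    (h₂ : treeProj D l b = 0 ∨ treeProj D r a = 0) : treeProj D (.node () l r) (node a b) = 0 := by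
  change TensorProduct.map (treeProj D l) (treeProj D r) (rootSplit D (node a b)) =
    (0 : treeTensor (ModuleCat.of K D) l ⊗[K] treeTensor (ModuleCat.of K D) r)
  have e₁ : treeProj D l a ⊗ₜ[K] treeProj D r b = 0 := by
    rcases h₁ with h | h <;> simp [h]
  have e₂ : treeProj D l b ⊗ₜ[K] treeProj D r a = 0 := by
    rcases h₂ with h | h <;> simp [h]
  rw [rootSplit_node, parity_apply D ha, ← TensorProduct.smul_tmul', map_smul, map_smul, treeAlt,
    LinearMap.smul_apply, LinearMap.sub_apply, LinearMap.id_apply, treeSwap_tmul D ha hb, map_smul,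
    map_sub, map_smul, TensorProduct.map_tmul, TensorProduct.map_tmul, e₁, e₂]
  simp

/-- A tree has no component in the shapes with a different number of vertices. -/
theorem treeProj_mk {t : PTree D} {n : ℤ} (ht : t.HasDeg D.gr n) (S : BinaryTree Unit)
    (hS : t.vertices ≠ S.numNodes) : treeProj D S (mk D.gr t) = 0 := by
  induction ht generalizing S with
  | leaf h =>
    cases S with
    | nil => exact (hS rfl).elim
    | node _ l r =>
      change TensorProduct.map (treeProj D l) (treeProj D r) (rootSplit D (ι _)) =
        (0 : treeTensor (ModuleCat.of K D) l ⊗[K] treeTensor (ModuleCat.of K D) r)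
      rw [rootSplit_ι, map_zero]
  | cork =>
    cases S with
    | nil => exact (counit_cork : counit D.gr (cork D.gr) = 0)
    | node _ l r =>
      change TensorProduct.map (treeProj D l) (treeProj D r) (rootSplit D (cork D.gr)) =
        (0 : treeTensor (ModuleCat.of K D) l ⊗[K] treeTensor (ModuleCat.of K D) r)
      rw [rootSplit_cork, map_zero]
  | @node p q a b ha hb iha ihb =>
    rw [← node_mk]
    cases S with
    | nil => exact (counit_node _ _ : counit D.gr (node (mk D.gr a) (mk D.gr b)) = 0)
    | node _ l r =>
      simp only [PTree.vertices, BinaryTree.numNodes, ne_eq, Nat.add_right_cancel_iff] at hS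
      refine treeProj_node_apply D l r (Submodule.subset_span ⟨_, ha, rfl⟩)
        (Submodule.subset_span ⟨_, hb, rfl⟩) ?_ ?_
      · by_cases h : a.vertices = l.numNodes
        · exact Or.inr (ihb r (by omega))
        · exact Or.inl (iha l h)
      · by_cases h : b.vertices = l.numNodes
        · exact Or.inr (iha r (by omega))
        · exact Or.inl (ihb l h)

/-- A linear combination of trees has no component in the shapes with many vertices. -/
theorem exists_treeProj_eq_zero (y : Trees D.gr) :
    ∃ N, ∀ S : BinaryTree Unit, N ≤ S.numNodes → treeProj D S y = 0 := by
  let B : Submodule K (Trees D.gr) :=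
    { carrier := {y | ∃ N, ∀ S : BinaryTree Unit, N ≤ S.numNodes → treeProj D S y = 0}
      zero_mem' := ⟨0, fun S _ => map_zero _⟩
      add_mem' := by
        rintro x y ⟨M, hM⟩ ⟨N, hN⟩
        refine ⟨max M N, fun S hS => ?_⟩
        rw [map_add, hM S ((le_max_left _ _).trans hS), hN S ((le_max_right _ _).trans hS),
          add_zero]
      smul_mem' := by
        rintro c x ⟨M, hM⟩
        exact ⟨M, fun S hS => by rw [map_smul, hM S hS, smul_zero]⟩ }
  have hB : iSup (deg D.gr) ≤ B := by
    refine iSup_le fun n => Submodule.span_le.2 ?_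
    rintro _ ⟨t, ht, rfl⟩
    exact ⟨t.vertices + 1, fun S hS => treeProj_mk D ht S (by omega)⟩
  rw [iSup_deg] at hB
  exact hB (Submodule.mem_top (x := y))

/-- The deviation of the binary part of a map to trees from the Jacobi identity, as a function of
the value of the map. -/
noncomputable def jac : Trees D.gr →ₗ[K] D ⊗[K] (D ⊗[K] D) :=
  ((TensorProduct.assoc K D D D).toLinearMap ∘ₗ TensorProduct.map (cobr D) (counit D.gr) -
    TensorProduct.map (counit D.gr) (cobr D) - D.susp.swap.lTensor D ∘ₗ
      (TensorProduct.assoc K D D D).toLinearMap ∘ₗ TensorProduct.map (cobr D) (counit D.gr)) ∘ₗ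
    rootSplit D

variable {D} {Δ : D →ₗ[K] Trees D.gr} (hΔ : ∀ n, ∀ x ∈ D.gr n, Δ x ∈ deg D.gr n)

/-- The part `x ↦ x + θ(x) sξ` of a map to trees. -/
noncomputable def linPart (θ : D →ₗ[K] K) : D →ₗ[K] Trees D.gr :=
  ι + LinearMap.toSpanSingleton K _ (cork D.gr) ∘ₗ θ

omit [CharZero K] in
theorem linPart_apply (θ : D →ₗ[K] K) (x : D) : linPart θ x = ι x + θ x • cork D.gr := rfl

/-- A coassociative and counital map to trees is determined by its part with at most one
vertex. -/
theorem eq_recursion (hε : counit D.gr ∘ₗ Δ = LinearMap.id)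
    (hco : decomp D.gr ∘ₗ Δ = map Δ hΔ ∘ₗ Δ) :
    Δ = linPart (corkCoeff D.gr ∘ₗ Δ) + braT D ∘ₗ TensorProduct.map Δ Δ ∘ₗ cobr D ∘ₗ Δ := by
  refine LinearMap.ext fun x => ?_
  have h := graftRoot_decomp (Δ x)
  have hε' : counit D.gr (Δ x) = x := LinearMap.congr_fun hε x
  have hco' : decomp D.gr (Δ x) = map Δ hΔ (Δ x) := LinearMap.congr_fun hco x
  rw [hco', graftRoot_map, hε', eq_sub_iff_add_eq] at h
  refine h.symm.trans ?_
  simp only [LinearMap.add_apply, linPart_apply, LinearMap.comp_apply]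
  abel

section Split

variable {δ : D →ₗ[K] D ⊗[K] D} {θ : D →ₗ[K] K}
  (hrec : Δ = linPart θ + braT D ∘ₗ TensorProduct.map Δ Δ ∘ₗ δ)
  (hanti : D.susp.swap ∘ₗ δ = -δ)
include hΔ hrec hanti

/-- The two trees above the root vertices of `Δ x` are the values of `Δ` on the factors of `δ x`. -/
theorem rootSplit_eq (x : D) : rootSplit D (Δ x) = TensorProduct.map Δ Δ (δ x) := by
  have hb : ∀ t, rootSplit D (braT D t) = treeAlt D t := fun t =>
    LinearMap.congr_fun (TensorProduct.ext' fun a b => rootSplit_bra D a b :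
      rootSplit D ∘ₗ braT D = treeAlt D) t
  conv_lhs => rw [hrec]
  rw [LinearMap.add_apply, linPart_apply, map_add, map_add, map_smul, rootSplit_ι, rootSplit_cork,
    smul_zero, add_zero, zero_add, LinearMap.comp_apply, LinearMap.comp_apply, hb,
    treeAlt_map D hΔ, alt_eq_self D (LinearMap.congr_fun hanti x)]

omit [CharZero K] hΔ hanti in
theorem counit_eq (x : D) : counit D.gr (Δ x) = x := by
  have hb : ∀ t, counit D.gr (braT D t) = 0 := fun t =>
    LinearMap.congr_fun (TensorProduct.ext' fun a b => counit_node _ _ :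
      counit D.gr ∘ₗ braT D = 0) t
  rw [hrec, LinearMap.add_apply, linPart_apply, map_add, map_add, map_smul, counit_ι, counit_cork,
    smul_zero, add_zero, LinearMap.comp_apply, LinearMap.comp_apply, hb, add_zero]

omit [CharZero K] hΔ hanti in
theorem corkCoeff_eq (x : D) : corkCoeff D.gr (Δ x) = θ x := by
  have hb : ∀ t, corkCoeff D.gr (braT D t) = 0 := fun t =>
    LinearMap.congr_fun (TensorProduct.ext' fun a b => corkCoeff_node _ _ :
      corkCoeff D.gr ∘ₗ braT D = 0) t
  rw [hrec, LinearMap.add_apply, linPart_apply, map_add, map_add, map_smul, corkCoeff_ι,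
    corkCoeff_cork, LinearMap.comp_apply, LinearMap.comp_apply, hb, add_zero, zero_add, smul_eq_mul,
    mul_one]

/-- The binary part of a solution of the recursion is `δ`. -/
theorem cobr_eq (x : D) : cobr D (Δ x) = δ x := by
  have h : counit D.gr ∘ₗ Δ = LinearMap.id := LinearMap.ext (counit_eq hrec)
  rw [cobr, LinearMap.comp_apply, rootSplit_eq hΔ hrec hanti, ← LinearMap.comp_apply,
    ← TensorProduct.map_comp, h, TensorProduct.map_id, LinearMap.id_apply]

/-- The iterated cobrackets are the projections of `Δ`. -/
theorem treeProj_eq (S : BinaryTree Unit) :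
    treeProj D S ∘ₗ Δ = iterCobracket (ModuleCat.of K D) δ S := by
  induction S with
  | nil => exact LinearMap.ext (counit_eq hrec)
  | node _ l r ihl ihr =>
    refine LinearMap.ext fun x => ?_
    change TensorProduct.map (treeProj D l) (treeProj D r) (rootSplit D (Δ x)) =
      TensorProduct.map (iterCobracket (ModuleCat.of K D) δ l)
        (iterCobracket (ModuleCat.of K D) δ r) (δ x)
    rw [rootSplit_eq hΔ hrec hanti, ← LinearMap.comp_apply, ← TensorProduct.map_comp, ihl, ihr]

/-- If the recursion has a solution, then the iterated cobrackets of `x` are components of the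
finite sum of trees `Δ x`, and hence eventually vanish. -/
theorem isConilp_of_recursion : IsConilp δ := fun x => by
  obtain ⟨N, hN⟩ := exists_treeProj_eq_zero D (Δ x)
  refine ⟨N, fun S hS => ?_⟩
  rw [← treeProj_eq hΔ hrec hanti]
  exact hN S hS.ge

/-- On the values of `Δ`, the map `jac` is the defect of the co-Jacobi identity for `δ`. -/
theorem jac_eq (x : D) : jac D (Δ x) =
    (TensorProduct.assoc K D D D) (δ.rTensor D (δ x)) - δ.lTensor D (δ x) -
      D.susp.swap.lTensor D ((TensorProduct.assoc K D D D) (δ.rTensor D (δ x))) := by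
  have h₁ : counit D.gr ∘ₗ Δ = LinearMap.id := LinearMap.ext (counit_eq hrec)
  have h₂ : cobr D ∘ₗ Δ = δ := LinearMap.ext (cobr_eq hΔ hrec hanti)
  rw [jac, LinearMap.comp_apply, rootSplit_eq hΔ hrec hanti]
  simp only [LinearMap.sub_apply, LinearMap.comp_apply, LinearEquiv.coe_coe]
  simp only [← LinearMap.comp_apply (TensorProduct.map _ _) (TensorProduct.map _ _),
    ← TensorProduct.map_comp, h₁, h₂]
  rfl

end Split

end Coalgebra

end Trees

namespace Trees

/-! ### The Jacobi identity -/

section Jacobi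

variable {K : Type u} [Field K] [CharZero K] (D : GMod.{u, v} K)

omit [CharZero K] in
theorem counit_parity (t : Trees D.gr) : counit D.gr (parity D t) = D.parity (counit D.gr t) := by
  have : counit D.gr ∘ₗ parity D = D.parity ∘ₗ counit D.gr :=
    lin_ext_of_iSup (iSup_deg D) fun n a ha => by
      rw [LinearMap.comp_apply, LinearMap.comp_apply, parity_apply D ha, map_smul,
        D.parity_apply (counit_mem ha)]
  exact LinearMap.congr_fun this t

theorem cobr_node (a b : Trees D.gr) :
    cobr D (node a b) = alt D (D.parity (counit D.gr a) ⊗ₜ counit D.gr b) := by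
  rw [cobr, LinearMap.comp_apply, rootSplit_node,
    map_treeAlt D (f := counit D.gr) (fun _ _ h => counit_mem h), TensorProduct.map_tmul,
    counit_parity]

variable {D} in
theorem jac_node {m n : ℤ} {a b : Trees D.gr} (ha : a ∈ deg D.gr m) (hb : b ∈ deg D.gr n) :
    jac D (node a b) = (2⁻¹ * sgn K m) • (
      ((TensorProduct.assoc K D D D) (cobr D a ⊗ₜ counit D.gr b) - counit D.gr a ⊗ₜ cobr D b -
        D.susp.swap.lTensor D ((TensorProduct.assoc K D D D) (cobr D a ⊗ₜ counit D.gr b))) -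
      sgn K ((m + 1) * (n + 1)) •
      ((TensorProduct.assoc K D D D) (cobr D b ⊗ₜ counit D.gr a) - counit D.gr b ⊗ₜ cobr D a -
        D.susp.swap.lTensor D ((TensorProduct.assoc K D D D) (cobr D b ⊗ₜ counit D.gr a)))) := by
  simp only [jac, LinearMap.comp_apply, rootSplit_node, parity_apply D ha,
    ← TensorProduct.smul_tmul', map_smul, treeAlt, LinearMap.smul_apply, LinearMap.sub_apply,
    LinearMap.id_apply, treeSwap_tmul D ha hb, map_sub, TensorProduct.map_tmul,
    LinearEquiv.coe_coe]
  module

variable {D} in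
/-- The map `jac` only sees the trees which consist of a trivial tree and a binary vertex above the
root vertex. -/
theorem jac_node_eq_zero {m n : ℤ} {a b : Trees D.gr} (ha : a ∈ deg D.gr m)
    (hb : b ∈ deg D.gr n) (h₁ : counit D.gr a = 0 ∨ cobr D b = 0)
    (h₂ : cobr D a = 0 ∨ counit D.gr b = 0) : jac D (node a b) = 0 := by
  rw [jac_node ha hb]
  rcases h₁ with h₁ | h₁ <;> rcases h₂ with h₂ | h₂ <;> simp [h₁, h₂]

variable {D} {p q r : ℤ} {x y z : D}

/-- The value of `jac` on a left comb with three leaves. -/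
theorem jac_comb (hx : x ∈ D.gr p) (hy : y ∈ D.gr q) (hz : z ∈ D.gr r) :
    jac D (node (node (ι x) (ι y)) (ι z)) = (-4⁻¹ : K) • (
      sgn K q • (x ⊗ₜ[K] (y ⊗ₜ[K] z)) + sgn K (p + p * q) • (y ⊗ₜ[K] (x ⊗ₜ[K] z)) +
      sgn K (p * r + q * r + p) • (z ⊗ₜ[K] (x ⊗ₜ[K] y)) +
      sgn K (p * r + q * r + p * q + q) • (z ⊗ₜ[K] (y ⊗ₜ[K] x)) +
      sgn K (q * r + r) • (x ⊗ₜ[K] (z ⊗ₜ[K] y)) +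
      sgn K (p * q + p * r + r) • (y ⊗ₜ[K] (z ⊗ₜ[K] x))) := by
  rw [jac_node (node_mem (ι_mem hx) (ι_mem hy)) (ι_mem hz), cobr_node, counit_node, counit_ι,
    counit_ι, counit_ι, cobr_ι, D.parity_apply hx, ← TensorProduct.smul_tmul', map_smul, alt,
    LinearMap.smul_apply, LinearMap.sub_apply, LinearMap.id_apply, D.susp_swap_tmul hx hy]
  simp only [TensorProduct.tmul_zero, map_zero, sub_zero, zero_sub,
    TensorProduct.tmul_smul, ← TensorProduct.smul_tmul', TensorProduct.sub_tmul,
    TensorProduct.tmul_sub, map_smul, map_sub, TensorProduct.assoc_tmul, LinearMap.lTensor_tmul,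
    D.susp_swap_tmul hx hz, D.susp_swap_tmul hy hz]
  have e₁ : sgn K (p + q + 1) * sgn K p = -sgn K q := by
    rw [← sgn_add, neg_sgn]; exact sgn_eq p (by ring)
  have e₂ : sgn K (p + q + 1) * sgn K p * sgn K ((p + 1) * (q + 1)) = sgn K (p + p * q) := by
    rw [← sgn_add, ← sgn_add]; exact sgn_eq (p + q + 1) (by ring)
  have e₃ : sgn K (p + q + 1) * sgn K ((p + q + 1 + 1) * (r + 1)) * sgn K p =
      -sgn K (p * r + q * r + p) := by
    rw [← sgn_add, ← sgn_add, neg_sgn]; exact sgn_eq (p + q + r + 1) (by ring)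
  have e₄ : sgn K (p + q + 1) * sgn K ((p + q + 1 + 1) * (r + 1)) * sgn K p *
      sgn K ((p + 1) * (q + 1)) = sgn K (p * r + q * r + p * q + q) := by
    rw [← sgn_add, ← sgn_add, ← sgn_add]; exact sgn_eq (2 * p + q + r + 2) (by ring)
  have e₅ : sgn K (p + q + 1) * sgn K p * sgn K ((q + 1) * (r + 1)) = sgn K (q * r + r) := by
    rw [← sgn_add, ← sgn_add]; exact sgn_eq (p + q + 1) (by ring)
  have e₆ : sgn K (p + q + 1) * sgn K p * sgn K ((p + 1) * (q + 1)) * sgn K ((p + 1) * (r + 1)) =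
      -sgn K (p * q + p * r + r) := by
    rw [← sgn_add, ← sgn_add, ← sgn_add, neg_sgn]; exact sgn_eq (2 * p + q + 1) (by ring)
  generalize x ⊗ₜ[K] (y ⊗ₜ[K] z) = v₁
  generalize y ⊗ₜ[K] (x ⊗ₜ[K] z) = v₂
  generalize z ⊗ₜ[K] (x ⊗ₜ[K] y) = v₃
  generalize z ⊗ₜ[K] (y ⊗ₜ[K] x) = v₄
  generalize x ⊗ₜ[K] (z ⊗ₜ[K] y) = v₅
  generalize y ⊗ₜ[K] (z ⊗ₜ[K] x) = v₆
  linear_combination (norm := module) ((4⁻¹ : K) * e₁) • v₁ - ((4⁻¹ : K) * e₂) • v₂ +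
    ((4⁻¹ : K) * e₃) • v₃ - ((4⁻¹ : K) * e₄) • v₄ - ((4⁻¹ : K) * e₅) • v₅ +
    ((4⁻¹ : K) * e₆) • v₆

/-- The six terms of `jac_comb` are permuted, up to Koszul signs, by the permutations of the three
labels: this lemma and `jac_comb_swap` treat generators of the symmetric group. -/
theorem jac_comb_rotate (hx : x ∈ D.gr p) (hy : y ∈ D.gr q) (hz : z ∈ D.gr r) :
    jac D (node (node (ι y) (ι z)) (ι x)) =
      sgn K (p * q + p * r) • jac D (node (node (ι x) (ι y)) (ι z)) := by
  rw [jac_comb hx hy hz, jac_comb hy hz hx]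
  have e₁ : sgn K (p * q + p * r) * sgn K q = sgn K (q * p + r * p + q) := by
    rw [← sgn_add]; exact sgn_eq 0 (by ring)
  have e₂ : sgn K (p * q + p * r) * sgn K (p + p * q) = sgn K (r * p + p) := by
    rw [← sgn_add]; exact sgn_eq (p * q) (by ring)
  have e₃ : sgn K (p * q + p * r) * sgn K (p * r + q * r + p) = sgn K (q * r + q * p + p) := by
    rw [← sgn_add]; exact sgn_eq (p * r) (by ring)
  have e₄ : sgn K (p * q + p * r) * sgn K (p * r + q * r + p * q + q) = sgn K (q + q * r) := by
    rw [← sgn_add]; exact sgn_eq (p * q + p * r) (by ring)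
  have e₅ : sgn K (p * q + p * r) * sgn K (q * r + r) = sgn K (q * p + r * p + q * r + r) := by
    rw [← sgn_add]; exact sgn_eq 0 (by ring)
  have e₆ : sgn K (p * q + p * r) * sgn K (p * q + p * r + r) = sgn K r := by
    rw [← sgn_add]; exact sgn_eq (p * q + p * r) (by ring)
  generalize x ⊗ₜ[K] (y ⊗ₜ[K] z) = v₁
  generalize y ⊗ₜ[K] (x ⊗ₜ[K] z) = v₂
  generalize z ⊗ₜ[K] (x ⊗ₜ[K] y) = v₃
  generalize z ⊗ₜ[K] (y ⊗ₜ[K] x) = v₄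
  generalize x ⊗ₜ[K] (z ⊗ₜ[K] y) = v₅
  generalize y ⊗ₜ[K] (z ⊗ₜ[K] x) = v₆
  linear_combination (norm := module) ((4⁻¹ : K) * e₁) • v₁ + ((4⁻¹ : K) * e₂) • v₂ +
    ((4⁻¹ : K) * e₃) • v₃ + ((4⁻¹ : K) * e₄) • v₄ + ((4⁻¹ : K) * e₅) • v₅ +
    ((4⁻¹ : K) * e₆) • v₆

theorem jac_comb_swap (hx : x ∈ D.gr p) (hy : y ∈ D.gr q) :
    jac D (node (node (ι y) (ι x)) (ι z)) =
      sgn K (p * q) • jac D (node (node (ι x) (ι y)) (ι z)) := by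
  rw [node_comm (ι_mem hy) (ι_mem hx), map_smul, LinearMap.smul_apply, map_smul, mul_comm]

theorem jac_right_comb (hx : x ∈ D.gr p) (hy : y ∈ D.gr q) (hz : z ∈ D.gr r) :
    jac D (node (ι x) (node (ι y) (ι z))) =
      sgn K p • jac D (node (node (ι x) (ι y)) (ι z)) := by
  rw [node_comm (ι_mem hx) (node_mem (ι_mem hy) (ι_mem hz)), map_smul, jac_comb_rotate hx hy hz,
    smul_smul, ← sgn_add]
  congr 1
  exact sgn_eq (p * q + p * r) (by ring)

/-- On the trees obtained from a left comb with labels `x₀, x₁, x₂` by permuting the labels, the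
map `jac` takes the same value up to the Koszul sign. -/
theorem sgn_smul_jac_comb {d : Fin 3 → ℤ} {x : Fin 3 → D} (hx : ∀ i, x i ∈ D.gr (d i))
    {i j k : Fin 3} (h : [i, j, k].Perm (List.finRange 3)) :
    sgn K (permSign d [i, j, k]) • jac D (node (node (ι (x i)) (ι (x j))) (ι (x k))) =
      jac D (node (node (ι (x 0)) (ι (x 1))) (ι (x 2))) := by
  have hijk : ∀ i j k : Fin 3, [i, j, k].Perm (List.finRange 3) →
      (i, j, k) = (0, 1, 2) ∨ (i, j, k) = (0, 2, 1) ∨ (i, j, k) = (1, 0, 2) ∨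
      (i, j, k) = (1, 2, 0) ∨ (i, j, k) = (2, 0, 1) ∨ (i, j, k) = (2, 1, 0) := by decide
  have h := hijk i j k h
  simp only [Prod.mk.injEq] at h
  have h0 := hx 0
  have h1 := hx 1
  have h2 := hx 2
  rcases h with ⟨rfl, rfl, rfl⟩ | ⟨rfl, rfl, rfl⟩ | ⟨rfl, rfl, rfl⟩ | ⟨rfl, rfl, rfl⟩ |
    ⟨rfl, rfl, rfl⟩ | ⟨rfl, rfl, rfl⟩
  · simp [permSign, sgn_zero]
  · rw [jac_comb_swap h2 h0, jac_comb_rotate h1 h2 h0, jac_comb_rotate h0 h1 h2, smul_smul,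
      smul_smul, smul_smul, ← sgn_add, ← sgn_add, ← sgn_add, sgn_eq (b := 0)
        (d 2 * d 1 + d 2 * d 0 + d 1 * d 0) (by simp [permSign]; ring), sgn_zero, one_smul]
  · rw [jac_comb_swap h0 h1, smul_smul, ← sgn_add, sgn_eq (b := 0)
        (d 0 * d 1) (by simp [permSign]; ring), sgn_zero, one_smul]
  · rw [jac_comb_rotate h0 h1 h2, smul_smul, ← sgn_add, sgn_eq (b := 0)
        (d 1 * d 0 + d 2 * d 0) (by simp [permSign]; ring), sgn_zero, one_smul]
  · rw [jac_comb_rotate h1 h2 h0, jac_comb_rotate h0 h1 h2, smul_smul,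
      smul_smul, ← sgn_add, ← sgn_add, sgn_eq (b := 0)
        (d 2 * d 1 + d 2 * d 0 + d 1 * d 0) (by simp [permSign]; ring), sgn_zero, one_smul]
  · rw [jac_comb_swap h1 h2, jac_comb_rotate h0 h1 h2, smul_smul,
      smul_smul, ← sgn_add, ← sgn_add, sgn_eq (b := 0)
        (d 2 * d 1 + d 2 * d 0 + d 1 * d 0) (by simp [permSign]; ring), sgn_zero, one_smul]

/-- The auxiliary `𝕋(W)`-algebra which defines `combCoeff`. The three components are the linear
forms which count the trees without corks with no, one and two vertices. -/
noncomputable def combAlg (K : Type u) [Field K] :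
    TreeAlg K (fun m : ℤ => (if m = 0 then ⊤ else ⊥ : Submodule K K).prod
      ((if m = 1 then ⊤ else ⊥ : Submodule K K).prod
        (if m = 2 then ⊤ else ⊥ : Submodule K K))) where
  cork := 0
  node := LinearMap.mk₂ K (fun a b => (0, a.1 * b.1, a.1 * b.2.1 + b.1 * a.2.1))
    (fun a a' b => by ext <;> simp <;> ring) (fun c a b => by ext <;> simp <;> ring)
    (fun a b b' => by ext <;> simp <;> ring) (fun c a b => by ext <;> simp <;> ring)
  cork_mem := zero_mem _
  node_mem {m n a b} ha hb := by
    simp only [Submodule.mem_prod] at ha hb ⊢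
    refine ⟨zero_mem _, ?_, add_mem ?_ ?_⟩
    · by_cases hm : m = 0
      · by_cases hn : n = 0
        · simp [hm, hn]
        · have : b.1 = 0 := by simpa [hn] using hb.1
          simp [this]
      · have : a.1 = 0 := by simpa [hm] using ha.1
        simp [this]
    · by_cases hm : m = 0
      · by_cases hn : n = 1
        · simp [hm, hn]
        · have : b.2.1 = 0 := by simpa [hn] using hb.2.1
          simp [this]
      · have : a.1 = 0 := by simpa [hm] using ha.1
        simp [this]
    · by_cases hn : n = 0
      · by_cases hm : m = 1
        · simp [hm, hn]
        · have : a.2.1 = 0 := by simpa [hm] using ha.2.1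
          simp [this]
      · have : b.1 = 0 := by simpa [hn] using hb.1
        simp [this]
  node_comm {m n a b} ha hb := by
    simp only [Submodule.mem_prod] at ha hb
    simp only [LinearMap.mk₂_apply, Prod.smul_mk, Prod.mk.injEq, smul_eq_mul, mul_zero, true_and]
    by_cases hm : m = 0
    · subst hm
      simp only [zero_mul, sgn_zero]
      constructor <;> ring
    · by_cases hn : n = 0
      · subst hn
        simp only [mul_zero, sgn_zero]
        constructor <;> ring
      · have h₁ : a.1 = 0 := by simpa [hm] using ha.1
        have h₂ : b.1 = 0 := by simpa [hn] using hb.1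
        simp [h₁, h₂]

/-- The linear form on trees with formal inputs which takes the value `1` on the trees with two
vertices and three leaves, and `0` on the other trees. -/
noncomputable def combCoeff (K : Type u) [Field K] (n : ℕ) : StdTrees K n →ₗ[K] K :=
  (LinearMap.snd K _ _ ∘ₗ LinearMap.snd K _ _) ∘ₗ
    lift (combAlg K)
      (LinearMap.prod (∑ i : Fin n, LinearMap.proj (R := K) (φ := fun _ => K) i) 0) fun m x hx => by
      refine Submodule.mem_prod.2 ⟨?_, zero_mem _⟩
      by_cases hm : m = 0
      · simp [hm]
      · have : x = 0 := by simpa [stdGr, hm] using hx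
        simp [this]

/-- The values of the components of the map which defines `combCoeff`. -/
def combVal {L : Type v} (K : Type u) [Field K] : PTree L → K × K × K
  | .leaf _ => (1, 0, 0)
  | .cork => 0
  | .node a b => (0, (combVal K a).1 * (combVal K b).1,
      (combVal K a).1 * (combVal K b).2.1 + (combVal K b).1 * (combVal K a).2.1)

omit [CharZero K] in
theorem combCoeff_mk {n : ℕ} (t : PTree (Fin n)) :
    combCoeff K n (mk (stdGr K n) (t.map (inp K))) = (combVal K t).2.2 := by
  have : eval (combAlg K)
      (LinearMap.prod (∑ i : Fin n, LinearMap.proj (R := K) (φ := fun _ => K) i) 0)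
      (t.map (inp K)) = combVal K t := by
    induction t with
    | leaf i => simp [PTree.map, eval, combVal, inp]; rfl
    | cork => rfl
    | node a b iha ihb =>
      rw [PTree.map, eval, iha, ihb]
      rfl
  rw [combCoeff, LinearMap.comp_apply, lift_mk, this]
  rfl

omit [CharZero K] in
theorem combVal_eq_zero {L : Type v} (t : PTree L) (k : ℕ) (hk : t.vertices = k) :
    (k ≠ 0 → (combVal K t).1 = 0) ∧ (k ≠ 1 → (combVal K t).2.1 = 0) ∧
      (k ≠ 2 → (combVal K t).2.2 = 0) := by
  induction t generalizing k with
  | leaf => simp [combVal, ← hk, PTree.vertices]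
  | cork => simp [combVal]
  | node a b iha ihb =>
    obtain ⟨a₀, a₁, a₂⟩ := iha _ rfl
    obtain ⟨b₀, b₁, b₂⟩ := ihb _ rfl
    simp only [PTree.vertices] at hk
    refine ⟨fun _ => rfl, fun h => ?_, fun h => ?_⟩
    · simp only [combVal]
      by_cases ha : a.vertices = 0
      · rw [b₀ (by omega), mul_zero]
      · rw [a₀ ha, zero_mul]
    · simp only [combVal]
      by_cases ha : a.vertices = 0
      · rw [b₁ (by omega), a₁ (by omega), mul_zero, mul_zero, add_zero]
      · rw [a₀ ha, zero_mul, zero_add]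
        by_cases hb : b.vertices = 0
        · rw [a₁ (by omega), mul_zero]
        · rw [b₀ hb, zero_mul]

omit [CharZero K] in
/-- The form `combCoeff` vanishes on the quadratic relations: the coefficients of the associativity
relation sum up to zero. -/
theorem combCoeff_quadRel {n : ℕ} {c : StdTrees K n} (hc : c ∈ quadRel K n) :
    combCoeff K n c = 0 := by
  have hle : quadRel K n ≤ LinearMap.ker (combCoeff K n) := by
    refine Submodule.span_le.2 ?_
    rintro _ (⟨σ, rfl⟩ | ⟨σ, rfl⟩)
    · change combCoeff K n (assocRel K _ _ _) = 0
      have h₁ := combCoeff_mk (K := K)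
        (PTree.node (.node (.leaf (σ 0)) (.leaf (σ 1))) (.leaf (σ 2)))
      have h₂ := combCoeff_mk (K := K)
        (PTree.node (.leaf (σ 0)) (.node (.leaf (σ 1)) (.leaf (σ 2))))
      simp only [PTree.map] at h₁ h₂
      rw [assocRel, map_sub, h₁, h₂]
      simp [combVal]
    · change combCoeff K n (unitRel K _) = 0
      have h₁ := combCoeff_mk (K := K) (PTree.node .cork (.leaf (σ 0)))
      simp only [PTree.map] at h₁
      rw [unitRel, h₁]
      simp [combVal]
  exact hle hc

omit [CharZero K] in
theorem combCoeff_weight {n : ℕ} (c : PTree (Fin n) →₀ K) :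
    combCoeff K n (weight (stdGr K n) 2 (opClass K n c)) = combCoeff K n (opClass K n c) := by
  induction c using Finsupp.induction_linear with
  | zero => simp
  | add f g hf hg => simp only [map_add, hf, hg]
  | single t a =>
    rw [opClass, Finsupp.linearCombination_single, map_smul, map_smul, map_smul, weight_mk,
      PTree.vertices_map]
    split_ifs with h
    · rfl
    · rw [combCoeff_mk, (combVal_eq_zero t _ rfl).2.2 h, map_zero]

/-- On a labelled tree, `jac` only depends on whether the tree has two vertices and three leaves. In
arity three, the common value is the one on the left comb with labels `x 0, x 1, x 2`. -/
theorem jac_plug {n : ℕ} {d : Fin n → ℤ} {x : Fin n → D} (hx : ∀ i, x i ∈ D.gr (d i)) :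
    ∃ J : D ⊗[K] (D ⊗[K] D), ∀ t : PTree (Fin n), t.IsLabelled →
      sgn K (permSign d t.leaves + insertSign d t) • jac D (mk D.gr (t.map x)) =
        (combVal K t).2.2 • J := by
  have hι : ∀ y, mk D.gr (.leaf y) = ι y := fun y => rfl
  have hc : mk D.gr .cork = cork D.gr := rfl
  have hdeg : ∀ t : PTree (Fin n), ∃ m, mk D.gr (t.map x) ∈ deg D.gr m := by
    intro t
    induction t with
    | leaf i => exact ⟨_, ι_mem (hx i)⟩
    | cork => exact ⟨_, cork_mem⟩
    | node a b iha ihb =>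
      obtain ⟨m, hm⟩ := iha
      obtain ⟨m', hm'⟩ := ihb
      exact ⟨_, (node_mk (gr := D.gr) (a.map x) (b.map x)) ▸ node_mem hm hm'⟩
  have hvan : ∀ a b : PTree (Fin n),
      counit D.gr (mk D.gr (a.map x)) = 0 ∨ cobr D (mk D.gr (b.map x)) = 0 →
      cobr D (mk D.gr (a.map x)) = 0 ∨ counit D.gr (mk D.gr (b.map x)) = 0 →
      jac D (mk D.gr ((PTree.node a b).map x)) = 0 := by
    intro a b h₁ h₂
    obtain ⟨m, hm⟩ := hdeg a
    obtain ⟨m', hm'⟩ := hdeg b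
    rw [PTree.map, ← node_mk]
    exact jac_node_eq_zero hm hm' h₁ h₂
  have hshape : ∀ t : PTree (Fin n),
      (jac D (mk D.gr (t.map x)) = 0 ∧ (combVal K t).2.2 = 0) ∨
      (∃ i j k, t = .node (.node (.leaf i) (.leaf j)) (.leaf k)) ∨
      ∃ i j k, t = .node (.leaf i) (.node (.leaf j) (.leaf k)) := by
    intro t
    rcases t with i | _ | ⟨a, b⟩
    · left; simp [PTree.map, hι, jac, combVal]
    · left; simp [PTree.map, hc, jac, combVal]
    · rcases a with i | _ | ⟨a₁, a₂⟩
      · rcases b with j | _ | ⟨b₁, b₂⟩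
        · left
          exact ⟨hvan _ _ (by simp [PTree.map, hι]) (by simp [PTree.map, hι]), by simp [combVal]⟩
        · left
          exact ⟨hvan _ _ (by simp [PTree.map, hc]) (by simp [PTree.map, hc]), by simp [combVal]⟩
        · rcases b₁ with j | _ | ⟨b₃, b₄⟩ <;> rcases b₂ with k | _ | ⟨b₅, b₆⟩
          · exact Or.inr (Or.inr ⟨i, j, k, rfl⟩)
          all_goals
            left
            exact ⟨hvan _ _ (by simp [PTree.map, ← node_mk, hι, hc, cobr_node])
              (by simp [PTree.map, ← node_mk]), by simp [combVal]⟩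
      · left
        exact ⟨hvan _ _ (by simp [PTree.map, hc]) (by simp [PTree.map, hc]), by simp [combVal]⟩
      · rcases b with k | _ | ⟨b₁, b₂⟩
        · rcases a₁ with i | _ | ⟨a₃, a₄⟩ <;> rcases a₂ with j | _ | ⟨a₅, a₆⟩
          · exact Or.inr (Or.inl ⟨i, j, k, rfl⟩)
          all_goals
            left
            exact ⟨hvan _ _ (by simp [PTree.map, ← node_mk])
              (by simp [PTree.map, ← node_mk, hι, hc, cobr_node]), by simp [combVal]⟩
        · left
          exact ⟨hvan _ _ (by simp [PTree.map, hc]) (by simp [PTree.map, hc]), by simp [combVal]⟩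
        · left
          exact ⟨hvan _ _ (by simp [PTree.map, ← node_mk]) (by simp [PTree.map, ← node_mk]),
            by simp [combVal]⟩
  by_cases hn : n = 3
  · subst hn
    refine ⟨jac D (node (node (ι (x 0)) (ι (x 1))) (ι (x 2))), fun t ht => ?_⟩
    rcases hshape t with ⟨h₁, h₂⟩ | ⟨i, j, k, rfl⟩ | ⟨i, j, k, rfl⟩
    · rw [h₁, h₂, smul_zero, zero_smul]
    · have ht' : [i, j, k].Perm (List.finRange 3) := ht
      have h := sgn_smul_jac_comb hx ht'
      have hs : insertSign d (.node (.node (.leaf i) (.leaf j)) (.leaf k)) = 0 := by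
        simp [insertSign, PTree.numVert]
      have hv : (combVal K (.node (.node (.leaf i) (.leaf j)) (.leaf k))).2.2 = 1 := by
        simp [combVal]
      rw [hs, hv, add_zero, one_smul, ← h, PTree.map, PTree.map, PTree.map, PTree.map, PTree.map,
        ← node_mk, ← node_mk]
      rfl
    · have ht' : [i, j, k].Perm (List.finRange 3) := ht
      have h := sgn_smul_jac_comb hx ht'
      have hs : insertSign d (.node (.leaf i) (.node (.leaf j) (.leaf k))) = d i := by
        simp [insertSign, PTree.numVert, PTree.leaves]
      have hv : (combVal K (.node (.leaf i) (.node (.leaf j) (.leaf k)))).2.2 = 1 := by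
        simp [combVal]
      rw [hs, hv, one_smul, ← h, PTree.map, PTree.map, PTree.map, PTree.map, PTree.map,
        ← node_mk, ← node_mk, hι, hι, hι, jac_right_comb (hx i) (hx j) (hx k), smul_smul, sgn_add,
        mul_assoc, sgn_mul_self, mul_one]
      rfl
  · refine ⟨0, fun t ht => ?_⟩
    have hlen : t.leaves.length = n := by
      have := List.Perm.length_eq ht
      rwa [List.length_finRange] at this
    rcases hshape t with ⟨h₁, h₂⟩ | ⟨i, j, k, rfl⟩ | ⟨i, j, k, rfl⟩
    · rw [h₁, h₂, smul_zero, zero_smul]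
    · exact (hn (by simpa [PTree.leaves] using hlen.symm)).elim
    · exact (hn (by simpa [PTree.leaves] using hlen.symm)).elim

/-- The Jacobi identity holds for the elements of `uCom^¡ ∘ D`: the value of `jac` is a multiple of
`combCoeff`, which vanishes on the quadratic relations. -/
theorem jac_eq_zero {y : Trees D.gr} (hy : y ∈ comp (uComDual K) D.gr ⊤) : jac D y = 0 := by
  have hle : comp (uComDual K) D.gr ⊤ ≤ LinearMap.ker (jac D) := by
    refine Submodule.span_le.2 ?_
    rintro _ ⟨n, c, d, x, hlab, hc, hx, rfl⟩
    obtain ⟨J, hJ⟩ := jac_plug fun i => (hx i).2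
    change jac D (plug D.gr d x c) = 0
    have h₁ : jac D (plug D.gr d x c) = combCoeff K n (opClass K n c) • J := by
      rw [plug, opClass, Finsupp.linearCombination_apply, Finsupp.linearCombination_apply,
        Finsupp.sum, Finsupp.sum, map_sum, map_sum, Finset.sum_smul]
      refine Finset.sum_congr rfl fun t ht => ?_
      rw [map_smul, map_smul, map_smul, hJ t (hlab t ht), combCoeff_mk, smul_assoc]
    rw [h₁, ← combCoeff_weight, combCoeff_quadRel ((isQuadratic_uComDual K).weight_mem n _ hc),
      zero_smul]
  exact hle hy

end Jacobi

end Trees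

/-! ### The functor to curved Lie coalgebras -/

namespace Trees

section

variable {K : Type u} [Field K] {D D' : GMod.{u, v} K}

theorem curv_braT (t : Trees D.gr ⊗[K] Trees D.gr) : curv D (braT D t) =
    (TensorProduct.lid K D) (TensorProduct.map (corkCoeff D.gr) (counit D.gr) t) -
      (TensorProduct.rid K D) (TensorProduct.map (counit D.gr) (corkCoeff D.gr) t) := by
  have : curv D ∘ₗ braT D = (TensorProduct.lid K D).toLinearMap ∘ₗ
      TensorProduct.map (corkCoeff D.gr) (counit D.gr) - (TensorProduct.rid K D).toLinearMap ∘ₗ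
      TensorProduct.map (counit D.gr) (corkCoeff D.gr) :=
    TensorProduct.ext' fun a b => by simp [curv_bra]
  exact LinearMap.congr_fun this t

theorem map_braT {f : D →ₗ[K] D'} (hf : ∀ n, ∀ x ∈ D.gr n, f x ∈ D'.gr n)
    (t : Trees D.gr ⊗[K] Trees D.gr) :
    map f hf (braT D t) = braT D' (TensorProduct.map (map f hf) (map f hf) t) := by
  have : map f hf ∘ₗ braT D = braT D' ∘ₗ TensorProduct.map (map f hf) (map f hf) :=
    tensor_ext_of_iSup (iSup_deg D) fun m n a ha b _ => by
      rw [LinearMap.comp_apply, LinearMap.comp_apply, braT_tmul, TensorProduct.map_tmul, braT_tmul,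
        bra_apply D ha, bra_apply D' (map_mem f hf ha), map_smul, map_node]
  exact LinearMap.congr_fun this t

/-- The value of the curvature on a map to trees which satisfies the recursion. -/
theorem curv_eq {Δ : D →ₗ[K] Trees D.gr} {δ : D →ₗ[K] D ⊗[K] D} {θ : D →ₗ[K] K}
    (hrec : Δ = linPart θ + braT D ∘ₗ TensorProduct.map Δ Δ ∘ₗ δ) :
    curv D ∘ₗ Δ = ((TensorProduct.lid K D).toLinearMap ∘ₗ TensorProduct.map θ LinearMap.id -
      (TensorProduct.rid K D).toLinearMap ∘ₗ TensorProduct.map LinearMap.id θ) ∘ₗ δ := by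
  have h₁ : counit D.gr ∘ₗ Δ = LinearMap.id := LinearMap.ext (counit_eq hrec)
  have h₂ : corkCoeff D.gr ∘ₗ Δ = θ := LinearMap.ext (corkCoeff_eq hrec)
  refine LinearMap.ext fun x => ?_
  rw [LinearMap.comp_apply]
  conv_lhs => rw [hrec]
  rw [LinearMap.add_apply, linPart_apply, map_add, map_add, map_smul, curv_ι, curv_cork, smul_zero,
    add_zero, zero_add, LinearMap.comp_apply, LinearMap.comp_apply, curv_braT,
    ← LinearMap.comp_apply (TensorProduct.map _ _) (TensorProduct.map _ _),
    ← LinearMap.comp_apply (TensorProduct.map (counit D.gr) _) (TensorProduct.map _ _),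
    ← TensorProduct.map_comp, ← TensorProduct.map_comp, h₁, h₂]
  rfl

end

end Trees

open Trees

variable {K : Type u} [Field K] [CharZero K]

namespace UComDualCog

theorem hrec (C : UComDualCog.{u, v} K) : C.Δ = linPart (corkCoeff C.D.gr ∘ₗ C.Δ) +
    braT C.D ∘ₗ TensorProduct.map C.Δ C.Δ ∘ₗ cobr C.D ∘ₗ C.Δ :=
  eq_recursion C.Δ_mem C.counit C.coassoc

theorem swap_cobr_comp (C : UComDualCog.{u, v} K) :
    C.D.susp.swap ∘ₗ (cobr C.D ∘ₗ C.Δ) = -(cobr C.D ∘ₗ C.Δ) :=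
  LinearMap.ext fun x => swap_cobr C.D (C.Δ x)

theorem isConilp (C : UComDualCog.{u, v} K) : IsConilp (cobr C.D ∘ₗ C.Δ) :=
  isConilp_of_recursion C.Δ_mem C.hrec C.swap_cobr_comp

/-- The curved Lie coalgebra structure on the suspension of a `uCom^¡`-coalgebra. -/
noncomputable def toLie (C : UComDualCog.{u, v} K) : CLieCog.{u, v} K where
  V := C.D.susp
  δ := cobr C.D ∘ₗ C.Δ
  d := C.d
  θ := corkCoeff C.D.gr ∘ₗ C.Δ
  δ_mem {n x} hx := by
    have := cobr_mem C.D (C.Δ_mem (n - 1) x hx)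
    rwa [sub_add_cancel] at this
  d_mem {n x} hx := C.d_mem (n - 1) x hx
  θ_apply {n x} hx hn := corkCoeff_of_mem (C.Δ_mem (n - 1) x hx) (by omega)
  antisymm := C.swap_cobr_comp
  coJacobi := LinearMap.ext fun x => by
    have h := jac_eq C.Δ_mem C.hrec C.swap_cobr_comp x
    rw [jac_eq_zero (C.Δ_mem_comp x), eq_comm, sub_eq_zero, sub_eq_iff_eq_add'] at h
    exact h
  coderivation := LinearMap.ext fun x => by
    have h : C.Δ (C.d x) = der C.D C.d C.d_mem (C.Δ x) := LinearMap.congr_fun C.coderivation x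
    change cobr C.D (C.Δ (C.d x)) = C.D.tensorDer C.d (cobr C.D (C.Δ x))
    rw [h, cobr_der]
  curvature := C.curvature.trans (curv_eq C.hrec)
  θ_d := LinearMap.ext fun x => by
    have h : C.Δ (C.d x) = der C.D C.d C.d_mem (C.Δ x) := LinearMap.congr_fun C.coderivation x
    change corkCoeff C.D.gr (C.Δ (C.d x)) = 0
    rw [h, corkCoeff_der]
  conilpotent := C.isConilp

/-- The functor from `uCom^¡`-coalgebras to curved conilpotent Lie coalgebras. -/
noncomputable def lieFunctor (K : Type u) [Field K] [CharZero K] :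
    UComDualCog.{u, v} K ⥤ CLieCog.{u, v} K where
  obj C := C.toLie
  map {C C'} f :=
    { base := ⟨f.base.toLin, fun h => f.base.map_mem h⟩
      comm_δ := LinearMap.ext fun x => by
        have h : C'.Δ (f.base.toLin x) =
            Trees.map _ (fun _ _ h => f.base.map_mem h) (C.Δ x) := LinearMap.congr_fun f.comm_Δ x
        change cobr C'.D (C'.Δ (f.base.toLin x)) = _
        rw [h]
        exact cobr_map C.D _ _
      comm_d := f.comm_d
      comm_θ := LinearMap.ext fun x => by
        have h : C'.Δ (f.base.toLin x) =
            Trees.map _ (fun _ _ h => f.base.map_mem h) (C.Δ x) := LinearMap.congr_fun f.comm_Δ x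
        change corkCoeff C'.D.gr (C'.Δ (f.base.toLin x)) = _
        rw [h]
        exact corkCoeff_map _ _ _ }

instance : (lieFunctor.{u, v} K).Faithful where
  map_injective {C C' f g} h := by
    have h' : f.base.toLin = g.base.toLin := congrArg (fun k => k.base.toLin) h
    exact Hom.ext (GMod.Hom.ext h')

/-- A degree `0` map which commutes with the cobrackets and with the curvatures commutes with the
whole decomposition maps. -/
theorem comm_Δ_of_comm {C C' : UComDualCog.{u, v} K} {f : C.D →ₗ[K] C'.D}
    (hf : ∀ n, ∀ x ∈ C.D.gr n, f x ∈ C'.D.gr n)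
    (hδ : (cobr C'.D ∘ₗ C'.Δ) ∘ₗ f = TensorProduct.map f f ∘ₗ (cobr C.D ∘ₗ C.Δ))
    (hθ : (corkCoeff C'.D.gr ∘ₗ C'.Δ) ∘ₗ f = corkCoeff C.D.gr ∘ₗ C.Δ) :
    C'.Δ ∘ₗ f = Trees.map f hf ∘ₗ C.Δ := by
  refine C.isConilp.unique (κ := linPart (corkCoeff C'.D.gr ∘ₗ C'.Δ) ∘ₗ f) (m := braT C'.D) ?_ ?_
  · conv_lhs => rw [C'.hrec]
    rw [LinearMap.add_comp, LinearMap.comp_assoc, LinearMap.comp_assoc, hδ, TensorProduct.map_comp]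
    rfl
  · refine LinearMap.ext fun x => ?_
    have hθ' : corkCoeff C'.D.gr (C'.Δ (f x)) = corkCoeff C.D.gr (C.Δ x) :=
      LinearMap.congr_fun hθ x
    rw [LinearMap.comp_apply]
    conv_lhs => rw [C.hrec]
    rw [LinearMap.add_apply, linPart_apply, map_add, map_add, map_smul, map_ι, map_cork,
      LinearMap.comp_apply (braT C.D), map_braT, LinearMap.add_apply, LinearMap.comp_apply _ f,
      linPart_apply, LinearMap.comp_apply _ C'.Δ, hθ', TensorProduct.map_comp]
    rfl

instance : (lieFunctor.{u, v} K).Full where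
  map_surjective {C C'} g := by
    have hf : ∀ n, ∀ x ∈ C.D.gr n, g.base.toLin x ∈ C'.D.gr n := fun n x hx => by
      have : g.base.toLin x ∈ C'.D.susp.gr (n + 1) := g.base.map_mem (C.D.mem_susp hx)
      change g.base.toLin x ∈ C'.D.gr (n + 1 - 1) at this
      rwa [add_sub_cancel_right] at this
    exact ⟨⟨⟨g.base.toLin, fun {n x} hx => hf n x hx⟩, comm_Δ_of_comm hf g.comm_δ g.comm_θ,
      g.comm_d⟩, rfl⟩

end UComDualCog

/-! ### Sums over cuttings of a word -/

section Splits

variable {X : Type v} {Y : Type*} {M : Type w} [AddCommMonoid M] {N : Type*} [AddCommMonoid N]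

/-- The sum of `F l₁ l₂` over all ways to cut a word as `l₁ ++ l₂`, where both parts may be
empty. -/
def splitSum (F : List X → List X → M) : List X → M
  | [] => F [] []
  | a :: l => F [] (a :: l) + splitSum (fun l₁ l₂ => F (a :: l₁) l₂) l

theorem splitSum_congr {F G : List X → List X → M} {l : List X}
    (h : ∀ l₁ l₂, l₁ ++ l₂ = l → F l₁ l₂ = G l₁ l₂) : splitSum F l = splitSum G l := by
  induction l generalizing F G with
  | nil => exact h [] [] rfl
  | cons a l ih =>
    rw [splitSum, splitSum, h [] _ rfl,
      ih fun l₁ l₂ hl => h (a :: l₁) l₂ (by rw [List.cons_append, hl])]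

theorem splitSum_add (F G : List X → List X → M) (l : List X) :
    splitSum (fun l₁ l₂ => F l₁ l₂ + G l₁ l₂) l = splitSum F l + splitSum G l := by
  induction l generalizing F G with
  | nil => rfl
  | cons a l ih => rw [splitSum, splitSum, splitSum, ih]; abel

theorem map_splitSum {A : Type*} [FunLike A M N] [AddMonoidHomClass A M N] (φ : A)
    (F : List X → List X → M) (l : List X) :
    φ (splitSum F l) = splitSum (fun l₁ l₂ => φ (F l₁ l₂)) l := by
  induction l generalizing F with
  | nil => rfl
  | cons a l ih => rw [splitSum, splitSum, map_add, ih]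

theorem splitSum_map (g : Y → X) (F : List X → List X → M) (l : List Y) :
    splitSum F (l.map g) = splitSum (fun l₁ l₂ => F (l₁.map g) (l₂.map g)) l := by
  induction l generalizing F with
  | nil => rfl
  | cons a l ih =>
    rw [List.map_cons, splitSum, splitSum, ih]
    rfl

theorem splitSum_append_cons (F : List X → List X → M) (p s : List X) (x : X) :
    splitSum F (p ++ x :: s) = splitSum (fun a b => F a (b ++ x :: s)) p +
      splitSum (fun a b => F (p ++ x :: a) b) s := by
  induction p generalizing F with
  | nil => rfl
  | cons y p ih =>
    rw [List.cons_append, splitSum, ih, splitSum, add_assoc]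
    rfl

theorem splitSum_mem {R : Type*} [Semiring R] [Module R M] {S : Submodule R M}
    {F : List X → List X → M} {l : List X} (h : ∀ l₁ l₂, l₁ ++ l₂ = l → F l₁ l₂ ∈ S) :
    splitSum F l ∈ S := by
  induction l generalizing F with
  | nil => exact h [] [] rfl
  | cons a l ih =>
    exact add_mem (h [] _ rfl) (ih fun l₁ l₂ hl => h (a :: l₁) l₂ (by rw [List.cons_append, hl]))

/-- The sum of `F P` over all ways to cut the word `u ++ l` into a list `P` of nonempty blocks, such
that the first block contains `u`. -/
def blockAux : List X → (List (List X) → M) → List X → M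
  | [], F, u => F [u]
  | b :: l, F, u => blockAux l F (u ++ [b]) + blockAux l (fun P => F (u :: P)) [b]

/-- The sum of `F P` over all ways to cut a word into a list `P` of nonempty blocks. -/
def blockSum (F : List (List X) → M) : List X → M
  | [] => F []
  | a :: l => blockAux l F [a]

theorem blockAux_congr {F G : List (List X) → M} {u l : List X}
    (h : ∀ v P, (v :: P).flatten = u ++ l → F (v :: P) = G (v :: P)) :
    blockAux l F u = blockAux l G u := by
  induction l generalizing F G u with
  | nil => exact h u [] (by simp)
  | cons b l ih =>
    rw [blockAux, blockAux, ih fun v P hP => h v P (by rw [hP]; simp),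
      ih (F := fun P => F (u :: P)) (G := fun P => G (u :: P)) (u := [b])
        fun v P hP => h u (v :: P) (by rw [List.flatten_cons, hP]; simp)]

theorem blockSum_congr {F G : List (List X) → M} {l : List X}
    (h : ∀ P, P.flatten = l → F P = G P) : blockSum F l = blockSum G l := by
  cases l with
  | nil => exact h [] rfl
  | cons a l => exact blockAux_congr fun v P hP => h _ hP

theorem map_blockAux {A : Type*} [FunLike A M N] [AddMonoidHomClass A M N] (φ : A)
    (F : List (List X) → M) (u l : List X) :
    φ (blockAux l F u) = blockAux l (fun P => φ (F P)) u := by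
  induction l generalizing F u with
  | nil => rfl
  | cons b l ih => rw [blockAux, blockAux, map_add, ih, ih]

theorem map_blockSum {A : Type*} [FunLike A M N] [AddMonoidHomClass A M N] (φ : A)
    (F : List (List X) → M) (l : List X) :
    φ (blockSum F l) = blockSum (fun P => φ (F P)) l := by
  cases l with
  | nil => rfl
  | cons a l => exact map_blockAux φ F _ _

theorem blockAux_add (F G : List (List X) → M) (u l : List X) :
    blockAux l (fun P => F P + G P) u = blockAux l F u + blockAux l G u := by
  induction l generalizing F G u with
  | nil => rfl
  | cons b l ih => rw [blockAux, blockAux, blockAux, ih, ih]; abel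

theorem blockSum_add (F G : List (List X) → M) (l : List X) :
    blockSum (fun P => F P + G P) l = blockSum F l + blockSum G l := by
  cases l with
  | nil => rfl
  | cons a l => exact blockAux_add F G _ _

theorem blockAux_mem {R : Type*} [Semiring R] [Module R M] {S : Submodule R M}
    {F : List (List X) → M} (h : ∀ P, F P ∈ S) (u l : List X) : blockAux l F u ∈ S := by
  induction l generalizing F u with
  | nil => exact h _
  | cons b l ih => exact add_mem (ih h _) (ih (fun P => h _) _)

theorem blockSum_mem {R : Type*} [Semiring R] [Module R M] {S : Submodule R M}
    {F : List (List X) → M} (h : ∀ P, F P ∈ S) (l : List X) : blockSum F l ∈ S := by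
  cases l with
  | nil => exact h _
  | cons a l => exact blockAux_mem h _ _

theorem blockAux_eq_zero {F : List (List X) → M} (h : ∀ v P, F (v :: P) = 0) (u l : List X) :
    blockAux l F u = 0 := by
  induction l generalizing F u with
  | nil => exact h _ _
  | cons b l ih => rw [blockAux, ih h, ih (F := fun P => F (u :: P)) (fun v P => h _ _), add_zero]

/-- The sum over block decompositions of a function which vanishes on the decompositions into more
than one block. -/
theorem blockAux_of_vanish {F : List (List X) → M} (h : ∀ u v P, F (u :: v :: P) = 0)
    (u l : List X) : blockAux l F u = F [u ++ l] := by
  induction l generalizing u with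
  | nil => rw [blockAux, List.append_nil]
  | cons b l ih =>
    rw [blockAux, ih, blockAux_eq_zero (fun v P => h u v P), add_zero, List.append_assoc]
    rfl

/-- Version of `blockSum_splitSum` with a given beginning of the first block. -/
theorem blockAux_splitSum (H : List (List X) → List (List X) → M) (u l : List X) :
    blockAux l (splitSum H) u = blockAux l (H []) u +
      splitSum (fun l₁ l₂ => blockAux l₁ (fun P₁ => blockSum (H P₁) l₂) u) l := by
  induction l generalizing H u with
  | nil => rfl
  | cons b l ih =>
    have h : (fun P => splitSum H (u :: P)) =
        fun P => H [] (u :: P) + splitSum (fun P₁ P₂ => H (u :: P₁) P₂) P := rfl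
    rw [blockAux, ih, h, blockAux_add, ih, blockAux, splitSum]
    simp only [blockAux]
    rw [splitSum_add]
    simp only [blockSum]
    abel

/-- Cutting a word into blocks and then cutting the list of blocks in two amounts to cutting the
word in two and then both parts into blocks. -/
theorem blockSum_splitSum (H : List (List X) → List (List X) → M) (l : List X) :
    blockSum (splitSum H) l =
      splitSum (fun l₁ l₂ => blockSum (fun P₁ => blockSum (H P₁) l₂) l₁) l := by
  cases l with
  | nil => rfl
  | cons a l => exact blockAux_splitSum H [a] l

end Splits

/-! ### Bracketings of words -/

section Bracket

variable {K : Type u} [Field K] {M : Type v} [AddCommGroup M] [Module K M]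
  {X : Type*}

/-- The total degree of a bracketing of a word with letters of prescribed degrees, by an operation
of degree `1`. -/
def wordDeg (l : List (ℤ × X)) : ℤ := (l.map fun a => a.1 + 1).sum - 1

theorem wordDeg_append (l₁ l₂ : List (ℤ × X)) :
    wordDeg (l₁ ++ l₂) = wordDeg l₁ + wordDeg l₂ + 1 := by
  simp only [wordDeg, List.map_append, List.sum_append]
  ring

theorem wordDeg_singleton (a : ℤ × X) : wordDeg [a] = a.1 := by simp [wordDeg]

/-- The value of a word of length one. -/
def letterVal : List (ℤ × M) → M
  | [a] => a.2
  | _ => 0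

theorem letterVal_eq_zero {l : List (ℤ × M)} (h : 2 ≤ l.length) : letterVal l = 0 := by
  rcases l with _ | ⟨a, _ | ⟨b, l⟩⟩
  · rfl
  · simp at h
  · rfl

/-- Two solutions of a recursion over the ways to cut a word in two coincide. As they vanish on the
empty word, only the cuttings into shorter words contribute. -/
theorem bracket_unique {s : List X → List X → K} {node : M →ₗ[K] M →ₗ[K] M} {val : List X → M}
    {G G' : List X → M} (h₀ : G [] = 0) (h₀' : G' [] = 0)
    (h : ∀ l, l ≠ [] → G l = val l + splitSum (fun l₁ l₂ => s l₁ l₂ • node (G l₁) (G l₂)) l)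
    (h' : ∀ l, l ≠ [] → G' l = val l + splitSum (fun l₁ l₂ => s l₁ l₂ • node (G' l₁) (G' l₂)) l)
    (l : List X) : G l = G' l := by
  induction hn : l.length using Nat.strong_induction_on generalizing l with
  | _ n ih =>
    by_cases hl : l = []
    · rw [hl, h₀, h₀']
    · rw [h l hl, h' l hl]
      congr 1
      refine splitSum_congr fun l₁ l₂ hs => ?_
      have hlen := congrArg List.length hs
      rw [List.length_append] at hlen
      rcases eq_or_ne l₁ [] with rfl | h₁
      · rw [h₀, h₀', map_zero, LinearMap.zero_apply, LinearMap.zero_apply]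
      rcases eq_or_ne l₂ [] with rfl | h₂
      · rw [h₀, h₀', map_zero, map_zero]
      have h₁ := List.length_pos_iff.2 h₁
      have h₂ := List.length_pos_iff.2 h₂
      rw [ih _ (by omega) l₁ rfl, ih _ (by omega) l₂ rfl]

variable (node : M →ₗ[K] M →ₗ[K] M)

/-- Auxiliary function for `bracket`, by recursion on a bound for the length of the word. -/
noncomputable def bracketAux : ℕ → List (ℤ × M) → M
  | 0, _ => 0
  | k + 1, l => letterVal l +
      splitSum (fun l₁ l₂ => sgn K (wordDeg l₁) • node (bracketAux k l₁) (bracketAux k l₂)) l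

theorem bracketAux_nil (k : ℕ) : bracketAux node k [] = 0 := by
  induction k with
  | zero => rfl
  | succ k ih => simp [bracketAux, splitSum, ih, letterVal]

theorem bracketAux_stable (k k' : ℕ) (l : List (ℤ × M)) (h : l.length ≤ k) (h' : l.length ≤ k') :
    bracketAux node k l = bracketAux node k' l := by
  induction k generalizing k' l with
  | zero =>
    rw [List.length_eq_zero_iff.1 (Nat.le_zero.1 h), bracketAux_nil, bracketAux_nil]
  | succ k ih =>
    cases k' with
    | zero => rw [List.length_eq_zero_iff.1 (Nat.le_zero.1 h'), bracketAux_nil, bracketAux_nil]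
    | succ k' =>
      rw [bracketAux, bracketAux]
      congr 1
      refine splitSum_congr fun l₁ l₂ hs => ?_
      have hlen := congrArg List.length hs
      rw [List.length_append] at hlen
      rcases eq_or_ne l₁ [] with rfl | h₁
      · rw [bracketAux_nil, bracketAux_nil, map_zero, LinearMap.zero_apply, LinearMap.zero_apply]
      rcases eq_or_ne l₂ [] with rfl | h₂
      · rw [bracketAux_nil, bracketAux_nil, map_zero, map_zero]
      have h₁ := List.length_pos_iff.2 h₁
      have h₂ := List.length_pos_iff.2 h₂
      rw [ih k' l₁ (by omega) (by omega), ih k' l₂ (by omega) (by omega)]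

/-- The sum over all complete bracketings of a word whose letters are elements of prescribed
degrees, by an operation of degree `1`, with the Koszul signs which make the operation of degree `0`
on the suspension. -/
noncomputable def bracket (l : List (ℤ × M)) : M := bracketAux node l.length l

theorem bracket_eq (l : List (ℤ × M)) : bracket node l = letterVal l +
    splitSum (fun l₁ l₂ => sgn K (wordDeg l₁) • node (bracket node l₁) (bracket node l₂)) l := by
  rw [bracket, bracketAux_stable node l.length (l.length + 1) l le_rfl (Nat.le_succ _), bracketAux]
  congr 1
  refine splitSum_congr fun l₁ l₂ hs => ?_
  have hlen := congrArg List.length hs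
  rw [List.length_append] at hlen
  rw [bracket, bracket, bracketAux_stable node l.length l₁.length l₁ (by omega) le_rfl,
    bracketAux_stable node l.length l₂.length l₂ (by omega) le_rfl]

@[simp] theorem bracket_nil : bracket node [] = 0 := rfl

@[simp] theorem bracket_singleton (a : ℤ × M) : bracket node [a] = a.2 := by
  rw [bracket_eq]
  simp [splitSum, letterVal]

theorem bracket_pair (a b : ℤ × M) : bracket node [a, b] = sgn K a.1 • node a.2 b.2 := by
  rw [bracket_eq]
  simp [splitSum, letterVal, wordDeg_singleton]

theorem bracket_triple (a b c : ℤ × M) : bracket node [a, b, c] =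
    sgn K a.1 • node a.2 (bracket node [b, c]) +
      sgn K (a.1 + b.1 + 1) • node (bracket node [a, b]) c.2 := by
  rw [bracket_eq]
  simp only [splitSum, letterVal, wordDeg_singleton, bracket_nil, map_zero, LinearMap.zero_apply,
    smul_zero, bracket_singleton, zero_add, add_zero]
  rw [show wordDeg [a, b] = a.1 + b.1 + 1 by simp [wordDeg]; ring]

/-- Membership of bracketings in a family of submodules which is compatible with the operation. -/
theorem bracket_mem {S : List X → Submodule K M} {g : X → ℤ × M} {l : List X}
    (hg : ∀ x ∈ l, (g x).2 ∈ S [x])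
    (hS : ∀ l₁ l₂, ∀ a ∈ S l₁, ∀ b ∈ S l₂, node a b ∈ S (l₁ ++ l₂)) :
    bracket node (l.map g) ∈ S l := by
  induction hn : l.length using Nat.strong_induction_on generalizing l with
  | _ n ih =>
    rw [bracket_eq, splitSum_map]
    refine add_mem ?_ (splitSum_mem fun l₁ l₂ hs => Submodule.smul_mem _ _ ?_)
    · rcases l with _ | ⟨a, _ | ⟨b, l⟩⟩
      · exact zero_mem _
      · exact hg a (by simp)
      · exact zero_mem _
    · have hlen := congrArg List.length hs
      rw [List.length_append] at hlen
      rcases eq_or_ne l₁ [] with rfl | h₁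
      · simp
      rcases eq_or_ne l₂ [] with rfl | h₂
      · simp
      have h₁ := List.length_pos_iff.2 h₁
      have h₂ := List.length_pos_iff.2 h₂
      rw [← hs]
      exact hS _ _ _ (ih _ (by omega) (fun x hx => hg x (hs ▸ List.mem_append_left _ hx)) rfl) _
        (ih _ (by omega) (fun x hx => hg x (hs ▸ List.mem_append_right _ hx)) rfl)

theorem map_bracket {M' : Type*} [AddCommGroup M'] [Module K M'] {node' : M' →ₗ[K] M' →ₗ[K] M'}
    (φ : M →ₗ[K] M') (hφ : ∀ a b, φ (node a b) = node' (φ a) (φ b)) (l : List (ℤ × M)) :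
    φ (bracket node l) = bracket node' (l.map (Prod.map id φ)) := by
  refine bracket_unique (node := node') (s := fun l₁ _ => sgn K (wordDeg l₁))
    (val := fun l => φ (letterVal l)) (G := fun l => φ (bracket node l))
    (G' := fun l => bracket node' (l.map (Prod.map id φ))) (map_zero _) rfl (fun l _ => ?_)
    (fun l _ => ?_) l
  · rw [bracket_eq, map_add, map_splitSum]
    simp only [map_smul, hφ]
  · rw [bracket_eq, splitSum_map]
    congr 1
    · rcases l with _ | ⟨a, _ | ⟨b, l⟩⟩
      · exact (map_zero _).symm
      · rfl
      · exact (map_zero _).symm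
    · refine splitSum_congr fun l₁ l₂ _ => ?_
      rw [show wordDeg (l₁.map (Prod.map id φ)) = wordDeg l₁ by
        simp [wordDeg, Function.comp_def]]

theorem letterVal_linear (p s : List (ℤ × M)) (d : ℤ) (c : K) (a b : M) :
    letterVal (p ++ (d, c • a + b) :: s) =
      c • letterVal (p ++ (d, a) :: s) + letterVal (p ++ (d, b) :: s) := by
  rcases p with _ | ⟨x, p⟩
  · rcases s with _ | ⟨y, s⟩
    · rfl
    · simp [letterVal]
  · rw [letterVal_eq_zero (by simp; omega), letterVal_eq_zero (by simp; omega),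
      letterVal_eq_zero (by simp; omega),
      smul_zero, add_zero]

/-- Bracketings are linear in each letter. -/
theorem bracket_linear (p s : List (ℤ × M)) (d : ℤ) (c : K) (a b : M) :
    bracket node (p ++ (d, c • a + b) :: s) =
      c • bracket node (p ++ (d, a) :: s) + bracket node (p ++ (d, b) :: s) := by
  induction hn : p.length + s.length using Nat.strong_induction_on generalizing p s with
  | _ n ih =>
    have hdeg : ∀ (q : List (ℤ × M)) (x y : M) (r : List (ℤ × M)),
        wordDeg (q ++ (d, x) :: r) = wordDeg (q ++ (d, y) :: r) := fun q x y r => by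
      simp [wordDeg]
    have hsm := fun (F : List (ℤ × M) → List (ℤ × M) → M) l =>
      map_splitSum (LinearMap.lsmul K M c) F l
    simp only [LinearMap.lsmul_apply] at hsm
    rw [bracket_eq, bracket_eq node (p ++ (d, a) :: s), bracket_eq node (p ++ (d, b) :: s),
      letterVal_linear, splitSum_append_cons, splitSum_append_cons, splitSum_append_cons]
    have h₁ : splitSum (fun l₁ l₂ => sgn K (wordDeg l₁) • node (bracket node l₁)
        (bracket node (l₂ ++ (d, c • a + b) :: s))) p =
        c • splitSum (fun l₁ l₂ => sgn K (wordDeg l₁) • node (bracket node l₁)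
          (bracket node (l₂ ++ (d, a) :: s))) p +
        splitSum (fun l₁ l₂ => sgn K (wordDeg l₁) • node (bracket node l₁)
          (bracket node (l₂ ++ (d, b) :: s))) p := by
      rw [hsm, ← splitSum_add]
      refine splitSum_congr fun l₁ l₂ hs => ?_
      rcases eq_or_ne l₁ [] with rfl | h₁
      · simp
      have h₁ := List.length_pos_iff.2 h₁
      have hlen := congrArg List.length hs
      rw [List.length_append] at hlen
      rw [ih _ (by omega) l₂ s rfl, map_add, map_smul, smul_add, smul_comm]
    have h₂ : splitSum (fun l₁ l₂ => sgn K (wordDeg (p ++ (d, c • a + b) :: l₁)) •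
        node (bracket node (p ++ (d, c • a + b) :: l₁)) (bracket node l₂)) s =
        c • splitSum (fun l₁ l₂ => sgn K (wordDeg (p ++ (d, a) :: l₁)) •
          node (bracket node (p ++ (d, a) :: l₁)) (bracket node l₂)) s +
        splitSum (fun l₁ l₂ => sgn K (wordDeg (p ++ (d, b) :: l₁)) •
          node (bracket node (p ++ (d, b) :: l₁)) (bracket node l₂)) s := by
      rw [hsm, ← splitSum_add]
      refine splitSum_congr fun l₁ l₂ hs => ?_
      rcases eq_or_ne l₂ [] with rfl | h₁
      · simp
      have h₁ := List.length_pos_iff.2 h₁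
      have hlen := congrArg List.length hs
      rw [List.length_append] at hlen
      rw [ih _ (by omega) p l₁ rfl, map_add, map_smul, LinearMap.add_apply, LinearMap.smul_apply,
        smul_add, smul_comm, hdeg p _ a l₁, hdeg p b a l₁]
    rw [h₁, h₂, smul_add, smul_add]
    abel

end Bracket

/-! ### Words in inputs and corks -/

section Words

variable (K : Type u) [Field K]

/-- The grafting of two planar trees on a vertex `sμ`, extended bilinearly. -/
noncomputable def PTree.nodeL (A : Type v) :
    (PTree A →₀ K) →ₗ[K] (PTree A →₀ K) →ₗ[K] (PTree A →₀ K) :=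
  Finsupp.linearCombination K fun a => Finsupp.lmapDomain K K (PTree.node a)

variable {K} in
theorem PTree.nodeL_single {A : Type v} (a b : PTree A) :
    PTree.nodeL K A (Finsupp.single a 1) (Finsupp.single b 1) =
      Finsupp.single (PTree.node a b) 1 := by
  rw [PTree.nodeL, Finsupp.linearCombination_single, one_smul, Finsupp.lmapDomain_apply,
    Finsupp.mapDomain_single]

/-- The letters `sξ` (encoded as `none`) and `1, 2, …`, as planar trees with their degrees. -/
noncomputable def treeLetter {A : Type v} : Option A → ℤ × (PTree A →₀ K)
  | none => (1, Finsupp.single .cork 1)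
  | some a => (0, Finsupp.single (.leaf a) 1)

/-- The sum of all bracketings of a word in the letters `sξ`, `1`, `2`, …, as a linear combination
of planar trees. -/
noncomputable def wordTree {A : Type v} (u : List (Option A)) : PTree A →₀ K :=
  bracket (PTree.nodeL K A) (u.map (treeLetter K))

/-- The leaves of the bracketings of a word are its letters other than `sξ`, in order, and their
number of vertices is the degree of the word. -/
theorem wordTree_mem {A : Type v} (u : List (Option A)) : wordTree K u ∈ Finsupp.supported K K
    {t | t.leaves = u.reduceOption ∧ t.numVert = wordDeg (u.map (treeLetter K))} := by
  refine bracket_mem (PTree.nodeL K A) (g := treeLetter K)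
    (S := fun u => Finsupp.supported K K
      {t | t.leaves = u.reduceOption ∧ t.numVert = wordDeg (u.map (treeLetter K))}) ?_ ?_
  · rintro (_ | a) -
    · exact Finsupp.single_mem_supported K 1 ⟨rfl, rfl⟩
    · exact Finsupp.single_mem_supported K 1 ⟨rfl, rfl⟩
  · intro l₁ l₂ a ha b hb
    rw [Finsupp.supported_eq_span_single] at ha hb
    refine Submodule.span_induction₂ (p := fun a b _ _ => PTree.nodeL K A a b ∈ _)
      ?_ ?_ ?_ ?_ ?_ ?_ ?_ ha hb
    · rintro _ _ ⟨s, hs, rfl⟩ ⟨t, ht, rfl⟩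
      rw [PTree.nodeL_single]
      refine Finsupp.single_mem_supported K 1 ⟨?_, ?_⟩
      · rw [PTree.leaves, hs.1, ht.1, List.reduceOption_append]
      · rw [PTree.numVert, hs.2, ht.2, List.map_append, wordDeg_append]
    · intros; simp
    · intros; simp
    · intro x y z _ _ _ h₁ h₂
      rw [map_add, LinearMap.add_apply]; exact add_mem h₁ h₂
    · intro x y z _ _ _ h₁ h₂
      rw [map_add]; exact add_mem h₁ h₂
    · intro c x y _ _ h
      rw [map_smul, LinearMap.smul_apply]; exact Submodule.smul_mem _ _ h
    · intro c x y _ _ h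
      rw [map_smul]; exact Submodule.smul_mem _ _ h

variable {K} {V : Type v} [AddCommGroup V] [Module K V] (gr : ℤ → Submodule K V)

/-- The letters `sξ` (encoded as `none`) and `x`, for an element `x` of a prescribed degree, as
trees with their degrees. -/
noncomputable def Trees.letter : Option (ℤ × V) → ℤ × Trees gr
  | none => (1, Trees.cork gr)
  | some x => (x.1, Trees.ι x.2)

/-- The sum of all bracketings of a word in the letters `sξ` and elements of `V` of prescribed
degrees. -/
noncomputable def Trees.word (w : List (Option (ℤ × V))) : Trees gr :=
  bracket Trees.node (w.map (Trees.letter gr))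

variable (K) in
theorem opClass_wordTree {n : ℕ} (u : List (Option (Fin n))) : opClass K n (wordTree K u) =
    Trees.word (stdGr K n) (u.map (Option.map fun i => (0, inp K i))) := by
  have h : ∀ a b, opClass K n (PTree.nodeL K _ a b) =
      Trees.node (opClass K n a) (opClass K n b) := by
    have : (PTree.nodeL K (Fin n)).compr₂ (opClass K n) =
        Trees.node.compl₁₂ (opClass K n) (opClass K n) := by
      refine Finsupp.lhom_ext' fun s => LinearMap.ext_ring ?_
      refine Finsupp.lhom_ext' fun t => LinearMap.ext_ring ?_
      simp only [LinearMap.comp_apply, Finsupp.lsingle_apply, LinearMap.compr₂_apply,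
        LinearMap.compl₁₂_apply, PTree.nodeL_single, opClass, Finsupp.linearCombination_single,
        one_smul, Trees.node_mk]
      rfl
    exact fun a b => LinearMap.congr_fun (LinearMap.congr_fun this a) b
  refine (map_bracket _ (opClass K n) h _).trans ?_
  rw [Trees.word, List.map_map, List.map_map]
  congr 1
  refine List.map_congr_left fun o _ => ?_
  cases o <;> simp [treeLetter, Trees.letter, opClass, PTree.map] <;> rfl

theorem Trees.map_word {B : Type w} [AddCommGroup B] [Module K B] {grB : ℤ → Submodule K B}
    (f : V →ₗ[K] B) (hf : ∀ n, ∀ x ∈ gr n, f x ∈ grB n) (w : List (Option (ℤ × V))) :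
    Trees.map f hf (Trees.word gr w) = Trees.word grB (w.map (Option.map (Prod.map id f))) := by
  refine (map_bracket _ (Trees.map f hf) (fun a b => map_node f hf a b) _).trans ?_
  rw [word, List.map_map, List.map_map]
  congr 1
  refine List.map_congr_left fun o _ => ?_
  cases o <;> simp [letter]

theorem Trees.word_mem {w : List (Option (ℤ × V))} (h : ∀ x, some x ∈ w → x.2 ∈ gr x.1) :
    Trees.word gr w ∈ deg gr (wordDeg (w.map (letter gr))) := by
  refine bracket_mem node (S := fun w => deg gr (wordDeg (w.map (letter gr)))) ?_ ?_
  · rintro (_ | x) hx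
    · simp only [List.map_cons, List.map_nil, wordDeg_singleton]
      exact cork_mem
    · simp only [List.map_cons, List.map_nil, wordDeg_singleton]
      exact ι_mem (h x hx)
  · intro l₁ l₂ a ha b hb
    rw [List.map_append, wordDeg_append]
    exact node_mem ha hb

/-! ### Koszul signs of words -/

/-- Insertion of elements `xᵢ` of degree `d i` in the inputs of planar trees. This differs from
`plug` by the sign of the permutation of the inputs. -/
noncomputable def plugPlanar {n : ℕ} (d : Fin n → ℤ) (x : Fin n → V) :
    (PTree (Fin n) →₀ K) →ₗ[K] Trees gr :=
  Finsupp.linearCombination K fun t => sgn K (insertSign d t) • Trees.mk gr (t.map x)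

/-- In a grafting, the vertices of the second tree are exchanged with the labels of the first. -/
theorem plugPlanar_nodeL {n : ℕ} (d : Fin n → ℤ) (x : Fin n → V) {D N : ℤ}
    {a b : PTree (Fin n) →₀ K} (ha : a ∈ Finsupp.supported K K {t | (t.leaves.map d).sum = D})
    (hb : b ∈ Finsupp.supported K K {t | t.numVert = N}) :
    plugPlanar gr d x (PTree.nodeL K _ a b) =
      sgn K (N * D) • Trees.node (plugPlanar gr d x a) (plugPlanar gr d x b) := by
  rw [Finsupp.supported_eq_span_single] at ha hb
  refine Submodule.span_induction₂ (p := fun a b _ _ => plugPlanar gr d x (PTree.nodeL K _ a b) =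
      sgn K (N * D) • Trees.node (plugPlanar gr d x a) (plugPlanar gr d x b))
      ?_ ?_ ?_ ?_ ?_ ?_ ?_ ha hb
  · rintro _ _ ⟨s, hs, rfl⟩ ⟨t, ht, rfl⟩
    rw [PTree.nodeL_single]
    have hs' : (s.leaves.map d).sum = D := hs
    have ht' : t.numVert = N := ht
    simp only [plugPlanar, Finsupp.linearCombination_single, one_smul]
    rw [map_smul, map_smul, LinearMap.smul_apply, Trees.node_mk, smul_smul, smul_smul, ← sgn_add,
      ← sgn_add, insertSign, PTree.map, hs', ht']
    congr 2
    ring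
  · intros; simp
  · intros; simp
  · intro x y z _ _ _ h₁ h₂
    simp only [map_add, LinearMap.add_apply, h₁, h₂, smul_add]
  · intro x y z _ _ _ h₁ h₂
    simp only [map_add, h₁, h₂, smul_add]
  · intro c x y _ _ h
    simp only [map_smul, LinearMap.smul_apply, h, smul_comm c]
  · intro c x y _ _ h
    simp only [map_smul, h, smul_comm c]

/-- The exponent of the sign which relates the word in formal inputs to the word in elements of
degrees `d i`. -/
def wordSign {n : ℕ} (d : Fin n → ℤ) : List (Option (Fin n)) → ℤ
  | [] => 0
  | none :: u => wordSign d u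
  | some i :: u => wordSign d u + d i * u.reduceOption.length

theorem wordSign_append {n : ℕ} (d : Fin n → ℤ) (u₁ u₂ : List (Option (Fin n))) :
    wordSign d (u₁ ++ u₂) = wordSign d u₁ + wordSign d u₂ +
      (u₁.reduceOption.map d).sum * u₂.reduceOption.length := by
  induction u₁ with
  | nil => simp [wordSign]
  | cons o u ih =>
    cases o with
    | none => simp [wordSign, ih]
    | some i =>
      simp only [List.cons_append, wordSign, ih, List.reduceOption_append, List.length_append,
        List.reduceOption_cons_of_some, List.map_cons, List.sum_cons]
      push_cast
      ring

/-- Each `sξ` raises the degree of a word by two, so that it does not affect signs. -/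
theorem exists_wordDeg_treeLetter {A : Type v} (u : List (Option A)) :
    ∃ k : ℤ, wordDeg (u.map (treeLetter K)) = u.reduceOption.length - 1 + 2 * k := by
  induction u with
  | nil => exact ⟨0, rfl⟩
  | cons o u ih =>
    obtain ⟨k, hk⟩ := ih
    simp only [wordDeg] at hk
    cases o with
    | none =>
      refine ⟨k + 1, ?_⟩
      simp only [wordDeg, List.map_cons, List.sum_cons, List.reduceOption_cons_of_none, treeLetter]
      linarith
    | some a =>
      refine ⟨k, ?_⟩
      simp only [wordDeg, List.map_cons, List.sum_cons, List.reduceOption_cons_of_some, treeLetter,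
        List.length_cons]
      push_cast
      linarith

theorem wordDeg_letter {n : ℕ} (d : Fin n → ℤ) (x : Fin n → V) (u : List (Option (Fin n))) :
    wordDeg ((u.map (Option.map fun i => (d i, x i))).map (Trees.letter gr)) =
      wordDeg (u.map (treeLetter K)) + (u.reduceOption.map d).sum := by
  induction u with
  | nil => rfl
  | cons o u ih =>
    simp only [wordDeg] at ih
    cases o with
    | none =>
      simp only [wordDeg, List.map_cons, List.sum_cons, List.reduceOption_cons_of_none, treeLetter,
        Trees.letter, Option.map_none]
      linarith
    | some a =>
      simp only [wordDeg, List.map_cons, List.sum_cons, List.reduceOption_cons_of_some, treeLetter,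
        Trees.letter, Option.map_some]
      linarith

/-- Insertion of elements in a word in formal inputs gives the word in these elements, up to a sign
which is the same for all bracketings. -/
theorem plugPlanar_wordTree {n : ℕ} (d : Fin n → ℤ) (x : Fin n → V) (u : List (Option (Fin n))) :
    plugPlanar gr d x (wordTree K u) =
      sgn K (wordSign d u) • Trees.word gr (u.map (Option.map fun i => (d i, x i))) := by
  refine bracket_unique (node := Trees.node (gr := gr))
    (s := fun u₁ u₂ => sgn K (wordDeg (u₁.map (treeLetter K))) *
      sgn K (wordDeg (u₂.map (treeLetter K)) * (u₁.reduceOption.map d).sum))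
    (val := fun u => letterVal ((u.map (Option.map fun i => (d i, x i))).map (Trees.letter gr)))
    (G := fun u => plugPlanar gr d x (wordTree K u))
    (G' := fun u => sgn K (wordSign d u) • Trees.word gr (u.map (Option.map fun i => (d i, x i))))
    (map_zero _) (smul_zero _) (fun l _ => ?_) (fun l _ => ?_) u
  · rw [wordTree, bracket_eq, map_add, map_splitSum, splitSum_map]
    congr 1
    · rcases l with _ | ⟨_ | a, _ | ⟨b, l⟩⟩
      · exact map_zero _
      all_goals simp [letterVal, treeLetter, Trees.letter, plugPlanar, insertSign, sgn_zero,
        PTree.map]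
      all_goals rfl
    · refine splitSum_congr fun l₁ l₂ _ => ?_
      rw [map_smul, mul_smul]
      congr 1
      refine plugPlanar_nodeL gr d x (Finsupp.supported_mono ?_ (wordTree_mem K l₁))
        (Finsupp.supported_mono ?_ (wordTree_mem K l₂))
      · rintro t ⟨h, -⟩
        exact congrArg (fun l => (List.map d l).sum) h
      · rintro t ⟨-, h⟩
        exact h
  · rw [Trees.word, bracket_eq, smul_add, splitSum_map, splitSum_map]
    congr 1
    · rcases l with _ | ⟨_ | a, _ | ⟨b, l⟩⟩ <;>
        simp [letterVal, wordSign, sgn_zero]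
    · rw [← LinearMap.lsmul_apply, map_splitSum]
      refine splitSum_congr fun l₁ l₂ hl => ?_
      rw [LinearMap.lsmul_apply, ← hl, wordSign_append, wordDeg_letter]
      change _ • _ • Trees.node (Trees.word _ _) (Trees.word _ _) = _
      simp only [map_smul, LinearMap.smul_apply, smul_smul, ← sgn_add]
      congr 1
      obtain ⟨k, hk⟩ := exists_wordDeg_treeLetter (K := K) l₂
      refine sgn_eq ((l₁.reduceOption.map d).sum * (1 - k)) ?_
      rw [hk]
      ring

theorem permSign_finRange {n : ℕ} (d : Fin n → ℤ) : permSign d (List.finRange n) = 0 := by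
  have h : ∀ l : List (Fin n), l.Pairwise (· < ·) → permSign d l = 0 := by
    intro l hl
    induction hl with
    | nil => rfl
    | cons h _ ih =>
      rw [permSign, ih, add_zero]
      refine List.sum_eq_zero fun y hy => ?_
      obtain ⟨j, hj, rfl⟩ := List.mem_map.1 hy
      exact if_neg (h j hj).le.not_gt
  exact h _ (List.pairwise_lt_finRange n)

theorem plug_wordTree {n : ℕ} (d : Fin n → ℤ) (x : Fin n → V) {u : List (Option (Fin n))}
    (hu : u.reduceOption = List.finRange n) : plug gr d x (wordTree K u) =
      sgn K (wordSign d u) • Trees.word gr (u.map (Option.map fun i => (d i, x i))) := by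
  rw [← plugPlanar_wordTree, plug, plugPlanar, Finsupp.linearCombination_apply,
    Finsupp.linearCombination_apply]
  refine Finsupp.sum_congr fun t ht => ?_
  have := wordTree_mem K u ht
  rw [this.1, hu, permSign_finRange, zero_add]

/-- Every word is obtained by a substitution from a word in which the inputs appear once each, in
order. -/
theorem exists_eq_map {A : Type v} (w : List (Option A)) : ∃ (n : ℕ) (f : Fin n → A)
    (u : List (Option (Fin n))), u.reduceOption = List.finRange n ∧ w = u.map (Option.map f) := by
  induction w with
  | nil => exact ⟨0, Fin.elim0, [], rfl, rfl⟩
  | cons o w ih =>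
    obtain ⟨n, f, u, hu, rfl⟩ := ih
    cases o with
    | none => exact ⟨n, f, none :: u, hu, rfl⟩
    | some a =>
      refine ⟨n + 1, Fin.cons a f, some 0 :: u.map (Option.map Fin.succ), ?_, ?_⟩
      · rw [List.reduceOption_cons_of_some, List.reduceOption_map, hu, List.finRange_succ]
      · rw [List.map_cons, List.map_map]
        congr 1
        refine List.map_congr_left fun o _ => ?_
        cases o <;> simp

end Words

/-! ### The cooperad of words -/

section LieWords

variable (K : Type u) [Field K]

/-- The span of the words in which each of the inputs `1, …, n` appears once. -/
noncomputable def lieWords (n : ℕ) : Submodule K (StdTrees K n) :=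
  Submodule.span K {c | ∃ u : List (Option (Fin n)), u.reduceOption.Perm (List.finRange n) ∧
    c = opClass K n (wordTree K u)}

variable {K} {V : Type v} [AddCommGroup V] [Module K V] {gr : ℤ → Submodule K V}

/-- Words in elements of `V` arise from words in formal inputs by insertion. -/
theorem Trees.word_mem_comp {S : Submodule K V} {w : List (Option (ℤ × V))}
    (h : ∀ x, some x ∈ w → x.2 ∈ S ∧ x.2 ∈ gr x.1) : word gr w ∈ comp (lieWords K) gr S := by
  obtain ⟨n, f, u, hu, rfl⟩ := exists_eq_map w
  have h' := plug_wordTree gr (fun i => (f i).1) (fun i => (f i).2) hu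
  have : word gr (u.map (Option.map f)) = sgn K (wordSign (fun i => (f i).1) u) •
      plug gr (fun i => (f i).1) (fun i => (f i).2) (wordTree K u) := by
    rw [h', sgn_smul_sgn_smul]
  rw [this]
  refine Submodule.smul_mem _ _ (Submodule.subset_span ⟨n, _, _, _, fun t ht => ?_,
    Submodule.subset_span ⟨u, hu ▸ List.Perm.refl _, rfl⟩, fun i => ?_, rfl⟩)
  · have := wordTree_mem K u ht
    rw [PTree.IsLabelled, this.1, hu]
  · refine h (f i) ?_
    have : i ∈ u.reduceOption := by rw [hu]; exact List.mem_finRange i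
    exact List.mem_map.2 ⟨some i, List.reduceOption_mem_iff.1 this, rfl⟩

/-- By multilinearity of bracketings, it is enough to consider words whose letters belong to
spanning sets. -/
theorem bracket_mem_of_span {M : Type v} [AddCommGroup M] [Module K M]
    {node : M →ₗ[K] M →ₗ[K] M} {T : Submodule K M} {A : ℤ → Set M}
    (h : ∀ l : List (ℤ × M), (∀ a ∈ l, a.2 ∈ A a.1) → bracket node l ∈ T) (l : List (ℤ × M))
    (hl : ∀ a ∈ l, a.2 ∈ Submodule.span K (A a.1)) : bracket node l ∈ T := by
  suffices H : ∀ s p : List (ℤ × M), (∀ a ∈ p, a.2 ∈ A a.1) →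
      (∀ a ∈ s, a.2 ∈ Submodule.span K (A a.1)) → bracket node (p ++ s) ∈ T from
    H l [] (by simp) hl
  intro s
  induction s with
  | nil =>
    intro p hp _
    rw [List.append_nil]
    exact h p hp
  | cons a s ih =>
    intro p hp hs
    have hlin := bracket_linear node p s a.1
    have h₀ : bracket node (p ++ (a.1, 0) :: s) = 0 := by
      simpa using hlin 1 0 0
    have key : Submodule.span K (A a.1) ≤
        T.comap ({ toFun := fun b => bracket node (p ++ (a.1, b) :: s)
                   map_add' := fun b c => by simpa using hlin 1 b c
                   map_smul' := fun c b => by simpa [h₀] using hlin c b 0 } : M →ₗ[K] M) := by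
      refine Submodule.span_le.2 fun b hb => ?_
      have := ih (p ++ [(a.1, b)]) (fun c hc => ?_) (fun c hc => hs c (List.mem_cons_of_mem _ hc))
      · rw [List.append_assoc] at this
        exact this
      · rcases List.mem_append.1 hc with hc | hc
        · exact hp c hc
        · rw [List.mem_singleton.1 hc]
          exact hb
    exact key (hs a List.mem_cons_self)

variable (gr) in
/-- The elements which are admissible as letters of degree `d`: elements of `S` of degree `d` and,
in degree `1`, the tree `sξ`. -/
def Trees.letters (S : Submodule K V) (d : ℤ) : Set (Trees gr) :=
  {y | (∃ x ∈ S, x ∈ gr d ∧ y = ι x) ∨ (d = 1 ∧ y = cork gr)}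

theorem Trees.bracket_mem_comp {S : Submodule K V} {l : List (ℤ × Trees gr)}
    (hl : ∀ a ∈ l, a.2 ∈ Submodule.span K (letters gr S a.1)) :
    bracket node l ∈ comp (lieWords K) gr S := by
  refine bracket_mem_of_span (A := letters gr S) (fun l hl => ?_) l hl
  have : ∃ w : List (Option (ℤ × V)), (∀ x, some x ∈ w → x.2 ∈ S ∧ x.2 ∈ gr x.1) ∧
      l = w.map (letter gr) := by
    induction l with
    | nil => exact ⟨[], by simp, rfl⟩
    | cons a l ih =>
      obtain ⟨w, hw, rfl⟩ := ih fun b hb => hl b (List.mem_cons_of_mem _ hb)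
      rcases hl a List.mem_cons_self with ⟨x, hx, hx', h⟩ | ⟨h, h'⟩
      · refine ⟨some (a.1, x) :: w, fun y hy => ?_, ?_⟩
        · rcases List.mem_cons.1 hy with hy | hy
          · rw [Option.some_inj.1 hy]
            exact ⟨hx, hx'⟩
          · exact hw y hy
        · rw [List.map_cons, letter, ← h]
      · refine ⟨none :: w, fun y hy => hw y (by simpa using hy), ?_⟩
        rw [List.map_cons, letter, ← h', ← h]
  obtain ⟨w, hw, rfl⟩ := this
  exact word_mem_comp hw

/-! ### The decomposition of words -/

variable (gr) in
open Classical in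
/-- The letter of `𝕋(W) ∘ 𝕋(W) ∘ V` given by a block of letters: the word in these letters,
together with `sξ` on the lower level in case the block is `sξ`. -/
noncomputable def Trees.blockLetter (b : List (Option (ℤ × V))) : ℤ × Trees (deg gr) :=
  (wordDeg (b.map (letter gr)), ι (word gr b) + if b = [none] then cork (deg gr) else 0)

theorem Trees.wordDeg_blockLetter (P : List (List (Option (ℤ × V)))) :
    wordDeg (P.map (blockLetter gr)) = wordDeg (P.flatten.map (letter gr)) := by
  induction P with
  | nil => rfl
  | cons b P ih =>
    rw [List.flatten_cons, List.map_append, wordDeg_append, ← ih, ← List.singleton_append,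
      List.map_append, wordDeg_append]
    congr 2
    exact wordDeg_singleton _

open Classical in
/-- The degrafting of a word is the sum over all ways to cut it into blocks of the word in these
blocks. -/
theorem Trees.decomp_word (w : List (Option (ℤ × V))) : decomp gr (word gr w) =
    blockSum (fun P => bracket node (P.map (blockLetter gr))) w := by
  refine bracket_unique (node := node (gr := deg gr))
    (s := fun w₁ _ => sgn K (wordDeg (w₁.map (letter gr)))) (val := fun w => (blockLetter gr w).2)
    (G := fun w => decomp gr (word gr w))
    (G' := blockSum fun P => bracket node (P.map (blockLetter gr)))
    (map_zero _) rfl (fun l _ => ?_) (fun l hl => ?_) w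
  · have h₁ : decomp gr (letterVal (l.map (letter gr))) = ι (letterVal (l.map (letter gr))) +
        if l = [none] then cork (deg gr) else 0 := by
      rcases l with _ | ⟨_ | a, _ | ⟨b, l⟩⟩ <;>
        simp [letterVal, letter, decomp_cork', decomp_ι]
    rw [blockLetter, word, bracket_eq, map_add, h₁, map_add, map_splitSum, map_splitSum,
      splitSum_map, splitSum_map]
    simp only [map_smul, decomp_node', smul_add]
    rw [splitSum_add]
    simp only [word]
    abel
  · have h₁ : (fun P => bracket node (P.map (blockLetter gr))) = fun P =>
        letterVal (P.map (blockLetter gr)) + splitSum (fun P₁ P₂ =>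
          sgn K (wordDeg (P₁.map (blockLetter gr))) • node
            (bracket node (P₁.map (blockLetter gr))) (bracket node (P₂.map (blockLetter gr)))) P :=
      funext fun P => by rw [bracket_eq, splitSum_map]
    conv_lhs => rw [h₁]
    rw [blockSum_add, blockSum_splitSum]
    congr 1
    · cases l with
      | nil => exact absurd rfl hl
      | cons a l => exact blockAux_of_vanish (fun _ _ _ => rfl) _ _
    · refine splitSum_congr fun l₁ l₂ _ => ?_
      have h₂ : ∀ P₁ : List (List (Option (ℤ × V))), blockSum (fun P₂ =>
          sgn K (wordDeg (P₁.map (blockLetter gr))) •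
            node (bracket node (P₁.map (blockLetter gr)))
              (bracket node (P₂.map (blockLetter gr)))) l₂ =
          sgn K (wordDeg (P₁.map (blockLetter gr))) • node
            (bracket node (P₁.map (blockLetter gr)))
            (blockSum (fun P₂ => bracket node (P₂.map (blockLetter gr))) l₂) := fun P₁ =>
        (map_blockSum (sgn K (wordDeg (P₁.map (blockLetter gr))) • node
            (bracket node (P₁.map (blockLetter gr)))) _ l₂).symm
      simp only [h₂]
      rw [blockSum_congr (G := fun P₁ => sgn K (wordDeg (l₁.map (letter gr))) • node
            (bracket node (P₁.map (blockLetter gr)))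
            (blockSum (fun P₂ => bracket node (P₂.map (blockLetter gr))) l₂))
        (fun P hP => by rw [wordDeg_blockLetter, hP])]
      exact (map_blockSum (sgn K (wordDeg (l₁.map (letter gr))) • node.flip
        (blockSum (fun P₂ => bracket node (P₂.map (blockLetter gr))) l₂)) _ l₁).symm

open Classical in
theorem Trees.decomp_word_mem {S : Submodule K V} {w : List (Option (ℤ × V))}
    (h : ∀ x, some x ∈ w → x.2 ∈ S ∧ x.2 ∈ gr x.1) : decomp gr (word gr w) ∈
      comp (lieWords K) (deg gr) (comp (lieWords K) gr S) := by
  rw [decomp_word, blockSum_congr (G := fun P => if P.flatten = w then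
    bracket node (P.map (blockLetter gr)) else 0) (fun P hP => by rw [if_pos hP])]
  refine blockSum_mem (fun P => ?_) w
  split_ifs with hP
  · refine bracket_mem_comp fun a ha => ?_
    obtain ⟨b, hb, rfl⟩ := List.mem_map.1 ha
    have hb' : ∀ x, some x ∈ b → x.2 ∈ S ∧ x.2 ∈ gr x.1 := fun x hx =>
      h x (hP ▸ List.mem_flatten.2 ⟨b, hb, hx⟩)
    refine add_mem (Submodule.subset_span (.inl ⟨_, word_mem_comp hb',
      word_mem gr fun x hx => (hb' x hx).2, rfl⟩)) ?_
    split_ifs with hn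
    · refine Submodule.subset_span (.inr ⟨?_, rfl⟩)
      simp [blockLetter, hn, wordDeg_singleton, letter]
    · exact zero_mem _
  · exact zero_mem _

/-! ### Words form a quadratic sub-cooperad -/

theorem opClass_mem_ops {n : ℕ} {c : PTree (Fin n) →₀ K} (hc : ∀ t ∈ c.support, t.IsLabelled) :
    opClass K n c ∈ ops K n := by
  rw [opClass, Finsupp.linearCombination_apply]
  exact Submodule.sum_mem _ fun t ht =>
    Submodule.smul_mem _ _ (Submodule.subset_span ⟨t, hc t ht, rfl⟩)

theorem funLeft_inp {n : ℕ} (σ : Equiv.Perm (Fin n)) (i : Fin n) :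
    LinearMap.funLeft K K σ (inp K i) = inp K (σ⁻¹ i) := by
  ext j
  simp only [LinearMap.funLeft_apply, inp, Pi.single_apply]
  exact if_congr (by rw [Equiv.Perm.eq_inv_iff_eq]) rfl rfl

theorem relabel_wordTree {n : ℕ} (σ : Equiv.Perm (Fin n)) (u : List (Option (Fin n))) :
    relabel σ (opClass K n (wordTree K u)) =
      opClass K n (wordTree K (u.map (Option.map ⇑σ⁻¹))) := by
  rw [opClass_wordTree, opClass_wordTree, relabel, Trees.map_word, List.map_map, List.map_map]
  congr 1
  refine List.map_congr_left fun o _ => ?_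
  cases o <;> simp [funLeft_inp]

theorem isSubcooperad_lieWords : IsSubcooperad (lieWords K) where
  le_ops n := by
    refine Submodule.span_le.2 ?_
    rintro _ ⟨u, hu, rfl⟩
    refine opClass_mem_ops fun t ht => ?_
    have := wordTree_mem K u ht
    rw [PTree.IsLabelled, this.1]
    exact hu
  relabel_mem n σ := by
    have : lieWords K n ≤ (lieWords K n).comap (relabel σ) := by
      refine Submodule.span_le.2 ?_
      rintro _ ⟨u, hu, rfl⟩
      rw [SetLike.mem_coe, Submodule.mem_comap, relabel_wordTree]
      refine Submodule.subset_span ⟨_, ?_, rfl⟩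
      rw [List.reduceOption_map]
      refine (hu.map _).trans ?_
      rw [List.perm_ext_iff_of_nodup ((List.nodup_finRange n).map σ⁻¹.injective)
        (List.nodup_finRange n)]
      exact fun i => ⟨fun _ => List.mem_finRange i,
        fun _ => List.mem_map.2 ⟨σ i, List.mem_finRange _, by simp⟩⟩
    exact this
  graded n := by
    refine Submodule.span_le.2 ?_
    rintro _ ⟨u, hu, rfl⟩
    refine Submodule.mem_iSup_of_mem _ ⟨Submodule.subset_span ⟨u, hu, rfl⟩,
      (opClass_wordTree K u).symm ▸ Trees.word_mem _ fun x hx => ?_⟩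
    obtain ⟨o, -, ho⟩ := List.mem_map.1 hx
    obtain ⟨i, -, rfl⟩ := Option.map_eq_some_iff.1 ho
    simp [stdGr]
  decomp_mem n := by
    have : lieWords K n ≤ (comp (lieWords K) (Trees.deg (stdGr K n))
        (comp (lieWords K) (stdGr K n) ⊤)).comap (Trees.decomp (stdGr K n)) := by
      refine Submodule.span_le.2 ?_
      rintro _ ⟨u, hu, rfl⟩
      rw [SetLike.mem_coe, Submodule.mem_comap, opClass_wordTree]
      refine Trees.decomp_word_mem fun x hx => ?_
      obtain ⟨o, -, ho⟩ := List.mem_map.1 hx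
      obtain ⟨i, -, rfl⟩ := Option.map_eq_some_iff.1 ho
      simp [stdGr]
    exact this

/-- A linear combination of trees with `m` vertices is concentrated in weight `m`. -/
theorem weight_opClass {n : ℕ} {k : ℕ} {m : ℤ} {c : PTree (Fin n) →₀ K}
    (hc : ∀ t ∈ c.support, t.numVert = m) :
    Trees.weight (stdGr K n) k (opClass K n c) = if m = k then opClass K n c else 0 := by
  rw [opClass, Finsupp.linearCombination_apply, Finsupp.sum, map_sum]
  have : ∀ t ∈ c.support, Trees.weight (stdGr K n) k (c t • Trees.mk (stdGr K n) (t.map (inp K))) =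
      if m = k then c t • Trees.mk (stdGr K n) (t.map (inp K)) else 0 := fun t ht => by
    rw [map_smul, Trees.weight_mk, PTree.vertices_map, ← hc t ht, PTree.numVert_eq, smul_ite,
      smul_zero]
    simp only [Nat.cast_inj]
  rw [Finset.sum_congr rfl this]
  split_ifs <;> simp

/-- The words of weight two are `sμ(sξ, i)`, `sμ(i, sξ)` and the associators of `i, j, k`, up to
sign. -/
theorem word_mem_quadRel {n : ℕ} {u : List (Option (Fin n))}
    (hu : u.reduceOption.Perm (List.finRange n)) (hd : wordDeg (u.map (treeLetter K)) = 2) :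
    opClass K n (wordTree K u) ∈ quadRel K n := by
  have hnd : u.reduceOption.Nodup := hu.nodup_iff.2 (List.nodup_finRange n)
  have hmem : ∀ i, i ∈ u.reduceOption := fun i => hu.mem_iff.2 (List.mem_finRange i)
  have hpos : ∀ l : List (Option (Fin n)), 0 ≤ ((l.map (treeLetter K)).map fun a => a.1 + 1).sum :=
    fun l => List.sum_nonneg fun y hy => by
      obtain ⟨a, ha, rfl⟩ := List.mem_map.1 hy
      obtain ⟨o, -, rfl⟩ := List.mem_map.1 ha
      cases o <;> simp [treeLetter]
  have hdeg : ∀ o : Option (Fin n), (treeLetter K o).1 = 0 ∨ (treeLetter K o).1 = 1 := fun o => by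
    cases o <;> simp [treeLetter]
  have hunit : ∀ i : Fin n, (∀ j, j ∈ [i]) → unitRel K i ∈ quadRel K n := fun i hi =>
    Submodule.subset_span (.inr ⟨List.Nodup.getEquivOfForallMemList [i] (by simp) hi, rfl⟩)
  rw [opClass_wordTree]
  rcases u with _ | ⟨a, _ | ⟨b, _ | ⟨c, _ | ⟨e, l⟩⟩⟩⟩
  · simp [wordDeg] at hd
  · have := hdeg a
    simp [wordDeg] at hd
    omega
  · cases a <;> cases b
    · simp [wordDeg, treeLetter] at hd
    · rename_i i
      have : Trees.word (stdGr K n) ([none, some i].map (Option.map fun i => (0, inp K i))) =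
          -unitRel K i := by
        simp only [Trees.word, List.map_cons, List.map_nil, bracket_pair, Option.map_none,
          Option.map_some, Trees.letter, sgn_one, neg_one_smul]
        rw [unitRel, ← Trees.node_mk]
        rfl
      rw [this]
      exact neg_mem (hunit i hmem)
    · rename_i i
      have : Trees.word (stdGr K n) ([some i, none].map (Option.map fun i => (0, inp K i))) =
          unitRel K i := by
        simp only [Trees.word, List.map_cons, List.map_nil, bracket_pair, Option.map_none,
          Option.map_some, Trees.letter, sgn_zero, one_smul]
        rw [Trees.node_comm (m := 0) (n := 1) (Trees.ι_mem (by simp [stdGr])) Trees.cork_mem,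
          zero_mul, sgn_zero, one_smul, unitRel, ← Trees.node_mk]
        rfl
      rw [this]
      exact hunit i hmem
    · simp [wordDeg, treeLetter] at hd
  · cases a <;> cases b <;> cases c
    any_goals
      simp [wordDeg, treeLetter] at hd
      done
    rename_i i j k
    have : Trees.word (stdGr K n) ([some i, some j, some k].map
        (Option.map fun i => (0, inp K i))) = -assocRel K i j k := by
      simp only [Trees.word, List.map_cons, List.map_nil, bracket_triple, bracket_pair,
        Option.map_some, Trees.letter, sgn_zero, one_smul, zero_add, sgn_one, neg_one_smul]
      rw [assocRel, ← Trees.node_mk, ← Trees.node_mk, ← Trees.node_mk, ← Trees.node_mk, neg_sub,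
        ← sub_eq_add_neg]
      rfl
    rw [this]
    exact neg_mem (Submodule.subset_span (.inl
      ⟨List.Nodup.getEquivOfForallMemList [i, j, k] hnd hmem, rfl⟩))
  -- A word with at least four letters has at least three vertices.
  · have h₁ := hdeg a
    have h₂ := hdeg b
    have h₃ := hdeg c
    have h₄ := hdeg e
    have h₅ := hpos l
    simp only [wordDeg, List.map_cons, List.sum_cons] at hd
    omega

/-- The words span a part of `uCom^¡`, by finality of the latter. -/
theorem isQuadratic_lieWords : IsQuadratic (lieWords K) where
  toIsSubcooperad := isSubcooperad_lieWords
  weight_mem n := by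
    have : lieWords K n ≤ (quadRel K n).comap (Trees.weight (stdGr K n) 2) := by
      refine Submodule.span_le.2 ?_
      rintro _ ⟨u, hu, rfl⟩
      rw [SetLike.mem_coe, Submodule.mem_comap,
        weight_opClass fun t ht => (wordTree_mem K u ht).2]
      split_ifs with h
      · exact word_mem_quadRel hu h
      · exact zero_mem _
    exact this

/-- Bracketings of words whose letters are elements of `S` and `sξ` belong to `uCom^¡ ∘ S`. -/
theorem Trees.bracket_mem_uComDual {S : Submodule K V} {l : List (ℤ × Trees gr)}
    (hl : ∀ a ∈ l, a.2 ∈ Submodule.span K (letters gr S a.1)) :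
    bracket node l ∈ comp (uComDual K) gr S :=
  comp_mono (le_uComDual isQuadratic_lieWords) le_rfl (bracket_mem_comp hl)

end LieWords

/-! ### Iterated sums along a binary splitting -/

section IterSum

variable {X : Type v} {M : Type w} [AddCommMonoid M] (rep : X → List (X × X))

/-- The sum of `F l t` over the results of `n` successive splittings of an element: at each step,
the last element is split in two by `rep`. Here `t` is the last element in the end, and `l` is the
list of the elements which precede it. -/
def iterSum : ℕ → (List X → X → M) → X → M
  | 0, F, a => F [] a
  | n + 1, F, a => ((rep a).map fun p => iterSum n (fun l t => F (p.1 :: l) t) p.2).sum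

@[simp] theorem iterSum_zero (F : List X → X → M) (a : X) : iterSum rep 0 F a = F [] a := rfl

variable {rep}

theorem iterSum_congr {P : X → Prop} (hP : ∀ a, P a → ∀ p ∈ rep a, P p.1 ∧ P p.2) {n : ℕ}
    {F G : List X → X → M} {a : X} (ha : P a)
    (h : ∀ l t, l.length = n → (∀ y ∈ l, P y) → P t → F l t = G l t) :
    iterSum rep n F a = iterSum rep n G a := by
  induction n generalizing F G a with
  | zero => exact h [] a rfl (by simp) ha
  | succ n ih =>
    rw [iterSum, iterSum]
    congr 1
    refine List.map_congr_left fun p hp => ih (hP a ha p hp).2 fun l t hl hl' ht => ?_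
    refine h _ t (by rw [List.length_cons, hl]) (fun y hy => ?_) ht
    rcases List.mem_cons.1 hy with rfl | hy
    · exact (hP a ha p hp).1
    · exact hl' y hy

theorem map_iterSum {N : Type*} [AddCommMonoid N] {A : Type*} [FunLike A M N]
    [AddMonoidHomClass A M N] (φ : A) (n : ℕ) (F : List X → X → M) (a : X) :
    φ (iterSum rep n F a) = iterSum rep n (fun l t => φ (F l t)) a := by
  induction n generalizing F a with
  | zero => rfl
  | succ n ih =>
    rw [iterSum, iterSum, map_list_sum, List.map_map]
    congr 1
    exact List.map_congr_left fun p _ => ih _ _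

theorem iterSum_mem {R : Type*} [Semiring R] [Module R M] {S : Submodule R M} {P : X → Prop}
    (hP : ∀ a, P a → ∀ p ∈ rep a, P p.1 ∧ P p.2) {n : ℕ} {F : List X → X → M} {a : X} (ha : P a)
    (h : ∀ l t, (∀ y ∈ l, P y) → P t → F l t ∈ S) : iterSum rep n F a ∈ S := by
  induction n generalizing F a with
  | zero => exact h [] a (by simp) ha
  | succ n ih =>
    refine list_sum_mem fun y hy => ?_
    obtain ⟨p, hp, rfl⟩ := List.mem_map.1 hy
    refine ih (hP a ha p hp).2 fun l t hl ht => h _ t (fun y hy => ?_) ht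
    rcases List.mem_cons.1 hy with rfl | hy
    · exact (hP a ha p hp).1
    · exact hl y hy

/-- To cut the list of the elements split off in two amounts to performing the splittings in two
stages. -/
theorem iterSum_splitSum (n : ℕ) (H : List X → List X → X → M) (a : X) :
    iterSum rep n (fun l t => splitSum (fun l₁ l₂ => H l₁ l₂ t) l) a =
      ∑ p ∈ Finset.HasAntidiagonal.antidiagonal n,
        iterSum rep p.1 (fun l₁ s => iterSum rep p.2 (fun l₂ t => H l₁ l₂ t) s) a := by
  induction n generalizing H a with
  | zero => simp [iterSum, splitSum]
  | succ n ih =>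
    rw [Finset.Nat.sum_antidiagonal_succ]
    change ((rep a).map fun p => iterSum rep n (fun l t => H [] (p.1 :: l) t +
      splitSum (fun l₁ l₂ => H (p.1 :: l₁) l₂ t) l) p.2).sum = _
    have hadd : ∀ (F G : List X → X → M) (b : X),
        iterSum rep n (fun l t => F l t + G l t) b = iterSum rep n F b + iterSum rep n G b := by
      intro F G b
      clear ih
      induction n generalizing F G b with
      | zero => rfl
      | succ n ih => simp only [iterSum, ih, List.sum_map_add]
    simp only [hadd, ih]
    rw [List.sum_map_add]
    congr 1
    simp only [iterSum]
    induction rep a with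
    | nil => simp
    | cons p l ihl => simp only [List.map_cons, List.sum_cons, ihl, Finset.sum_add_distrib]

end IterSum

/-! ### Iterated brackets and words -/

namespace Trees

variable {K : Type u} [Field K] {D : GMod.{u, v} K}

section

variable {f g : D →ₗ[K] Trees D.gr} (hf : ∀ n, ∀ x ∈ D.gr n, f x ∈ deg D.gr n)
  (hg : ∀ n, ∀ x ∈ D.gr n, g x ∈ deg D.gr n)
include hf hg

theorem braT_map_mem {n : ℤ} {t : D ⊗[K] D} (ht : t ∈ D.susp.tensorGr (n + 1)) :
    braT D (TensorProduct.map f g t) ∈ deg D.gr n := by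
  have : D.susp.tensorGr (n + 1) ≤
      (deg D.gr n).comap (braT D ∘ₗ TensorProduct.map f g) := by
    refine Submodule.span_le.2 ?_
    rintro _ ⟨p, q, x, y, hpq, hx, hy, rfl⟩
    have := bra_mem D (hf (p - 1) x hx) (hg (q - 1) y hy)
    rwa [show p - 1 + (q - 1) + 1 = n by omega] at this
  exact this ht

end

theorem linPart_mem {θ : D →ₗ[K] K} (hθ : ∀ n, ∀ x ∈ D.gr n, n ≠ 1 → θ x = 0) {n : ℤ} {x : D}
    (hx : x ∈ D.gr n) : linPart θ x ∈ deg D.gr n := by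
  rw [linPart_apply]
  refine add_mem (ι_mem hx) ?_
  by_cases hn : n = 1
  · rw [hn]
    exact Submodule.smul_mem _ _ cork_mem
  · rw [hθ n x hx hn, zero_smul]
    exact zero_mem _

theorem linPart_mem_span_letters {θ : D →ₗ[K] K} (hθ : ∀ n, ∀ x ∈ D.gr n, n ≠ 1 → θ x = 0) {n : ℤ}
    {x : D} (hx : x ∈ D.gr n) : linPart θ x ∈ Submodule.span K (letters D.gr ⊤ n) := by
  rw [linPart_apply]
  refine add_mem (Submodule.subset_span (.inl ⟨x, trivial, hx, rfl⟩)) ?_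
  by_cases hn : n = 1
  · exact Submodule.smul_mem _ _ (Submodule.subset_span (.inr ⟨hn, rfl⟩))
  · rw [hθ n x hx hn, zero_smul]
    exact zero_mem _

section Dynkin

variable {δ : D →ₗ[K] D ⊗[K] D} {θ : D →ₗ[K] K}
  (hδ : ∀ n, ∀ x ∈ D.gr n, δ x ∈ D.susp.tensorGr (n + 1))

section

include hδ

theorem recComp_mem (hθ : ∀ n, ∀ x ∈ D.gr n, n ≠ 1 → θ x = 0) (k : ℕ) (n : ℤ) (x : D)
    (hx : x ∈ D.gr n) : recComp δ (linPart θ) (braT D) k x ∈ deg D.gr n := by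
  induction k using Nat.strong_induction_on generalizing n x with
  | _ k ih =>
    cases k with
    | zero =>
      rw [recComp_zero]
      exact linPart_mem hθ hx
    | succ k =>
      rw [recComp_succ, LinearMap.sum_apply]
      refine Submodule.sum_mem _ fun p hp => ?_
      have hp := Finset.HasAntidiagonal.mem_antidiagonal.1 hp
      exact braT_map_mem (ih p.1 (by omega)) (ih p.2 (by omega)) (hδ n x hx)

/-- To apply `δ` to the first factor, after an exchange, amounts to applying it to the second factor
and moving the other factor through the result. -/
theorem lTensor_swap (t : D ⊗[K] D) : δ.lTensor D (D.susp.swap t) =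
    (TensorProduct.assoc K D D D) (D.susp.swap.rTensor D ((TensorProduct.assoc K D D D).symm
      (D.susp.swap.lTensor D ((TensorProduct.assoc K D D D) (δ.rTensor D t))))) := by
  have h : δ.lTensor D ∘ₗ D.susp.swap = (TensorProduct.assoc K D D D).toLinearMap ∘ₗ
      D.susp.swap.rTensor D ∘ₗ (TensorProduct.assoc K D D D).symm.toLinearMap ∘ₗ
      D.susp.swap.lTensor D ∘ₗ (TensorProduct.assoc K D D D).toLinearMap ∘ₗ δ.rTensor D := by
    refine tensor_ext_of_iSup D.iSup_gr fun m n x hx y hy => ?_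
    have key : D.susp.tensorGr (m + 1) ≤ LinearMap.eqLocus
        ((TensorProduct.assoc K D D D).toLinearMap ∘ₗ
          D.susp.swap.rTensor D ∘ₗ (TensorProduct.assoc K D D D).symm.toLinearMap ∘ₗ
          D.susp.swap.lTensor D ∘ₗ (TensorProduct.assoc K D D D).toLinearMap ∘ₗ
          (TensorProduct.mk K (D ⊗[K] D) D).flip y)
        (sgn K ((m + 1) * (n + 1)) • TensorProduct.mk K D (D ⊗[K] D) y) := by
      refine Submodule.span_le.2 ?_
      rintro _ ⟨p, q, a, b, hpq, ha, hb, rfl⟩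
      rw [SetLike.mem_coe, LinearMap.mem_eqLocus]
      simp only [LinearMap.comp_apply, LinearMap.flip_apply, TensorProduct.mk_apply,
        LinearEquiv.coe_coe, TensorProduct.assoc_tmul, LinearMap.lTensor_tmul,
        D.susp.swap_tmul hb (D.mem_susp hy), TensorProduct.tmul_smul, map_smul,
        TensorProduct.assoc_symm_tmul, LinearMap.rTensor_tmul,
        D.susp.swap_tmul ha (D.mem_susp hy), LinearMap.smul_apply]
      rw [← TensorProduct.smul_tmul', map_smul, TensorProduct.assoc_tmul, smul_smul, ← sgn_add,
        ← hpq]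
      congr 2
      ring
    have := key (hδ m x hx)
    rw [LinearMap.mem_eqLocus] at this
    rw [LinearMap.comp_apply, D.susp_swap_tmul hx hy, map_smul, LinearMap.lTensor_tmul]
    exact this.symm
  exact LinearMap.congr_fun h t

variable (hanti : D.susp.swap ∘ₗ δ = -δ)
  (hjac : (TensorProduct.assoc K D D D).toLinearMap ∘ₗ δ.rTensor D ∘ₗ δ = δ.lTensor D ∘ₗ δ +
    D.susp.swap.lTensor D ∘ₗ (TensorProduct.assoc K D D D).toLinearMap ∘ₗ δ.rTensor D ∘ₗ δ)
include hanti hjac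

/-- The co-Jacobi identity, solved for the cobracket of the first factor. -/
theorem rTensor_cobracket (x : D) : δ.rTensor D (δ x) =
    (TensorProduct.assoc K D D D).symm (δ.lTensor D (δ x)) -
      D.susp.swap.rTensor D ((TensorProduct.assoc K D D D).symm (δ.lTensor D (δ x))) := by
  have h₁ := lTensor_swap hδ (δ x)
  have h₂ : D.susp.swap (δ x) = -δ x := LinearMap.congr_fun hanti x
  have h₃ : (TensorProduct.assoc K D D D) (δ.rTensor D (δ x)) = δ.lTensor D (δ x) +
    D.susp.swap.lTensor D ((TensorProduct.assoc K D D D) (δ.rTensor D (δ x))) :=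
    LinearMap.congr_fun hjac x
  have h₄ : D.susp.swap.rTensor D (δ.rTensor D (δ x)) = -δ.rTensor D (δ x) := by
    rw [← LinearMap.comp_apply, ← LinearMap.rTensor_comp, hanti, LinearMap.rTensor_neg]
    rfl
  rw [← sub_eq_iff_eq_add'] at h₃
  rw [h₂, map_neg, ← h₃, map_sub, map_sub, LinearEquiv.symm_apply_apply, h₄] at h₁
  have h₅ := congrArg (TensorProduct.assoc K D D D).symm h₁
  rw [map_neg, LinearEquiv.symm_apply_apply] at h₅
  rw [eq_sub_iff_add_eq, ← neg_inj, neg_add', h₅]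

end

/-- The sum of all bracketings of a word in elements `x + θ(x) sξ`. -/
noncomputable def linWord (θ : D →ₗ[K] K) (l : List (ℤ × D)) : Trees D.gr :=
  bracket node (l.map fun a => (a.1, linPart θ a.2))

theorem linWord_mem (hθ : ∀ n, ∀ x ∈ D.gr n, n ≠ 1 → θ x = 0) {l : List (ℤ × D)}
    (hl : ∀ a ∈ l, a.2 ∈ D.gr a.1) : linWord θ l ∈ deg D.gr (wordDeg l) := by
  refine bracket_mem node (g := fun a : ℤ × D => (a.1, linPart θ a.2)) (l := l)
    (S := fun l : List (ℤ × D) => deg D.gr (wordDeg l)) (fun a ha => ?_) ?_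
  · rw [wordDeg_singleton]
    exact linPart_mem hθ (hl a ha)
  · intro l₁ l₂ a ha b hb
    rw [wordDeg_append]
    exact node_mem ha hb

theorem linWord_eq (hθ : ∀ n, ∀ x ∈ D.gr n, n ≠ 1 → θ x = 0) {l : List (ℤ × D)}
    (hl : ∀ a ∈ l, a.2 ∈ D.gr a.1) (hlen : 2 ≤ l.length) :
    linWord θ l = splitSum (fun l₁ l₂ => bra D (linWord θ l₁) (linWord θ l₂)) l := by
  rw [linWord, bracket_eq, letterVal_eq_zero (by simpa using hlen), zero_add, splitSum_map]
  refine splitSum_congr fun l₁ l₂ h => ?_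
  rw [bra_apply D (linWord_mem hθ fun a ha => hl a (h ▸ List.mem_append_left _ ha))]
  have : wordDeg (l₁.map fun a => (a.1, linPart θ a.2)) = wordDeg l₁ := by
    simp [wordDeg, Function.comp_def]
  rw [this]
  rfl

variable {rep : ℤ × D → List ((ℤ × D) × (ℤ × D))}
  (hrep : ∀ a : ℤ × D, a.2 ∈ D.gr a.1 → ∀ p ∈ rep a, p.1.2 ∈ D.gr p.1.1 ∧ p.2.2 ∈ D.gr p.2.1)
  (hsum : ∀ a : ℤ × D, a.2 ∈ D.gr a.1 →
    ((rep a).map fun p => p.1.2 ⊗ₜ[K] p.2.2).sum = (2 : K) • δ a.2)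
  (hθ : ∀ n, ∀ x ∈ D.gr n, n ≠ 1 → θ x = 0)
  (hanti : D.susp.swap ∘ₗ δ = -δ)
  (hjac : (TensorProduct.assoc K D D D).toLinearMap ∘ₗ δ.rTensor D ∘ₗ δ = δ.lTensor D ∘ₗ δ +
    D.susp.swap.lTensor D ∘ₗ (TensorProduct.assoc K D D D).toLinearMap ∘ₗ δ.rTensor D ∘ₗ δ)
include hδ hrep hsum hθ hanti hjac

/-- The words in the elements which are split off from `x` by iterating `2 δ` on the right compute
the solution of the recursion on the first factor of `2 δ x`. -/
theorem iterSum_linWord_tmul (k : ℕ) (a : ℤ × D) (ha : a.2 ∈ D.gr a.1) :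
    iterSum rep (k + 1) (fun l t => linWord θ l ⊗ₜ[K] t.2) a =
      TensorProduct.map (recComp δ (linPart θ) (braT D) k) LinearMap.id ((2 : K) • δ a.2) := by
  induction k using Nat.strong_induction_on generalizing a with
  | _ k ih =>
    cases k with
    | zero =>
      rw [← hsum a ha, map_list_sum, List.map_map, recComp_zero]
      simp only [iterSum]
      congr 1
      refine List.map_congr_left fun p _ => ?_
      simp [linWord]
    | succ k =>
      rw [iterSum_congr (P := fun a => a.2 ∈ D.gr a.1) hrep ha (G := fun l t =>
        splitSum (fun l₁ l₂ => bra D (linWord θ l₁) (linWord θ l₂) ⊗ₜ[K] t.2) l)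
        (fun l t hl hl' _ => by
          rw [linWord_eq hθ hl' (by omega)]
          exact map_splitSum ((TensorProduct.mk K (Trees D.gr) D).flip t.2) _ l),
        iterSum_splitSum, Finset.Nat.sum_antidiagonal_succ, Finset.Nat.sum_antidiagonal_succ']
      have hz : ∀ n b, iterSum rep n (fun _ _ => (0 : Trees D.gr ⊗[K] D)) b = 0 := fun n b =>
        (map_iterSum (0 : Trees D.gr ⊗[K] D →ₗ[K] Trees D.gr ⊗[K] D) n (fun _ _ => 0) b).symm
      have hn : linWord θ [] = 0 := rfl
      simp only [iterSum_zero, hn, map_zero, LinearMap.zero_apply, TensorProduct.zero_tmul, hz,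
        zero_add]
      set A := recComp δ (linPart θ) (braT D) with hA
      -- Both sides are sums of the terms `sμ(A_i, A_j)` on the first two factors.
      have hL : ∀ p ∈ Finset.HasAntidiagonal.antidiagonal k,
          iterSum rep (p.1 + 1) (fun l₁ s => iterSum rep (p.2 + 1)
            (fun l₂ t => bra D (linWord θ l₁) (linWord θ l₂) ⊗ₜ[K] t.2) s) a =
          (4 : K) • (braT D).rTensor D (TensorProduct.map (TensorProduct.map (A p.1) (A p.2))
            LinearMap.id ((TensorProduct.assoc K D D D).symm (δ.lTensor D (δ a.2)))) := by
        intro p hp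
        have hp := Finset.HasAntidiagonal.mem_antidiagonal.1 hp
        rw [iterSum_congr (P := fun a => a.2 ∈ D.gr a.1) hrep ha (G := fun l t =>
          ((braT D).rTensor D ∘ₗ (TensorProduct.assoc K _ _ _).symm.toLinearMap ∘ₗ
            TensorProduct.map LinearMap.id
              (TensorProduct.map (A p.2) LinearMap.id ∘ₗ ((2 : K) • δ))) (linWord θ l ⊗ₜ[K] t.2))
          (fun l t _ _ ht => ?_), ← map_iterSum, ih p.1 (by omega) a ha]
        · have hnat : ∀ t : D ⊗[K] D, ((braT D).rTensor D ∘ₗ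
              (TensorProduct.assoc K _ _ _).symm.toLinearMap ∘ₗ TensorProduct.map LinearMap.id
              (TensorProduct.map (A p.2) LinearMap.id ∘ₗ ((2 : K) • δ)))
              (TensorProduct.map (A p.1) LinearMap.id t) =
              (2 : K) • (braT D).rTensor D (TensorProduct.map (TensorProduct.map (A p.1) (A p.2))
                LinearMap.id ((TensorProduct.assoc K D D D).symm (δ.lTensor D t))) := by
            intro t
            induction t with
            | zero => simp
            | add x y hx hy => simp only [map_add, smul_add, hx, hy]
            | tmul x y =>
              simp only [LinearMap.comp_apply, TensorProduct.map_tmul, LinearMap.id_apply,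
                LinearMap.smul_apply, LinearMap.lTensor_tmul, LinearEquiv.coe_coe, map_smul,
                TensorProduct.tmul_smul]
              congr 2
              induction δ y with
              | zero => simp
              | add x y hx hy => simp only [map_add, TensorProduct.tmul_add, hx, hy]
              | tmul y z => simp
          rw [hnat, map_smul, map_smul, map_smul, map_smul, smul_smul]
          norm_num
        · have := congrArg (((braT D).rTensor D ∘ₗ
            (TensorProduct.assoc K _ _ _).symm.toLinearMap) ∘ₗ
            TensorProduct.mk K (Trees D.gr) (Trees D.gr ⊗[K] D) (linWord θ l))
            (ih p.2 (by omega) t ht)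
          rw [map_iterSum] at this
          exact this
      rw [Finset.sum_congr rfl hL, ← Finset.smul_sum, map_smul, hA, recComp_succ, ← hA]
      have hswap : ∀ i j (t : D ⊗[K] D ⊗[K] D), (braT D).rTensor D
          (TensorProduct.map (TensorProduct.map (A i) (A j)) LinearMap.id
            (D.susp.swap.rTensor D t)) = -(braT D).rTensor D
          (TensorProduct.map (TensorProduct.map (A j) (A i)) LinearMap.id t) := by
        intro i j t
        induction t with
        | zero => simp
        | add x y hx hy => rw [map_add, map_add, map_add, hx, hy, map_add, map_add, neg_add]
        | tmul x y =>
          rw [LinearMap.rTensor_tmul, TensorProduct.map_tmul, LinearMap.rTensor_tmul,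
            braT_map_swap D (recComp_mem hδ hθ i) (recComp_mem hδ hθ j), TensorProduct.neg_tmul]
          rfl
      have hR : TensorProduct.map (∑ p ∈ Finset.HasAntidiagonal.antidiagonal k,
          braT D ∘ₗ TensorProduct.map (A p.1) (A p.2) ∘ₗ δ) LinearMap.id (δ a.2) =
          ∑ p ∈ Finset.HasAntidiagonal.antidiagonal k,
            ((braT D).rTensor D (TensorProduct.map (TensorProduct.map (A p.1) (A p.2))
              LinearMap.id ((TensorProduct.assoc K D D D).symm (δ.lTensor D (δ a.2)))) +
            (braT D).rTensor D (TensorProduct.map (TensorProduct.map (A p.2) (A p.1))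
              LinearMap.id ((TensorProduct.assoc K D D D).symm (δ.lTensor D (δ a.2))))) := by
        have hs : TensorProduct.map (∑ p ∈ Finset.HasAntidiagonal.antidiagonal k,
            braT D ∘ₗ TensorProduct.map (A p.1) (A p.2) ∘ₗ δ) LinearMap.id (δ a.2) =
            ∑ p ∈ Finset.HasAntidiagonal.antidiagonal k, (braT D).rTensor D
              (TensorProduct.map (TensorProduct.map (A p.1) (A p.2)) LinearMap.id
                (δ.rTensor D (δ a.2))) := by
          induction δ a.2 with
          | zero => simp
          | add x y hx hy => simp only [map_add, hx, hy, Finset.sum_add_distrib]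
          | tmul x y => simp [TensorProduct.sum_tmul]
        rw [hs, rTensor_cobracket hδ hanti hjac]
        refine Finset.sum_congr rfl fun p _ => ?_
        rw [map_sub, map_sub, hswap, sub_neg_eq_add]
      rw [hR, Finset.sum_add_distrib]
      have hsym : ∀ f : ℕ → ℕ → Trees D.gr ⊗[K] D,
          ∑ p ∈ Finset.HasAntidiagonal.antidiagonal k, f p.2 p.1 =
            ∑ p ∈ Finset.HasAntidiagonal.antidiagonal k, f p.1 p.2 := fun f =>
        Finset.Nat.sum_antidiagonal_swap (f := fun p => f p.1 p.2)
      rw [hsym fun i j => (braT D).rTensor D (TensorProduct.map (TensorProduct.map (A i) (A j))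
        LinearMap.id ((TensorProduct.assoc K D D D).symm (δ.lTensor D (δ a.2)))), ← two_smul K,
        smul_smul]
      norm_num

/-- The homogeneous components of the solution of the recursion are obtained, up to a scalar, by
iterating `2 δ` on the right and taking the sum of all bracketings of the resulting words. This is
dual to the Dynkin-Specht-Wever formula. The scaling of `δ` by `2` makes the scalar equal to
`k + 1`; otherwise powers of `2` would appear. -/
theorem iterSum_linWord (k : ℕ) (a : ℤ × D) (ha : a.2 ∈ D.gr a.1) :
    iterSum rep k (fun l t => linWord θ (l ++ [t])) a =
      ((k : K) + 1) • recComp δ (linPart θ) (braT D) k a.2 := by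
  induction k using Nat.strong_induction_on generalizing a with
  | _ k ih =>
    cases k with
    | zero => simp [iterSum, linWord, recComp_zero]
    | succ k =>
      have hn : linWord θ [] = 0 := rfl
      rw [iterSum_congr (P := fun a => a.2 ∈ D.gr a.1) hrep ha (G := fun l t =>
        splitSum (fun l₁ l₂ => bra D (linWord θ l₁) (linWord θ (l₂ ++ [t]))) l)
        (fun l t hl hl' ht => by
          rw [linWord_eq hθ (fun y hy => by
            rcases List.mem_append.1 hy with hy | hy
            · exact hl' y hy
            · rw [List.mem_singleton.1 hy]
              exact ht) (by simp [hl]), splitSum_append_cons, splitSum, hn, map_zero, add_zero]),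
        iterSum_splitSum, Finset.Nat.sum_antidiagonal_succ]
      have hz : ∀ n b, iterSum rep n (fun _ _ => (0 : Trees D.gr)) b = 0 := fun n b =>
        (map_iterSum (0 : Trees D.gr →ₗ[K] Trees D.gr) n (fun _ _ => 0) b).symm
      simp only [iterSum_zero, hn, map_zero, LinearMap.zero_apply, hz, zero_add]
      set A := recComp δ (linPart θ) (braT D) with hA
      have hL : ∀ p ∈ Finset.HasAntidiagonal.antidiagonal k,
          iterSum rep (p.1 + 1) (fun l₁ s => iterSum rep p.2
            (fun l₂ t => bra D (linWord θ l₁) (linWord θ (l₂ ++ [t]))) s) a =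
          ((2 : K) * (p.2 + 1)) • braT D (TensorProduct.map (A p.1) (A p.2) (δ a.2)) := by
        intro p hp
        have hp := Finset.HasAntidiagonal.mem_antidiagonal.1 hp
        rw [iterSum_congr (P := fun a => a.2 ∈ D.gr a.1) hrep ha (G := fun l t =>
          (braT D ∘ₗ TensorProduct.map LinearMap.id (((p.2 : K) + 1) • A p.2))
            (linWord θ l ⊗ₜ[K] t.2))
          (fun l t _ _ ht => ?_), ← map_iterSum,
          iterSum_linWord_tmul hδ hrep hsum hθ hanti hjac p.1 a ha, LinearMap.comp_apply, ← hA,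
          ← LinearMap.comp_apply (TensorProduct.map _ _) (TensorProduct.map _ _),
          ← TensorProduct.map_comp, LinearMap.id_comp, LinearMap.comp_id,
          TensorProduct.map_smul_right, LinearMap.smul_apply, map_smul, map_smul, map_smul,
          smul_smul, mul_comm]
        have := congrArg (bra D (linWord θ l)) (ih p.2 (by omega) t ht)
        rw [map_iterSum] at this
        exact this
      have hsym : ∀ i j, braT D (TensorProduct.map (A i) (A j) (δ a.2)) =
          braT D (TensorProduct.map (A j) (A i) (δ a.2)) := by
        intro i j
        have h₁ : D.susp.swap (δ a.2) = -δ a.2 := LinearMap.congr_fun hanti a.2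
        have h₂ := braT_map_swap D (recComp_mem hδ hθ i) (recComp_mem hδ hθ j) (δ a.2)
        rw [h₁, map_neg, map_neg, neg_inj] at h₂
        exact h₂
      have hflip : ∑ p ∈ Finset.HasAntidiagonal.antidiagonal k, ((p.2 : K) + 1) •
          braT D (TensorProduct.map (A p.1) (A p.2) (δ a.2)) =
          ∑ p ∈ Finset.HasAntidiagonal.antidiagonal k, ((p.1 : K) + 1) •
            braT D (TensorProduct.map (A p.1) (A p.2) (δ a.2)) := by
        rw [← Finset.Nat.sum_antidiagonal_swap]
        exact Finset.sum_congr rfl fun p _ => by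
          rw [Prod.fst_swap, Prod.snd_swap, hsym]
      rw [Finset.sum_congr rfl hL, hA, recComp_succ, ← hA, LinearMap.sum_apply, Finset.smul_sum]
      simp only [mul_smul]
      rw [← Finset.smul_sum, two_smul]
      nth_rewrite 1 [hflip]
      rw [← Finset.sum_add_distrib]
      refine Finset.sum_congr rfl fun p hp => ?_
      have hp := Finset.HasAntidiagonal.mem_antidiagonal.1 hp
      rw [← add_smul, ← hp]
      push_cast
      rw [show (p.1 : K) + 1 + (p.2 + 1) = p.1 + p.2 + 1 + 1 by ring]
      rfl

end Dynkin

/-- Homogeneous representatives of tensors. -/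
theorem exists_rep {n : ℤ} {t : D ⊗[K] D} (ht : t ∈ D.susp.tensorGr n) :
    ∃ L : List ((ℤ × D) × (ℤ × D)), (∀ p ∈ L, p.1.2 ∈ D.gr p.1.1 ∧ p.2.2 ∈ D.gr p.2.1) ∧
      (L.map fun p => p.1.2 ⊗ₜ[K] p.2.2).sum = t := by
  induction ht using Submodule.span_induction with
  | mem t ht =>
    obtain ⟨p, q, x, y, -, hx, hy, rfl⟩ := ht
    exact ⟨[((p - 1, x), (q - 1, y))], by simpa using ⟨hx, hy⟩, by simp⟩
  | zero => exact ⟨[], by simp, by simp⟩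
  | add s t _ _ hs ht =>
    obtain ⟨L, hL, rfl⟩ := hs
    obtain ⟨L', hL', rfl⟩ := ht
    refine ⟨L ++ L', fun p hp => ?_, by simp⟩
    rcases List.mem_append.1 hp with hp | hp
    · exact hL p hp
    · exact hL' p hp
  | smul c t _ ht =>
    obtain ⟨L, hL, rfl⟩ := ht
    refine ⟨L.map fun p => ((p.1.1, c • p.1.2), p.2), fun p hp => ?_, ?_⟩
    · obtain ⟨q, hq, rfl⟩ := List.mem_map.1 hp
      exact ⟨Submodule.smul_mem _ _ (hL q hq).1, (hL q hq).2⟩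
    · rw [List.map_map, List.smul_sum, List.map_map]
      rfl

/-- For a curved Lie coalgebra, the solution of the recursion has values in `uCom^¡ ∘ D`: in
characteristic zero, the scalar in `iterSum_linWord` can be divided out. -/
theorem recComp_mem_comp [CharZero K] {δ : D →ₗ[K] D ⊗[K] D} {θ : D →ₗ[K] K}
    (hδ : ∀ n, ∀ x ∈ D.gr n, δ x ∈ D.susp.tensorGr (n + 1))
    (hθ : ∀ n, ∀ x ∈ D.gr n, n ≠ 1 → θ x = 0) (hanti : D.susp.swap ∘ₗ δ = -δ)
    (hjac : (TensorProduct.assoc K D D D).toLinearMap ∘ₗ δ.rTensor D ∘ₗ δ = δ.lTensor D ∘ₗ δ +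
      D.susp.swap.lTensor D ∘ₗ (TensorProduct.assoc K D D D).toLinearMap ∘ₗ δ.rTensor D ∘ₗ δ)
    (k : ℕ) {n : ℤ} {x : D} (hx : x ∈ D.gr n) :
    recComp δ (linPart θ) (braT D) k x ∈ comp (uComDual K) D.gr ⊤ := by
  have : ∀ a : ℤ × D, ∃ L : List ((ℤ × D) × (ℤ × D)), a.2 ∈ D.gr a.1 →
      (∀ p ∈ L, p.1.2 ∈ D.gr p.1.1 ∧ p.2.2 ∈ D.gr p.2.1) ∧
      (L.map fun p => p.1.2 ⊗ₜ[K] p.2.2).sum = (2 : K) • δ a.2 := fun a => by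
    by_cases ha : a.2 ∈ D.gr a.1
    · obtain ⟨L, hL⟩ := exists_rep (Submodule.smul_mem _ (2 : K) (hδ _ _ ha))
      exact ⟨L, fun _ => hL⟩
    · exact ⟨[], fun h => absurd h ha⟩
  choose rep hrep using this
  have h := iterSum_linWord hδ (fun a ha => (hrep a ha).1) (fun a ha => (hrep a ha).2) hθ hanti
    hjac k (n, x) hx
  have hk : ((k : K) + 1) ≠ 0 := by exact_mod_cast k.succ_ne_zero
  rw [← Submodule.smul_mem_iff _ hk]
  rw [← h]
  refine iterSum_mem (P := fun a => a.2 ∈ D.gr a.1) (fun a ha => (hrep a ha).1) hx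
    fun l t hl ht => ?_
  refine bracket_mem_uComDual fun a ha => ?_
  obtain ⟨b, hb, rfl⟩ := List.mem_map.1 ha
  refine linPart_mem_span_letters hθ ?_
  rcases List.mem_append.1 hb with hb | hb
  · exact hl b hb
  · rw [List.mem_singleton.1 hb]
    exact ht

end Trees

/-! ### The coalgebra of a curved Lie coalgebra -/

namespace Trees

section Levels

variable {K : Type u} [Field K] (D : GMod.{u, v} K)

/-- The involution `t ↦ (-1) ^ |t| t` of `𝕋(W) ∘ 𝕋(W) ∘ D`. -/
noncomputable def parity₂ : Trees (deg D.gr) →ₗ[K] Trees (deg D.gr) :=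
  lift (grB := deg (deg D.gr))
    { cork := -cork (deg D.gr)
      node := -node
      cork_mem := neg_mem cork_mem
      node_mem := fun ha hb => neg_mem (node_mem ha hb)
      node_comm := fun ha hb => by
        simp only [LinearMap.neg_apply, smul_neg, ← node_comm ha hb] }
    (ι ∘ₗ parity D) (fun _ _ hx => ι_mem (parity_mem D hx))

theorem parity₂_apply {n : ℤ} {x : Trees (deg D.gr)} (hx : x ∈ deg (deg D.gr) n) :
    parity₂ D x = sgn K n • x := by
  have : deg (deg D.gr) n ≤ LinearMap.eqLocus (parity₂ D) (sgn K n • LinearMap.id) := by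
    refine Submodule.span_le.2 ?_
    rintro _ ⟨t, ht, rfl⟩
    simp only [SetLike.mem_coe, LinearMap.mem_eqLocus, LinearMap.smul_apply, LinearMap.id_apply]
    rw [parity₂, lift_mk]
    clear hx
    induction ht with
    | leaf h =>
      simp only [eval, LinearMap.comp_apply, parity_apply D h, map_smul]
      rfl
    | cork =>
      simp only [eval, sgn_one, neg_one_smul]
      rfl
    | node ha hb iha ihb =>
      simp only [eval, iha, ihb, map_smul, LinearMap.neg_apply, LinearMap.smul_apply, sgn_add,
        sgn_one, smul_neg, mul_neg, mul_one, neg_smul, smul_smul]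
      rw [← node_mk, mul_comm]
  exact this hx

/-- Grafting of suspended trees of trees, as a map on the tensor product. -/
noncomputable def braT₂ :
    Trees (deg D.gr) ⊗[K] Trees (deg D.gr) →ₗ[K] Trees (deg D.gr) :=
  TensorProduct.lift (node ∘ₗ parity₂ D)

variable {D}

theorem decomp_mem {n : ℤ} {a : Trees D.gr} (ha : a ∈ deg D.gr n) :
    decomp D.gr a ∈ deg (deg D.gr) n :=
  (Submodule.mem_prod.1 (lift_mem (decompAlg D.gr) (LinearMap.prod ι (ι ∘ₗ ι))
    (fun _ _ hx => Submodule.mem_prod.2 ⟨ι_mem hx, ι_mem (ι_mem hx)⟩) ha)).2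

theorem decomp_braT (t : Trees D.gr ⊗[K] Trees D.gr) : decomp D.gr (braT D t) =
    ι (braT D t) + braT₂ D (TensorProduct.map (decomp D.gr) (decomp D.gr) t) := by
  have : decomp D.gr ∘ₗ braT D = ι ∘ₗ braT D +
      braT₂ D ∘ₗ TensorProduct.map (decomp D.gr) (decomp D.gr) :=
    tensor_ext_of_iSup (iSup_deg D) fun m n a ha b _ => by
      simp only [LinearMap.comp_apply, LinearMap.add_apply, TensorProduct.map_tmul, braT_tmul,
        braT₂, TensorProduct.lift.tmul, bra_apply D ha, parity₂_apply D (decomp_mem ha), map_smul,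
        LinearMap.smul_apply, decomp_node', smul_add]
  exact LinearMap.congr_fun this t

theorem map_braT_braT₂ {Δ : D →ₗ[K] Trees D.gr} (hΔ : ∀ n, ∀ x ∈ D.gr n, Δ x ∈ deg D.gr n)
    (t : Trees D.gr ⊗[K] Trees D.gr) : map Δ hΔ (braT D t) =
      braT₂ D (TensorProduct.map (map Δ hΔ) (map Δ hΔ) t) := by
  have : map Δ hΔ ∘ₗ braT D = braT₂ D ∘ₗ TensorProduct.map (map Δ hΔ) (map Δ hΔ) :=
    tensor_ext_of_iSup (iSup_deg D) fun m n a ha b _ => by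
      simp only [LinearMap.comp_apply, TensorProduct.map_tmul, braT_tmul,
        braT₂, TensorProduct.lift.tmul, bra_apply D ha, parity₂_apply D (map_mem Δ hΔ ha),
        map_smul, LinearMap.smul_apply, map_node]
  exact LinearMap.congr_fun this t

end Levels

section Recursion

variable {K : Type u} [Field K] {D : GMod.{u, v} K} {Δ : D →ₗ[K] Trees D.gr}
  (hΔ : ∀ n, ∀ x ∈ D.gr n, Δ x ∈ deg D.gr n) {δ : D →ₗ[K] D ⊗[K] D} {θ : D →ₗ[K] K}
  (hrec : Δ = linPart θ + braT D ∘ₗ TensorProduct.map Δ Δ ∘ₗ δ) (hconil : IsConilp δ)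
include hrec hconil

/-- Both sides of the coassociativity relation solve the same recursion. -/
theorem coassoc_of_recursion : decomp D.gr ∘ₗ Δ = map Δ hΔ ∘ₗ Δ := by
  refine hconil.unique (κ := ι ∘ₗ Δ + LinearMap.toSpanSingleton K _ (cork (deg D.gr)) ∘ₗ θ)
    (m := braT₂ D) (LinearMap.ext fun x => ?_) (LinearMap.ext fun x => ?_)
  · have h := LinearMap.congr_fun hrec x
    rw [LinearMap.add_apply, LinearMap.comp_apply, linPart_apply] at h
    rw [LinearMap.comp_apply, h, map_add, map_add, map_smul, decomp_ι, decomp_cork', decomp_braT,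
      LinearMap.add_apply, LinearMap.add_apply, LinearMap.comp_apply ι, h, map_add, map_add,
      map_smul, TensorProduct.map_comp]
    simp only [LinearMap.comp_apply, LinearMap.toSpanSingleton_apply, smul_add]
    abel
  · have h := LinearMap.congr_fun hrec x
    rw [LinearMap.add_apply, LinearMap.comp_apply, linPart_apply] at h
    rw [LinearMap.comp_apply, h, map_add, map_add, map_smul, map_ι, map_cork, map_braT_braT₂,
      LinearMap.add_apply, LinearMap.add_apply, TensorProduct.map_comp]
    rfl

/-- The difference of both sides of the coderivation relation solves a homogeneous linear
recursion. -/
theorem coderivation_of_recursion [CharZero K] {d : D →ₗ[K] D}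
    (hΔ : ∀ n, ∀ x ∈ D.gr n, Δ x ∈ deg D.gr n)
    (hd : ∀ n, ∀ x ∈ D.gr n, d x ∈ D.gr (n - 1)) (hδd : δ ∘ₗ d = D.tensorDer d ∘ₗ δ)
    (hθd : θ ∘ₗ d = 0) : Δ ∘ₗ d = der D d hd ∘ₗ Δ := by
  have hder : ∀ t, der D d hd (braT D t) =
      braT D (TensorProduct.map (der D d hd) LinearMap.id t) -
        braT D (TensorProduct.map (parity D) (der D d hd) t) := fun t => by
    have : der D d hd ∘ₗ braT D = braT D ∘ₗ TensorProduct.map (der D d hd) LinearMap.id -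
        braT D ∘ₗ TensorProduct.map (parity D) (der D d hd) :=
      tensor_ext_of_iSup (iSup_deg D) fun m n a ha b _ => der_bra D hd ha b
    exact LinearMap.congr_fun this t
  have hpar : Δ ∘ₗ D.susp.parity = -(parity D ∘ₗ Δ) :=
    lin_ext_of_iSup D.iSup_gr fun n x hx => by
      rw [LinearMap.comp_apply, D.susp_parity, LinearMap.neg_apply, LinearMap.neg_apply,
        D.parity_apply hx, LinearMap.comp_apply, parity_apply D (hΔ n x hx), map_neg, map_smul]
  rw [← sub_eq_zero]
  refine hconil.eq_zero (U := Δ) (U' := Δ ∘ₗ D.susp.parity) (m := braT D) (m' := braT D)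
    (LinearMap.ext fun x => ?_)
  have h₁ := LinearMap.congr_fun hrec (d x)
  have h₂ := LinearMap.congr_fun hrec x
  have h₃ : δ (d x) = D.tensorDer d (δ x) := LinearMap.congr_fun hδd x
  have h₄ : θ (d x) = 0 := LinearMap.congr_fun hθd x
  rw [LinearMap.add_apply, LinearMap.comp_apply, linPart_apply] at h₁ h₂
  rw [LinearMap.sub_apply, LinearMap.comp_apply, LinearMap.comp_apply, h₁, h₂, map_add, map_add,
    map_smul, der_ι, der_cork, hder, h₄, LinearMap.comp_apply, h₃]
  simp only [LinearMap.add_apply, LinearMap.comp_apply, zero_smul, smul_zero, add_zero]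
  rw [add_sub_add_left_eq_sub]
  have h₅ : ∀ t, TensorProduct.map Δ Δ (D.tensorDer d t) = TensorProduct.map (Δ ∘ₗ d) Δ t +
      TensorProduct.map (Δ ∘ₗ D.susp.parity) (Δ ∘ₗ d) t := fun t => by
    rw [GMod.tensorDer, LinearMap.add_apply, map_add, TensorProduct.map_comp,
      ← LinearMap.comp_apply, ← TensorProduct.map_comp, LinearMap.comp_id]
    rfl
  rw [h₅, ← LinearMap.comp_apply (TensorProduct.map _ _) (TensorProduct.map _ _),
    ← TensorProduct.map_comp, ← LinearMap.comp_apply (TensorProduct.map (parity D) _)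
    (TensorProduct.map _ _), ← TensorProduct.map_comp, LinearMap.id_comp, hpar,
    ← neg_one_smul K (parity D ∘ₗ Δ), TensorProduct.map_smul_left, TensorProduct.map_smul_left,
    sub_eq_add_neg (Δ ∘ₗ d), ← neg_one_smul K (der D d hd ∘ₗ Δ), TensorProduct.map_add_left,
    TensorProduct.map_add_right, TensorProduct.map_smul_left, TensorProduct.map_smul_right]
  simp only [LinearMap.add_apply, LinearMap.smul_apply, map_add, map_smul]
  module

end Recursion

end Trees

namespace UComDualCog

open Trees

variable {K : Type u} [Field K] [CharZero K]

/-- A curved conilpotent Lie coalgebra structure on the suspension of `D` comes from a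
`uCom^¡`-coalgebra structure on `D`. -/
theorem exists_of_lie {D : GMod.{u, v} K} {δ : D →ₗ[K] D ⊗[K] D} {d : D →ₗ[K] D} {θ : D →ₗ[K] K}
    (hδ : ∀ n, ∀ x ∈ D.gr n, δ x ∈ D.susp.tensorGr (n + 1))
    (hd : ∀ n, ∀ x ∈ D.gr n, d x ∈ D.gr (n - 1)) (hθ : ∀ n, ∀ x ∈ D.gr n, n ≠ 1 → θ x = 0)
    (hanti : D.susp.swap ∘ₗ δ = -δ)
    (hjac : (TensorProduct.assoc K D D D).toLinearMap ∘ₗ δ.rTensor D ∘ₗ δ = δ.lTensor D ∘ₗ δ +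
      D.susp.swap.lTensor D ∘ₗ (TensorProduct.assoc K D D D).toLinearMap ∘ₗ δ.rTensor D ∘ₗ δ)
    (hδd : δ ∘ₗ d = D.tensorDer d ∘ₗ δ)
    (hcurv : d ∘ₗ d = ((TensorProduct.lid K D).toLinearMap ∘ₗ TensorProduct.map θ LinearMap.id -
      (TensorProduct.rid K D).toLinearMap ∘ₗ TensorProduct.map LinearMap.id θ) ∘ₗ δ)
    (hθd : θ ∘ₗ d = 0) (hconil : IsConilp δ) :
    ∃ (Δ : D →ₗ[K] Trees D.gr) (hΔ : ∀ n, ∀ x ∈ D.gr n, Δ x ∈ deg D.gr n),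
      (∀ x, Δ x ∈ comp (uComDual K) D.gr ⊤) ∧ Trees.counit D.gr ∘ₗ Δ = LinearMap.id ∧
      Trees.decomp D.gr ∘ₗ Δ = Trees.map Δ hΔ ∘ₗ Δ ∧ Δ ∘ₗ d = Trees.der D d hd ∘ₗ Δ ∧
      d ∘ₗ d = Trees.curv D ∘ₗ Δ ∧
      cobr D ∘ₗ Δ = δ ∧ corkCoeff D.gr ∘ₗ Δ = θ := by
  have hrec := hconil.sol_eq (κ := linPart θ) (m := braT D)
  have hsum : ∀ x : D, ∃ N, hconil.sol (linPart θ) (braT D) x =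
      ∑ n ∈ Finset.range N, recComp δ (linPart θ) (braT D) n x := fun x => by
    obtain ⟨N, hN⟩ := hconil.finite_support (κ := linPart θ) (m := braT D) x
    exact ⟨N, hconil.sol_eq_sum hN⟩
  generalize hconil.sol (linPart θ) (braT D) = Δ at hrec hsum
  have hΔ : ∀ n, ∀ x ∈ D.gr n, Δ x ∈ deg D.gr n := fun n x hx => by
    obtain ⟨N, hN⟩ := hsum x
    rw [hN]
    exact Submodule.sum_mem _ fun k _ => recComp_mem hδ hθ k n x hx
  have hcomp : ∀ x, Δ x ∈ comp (uComDual K) D.gr ⊤ := by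
    have : iSup D.gr ≤ (comp (uComDual K) D.gr ⊤).comap Δ := iSup_le fun n x hx => by
      obtain ⟨N, hN⟩ := hsum x
      rw [Submodule.mem_comap, hN]
      exact Submodule.sum_mem _ fun k _ => recComp_mem_comp hδ hθ hanti hjac k hx
    exact fun x => this (by rw [D.iSup_gr]; trivial)
  exact ⟨Δ, hΔ, hcomp, LinearMap.ext (counit_eq hrec), coassoc_of_recursion hΔ hrec hconil,
    coderivation_of_recursion hrec hconil hΔ hd hδd hθd, hcurv.trans (curv_eq hrec).symm,
    LinearMap.ext (cobr_eq hΔ hrec hanti), LinearMap.ext (corkCoeff_eq hrec)⟩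

instance : (lieFunctor.{u, v} K).EssSurj where
  mem_essImage C := by
    obtain ⟨V, δ, d, θ, δ_mem, d_mem, θ_apply, antisymm, coJacobi, coderivation, curvature, θ_d,
      conilpotent⟩ := C
    obtain ⟨D, rfl⟩ := V.exists_eq_susp
    have hd : ∀ n, ∀ x ∈ D.gr n, d x ∈ D.gr (n - 1) := fun n x hx => by
      have : d x ∈ D.gr (n + 1 - 1 - 1) := d_mem (D.mem_susp hx)
      rwa [add_sub_cancel_right] at this
    obtain ⟨Δ, h₁, h₂, h₃, h₄, h₅, h₆, rfl, rfl⟩ :=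
      exists_of_lie (D := D) (δ := δ) (d := d) (θ := θ) (fun n x hx => δ_mem (D.mem_susp hx)) hd
        (fun n x hx hn => θ_apply (D.mem_susp hx) (by omega)) antisymm coJacobi coderivation
        curvature θ_d conilpotent
    exact ⟨⟨D, Δ, d, h₁, hd, h₂, h₃, h₄, h₅, h₆⟩, ⟨Iso.refl _⟩⟩

instance : (lieFunctor.{u, v} K).IsEquivalence where

end UComDualCog

end CurvedKoszul

theorem mainTheorem11 (K : Type u) [Field K] [CharZero K] :
    ∃ E : CurvedKoszul.UComDualCog.{u, v} K ≌ CurvedKoszul.CLieCog.{u, v} K,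
      Nonempty (E.functor ⋙ CurvedKoszul.CLieCog.forget K ≅
        CurvedKoszul.UComDualCog.forget K ⋙ CurvedKoszul.GMod.suspension K) :=
  ⟨(CurvedKoszul.UComDualCog.lieFunctor K).asEquivalence, ⟨CategoryTheory.Iso.refl _⟩⟩
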